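/- **Setting.** Let $\Omega=[-1,1]$, let $\mathcal U\subset\mathbb R^m$ be closed and convex with nonempty interior, let $f:\mathbb R^n\times\mathbb R^m\to\mathbb R^n$ and $C:\mathbb R^n\to\mathbb R$ be continuous, and let $x_0\in\mathbb R^n$. Let $(x^*,u^*)\in C^1(\Omega;\mathbb R^n)\times C^0(\Omega;\mathbb R^m)$ be a local minimizer (in the norm topology of this space) of $$\min\ C(x(1))\quad\text{subject to}\quad \dot x(t)=f(x(t),u(t)),\ u(t)\in\mathcal U\ (t\in\Omega),\ x(-1)=x_0 .$$ Assume that there are an open set $\mathcal O\subset\mathbb R^{n+m}$ and $\rho>0$ such that, for all $t\in\Omega$, the closed ball of radius $\rho$ about $(x^*(t),u^*(t))$ lies in $\mathcal O$, and such that the first two derivatives of $f$ on $\mathcal O$, and of $C$ on the ball of radius $\rho$ about $x^*(1)$, exist and are Lipschitz continuous. With $H(x,u,\lambda)=\lambda^{\mathsf T}f(x,u)$, let $\lambda^*$ be the solution of $\dot\lambda^*=-\nabla_xH(x^*,u^*,\lambda^*)$ on $\Omega$, $\lambda^*(1)=\nabla C(x^*(1))$. For $N\ge1$ let $\tau_1<\dots<\tau_N$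 be the roots of the Legendre polynomial $P_N$, $\tau_0=-1$, $\tau_{N+1}=1$, and $\omega_i=2/[(1-\tau_i^2)P_N'(\tau_i)^2]$ for $1\le i\le N$. Let $D_{ij}=\dot L_j(\tau_i)$ ($1\le i\le N$, $0\le j\le N$), where $L_0,\dots,L_N$ are the Lagrange basis polynomials for $\tau_0,\dots,\tau_N$, and let $D^\dagger_{ij}=-(\omega_j/\omega_i)D_{ji}$ ($1\le i,j\le N$), $D^\dagger_{i,N+1}=-\sum_{j=1}^ND^\dagger_{ij}$. For $X=(X_0,\dots,X_{N+1})$ and $\Lambda=(\Lambda_0,\dots,\Lambda_{N+1})$ with entries in $\mathbb R^n$, and $U=(U_1,\dots,U_N)$ with entries in $\mathbb R^m$, define $\mathcal T(X,U,\Lambda)$ by $$\begin{aligned} \mathcal T_0&=X_0-x_0, & \mathcal T_{1i}&=\sum_{j=0}^ND_{ij}X_j-f(X_i,U_i),\\ \mathcal T_2&=X_{N+1}-X_0-\sum_{j=1}^N\omega_jf(X_j,U_j), & \mathcal T_3&=\Lambda_{N+1}-\Lambda_0+\sum_{i=1}^N\omega_i\nabla_xH(X_i,U_i,\Lambda_i),\\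 \mathcal T_{4i}&=\sum_{j=1}^{N+1}D^\dagger_{ij}\Lambda_j+\nabla_xH(X_i,U_i,\Lambda_i), & \mathcal T_5&=\Lambda_{N+1}-\nabla C(X_{N+1}),\\ \mathcal T_{6i}&=-\nabla_uH(X_i,U_i,\Lambda_i), \end{aligned}$$ where $1\le i\le N$. Let $\mathcal F(U)$ be the set of all $y=(y_0,\dots,y_6)$ with $y_0=\dots=y_5=0$ and $y_{6i}\in N_{\mathcal U}(U_i)$ for $1\le i\le N$, where $N_{\mathcal U}(u)=\{w: w^{\mathsf T}(v-u)\le0\ \text{for all } v\in\mathcal U\}$ if $u\in\mathcal U$ and $N_{\mathcal U}(u)=\emptyset$ otherwise. Put $$\|y\|_{\mathcal Y}=|y_0|+|y_2|+|y_3|+|y_5|+\|y_6\|_\infty+\|y_1\|_\omega+\|y_4\|_\omega,\qquad \|z\|_\omega=\Big(\sum_{i=1}^N\omega_i|z_i|^2\Big)^{1/2},$$ where $|\cdot|$ is the Euclidean norm and $\|y_6\|_\infty$ is the largest absolute value of an entry of $y_6$. Let $X^*=(x^*(\tau_j))_{0\le j\le N+1}$, $\Lambda^*=(\lambda^*(\tau_j))_{0\le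 j\le N+1}$ and $U^*=(u^*(\tau_i))_{1\le i\le N}$. For an integer $p\ge0$, $\mathcal H^p(\Omega;\mathbb R^n)$ is the Sobolev space of functions with square integrable weak derivatives through order $p$, with norm $\|g\|_{\mathcal H^p}=\big(\sum_{k=0}^p\int_\Omega|g^{(k)}|^2\,dt\big)^{1/2}$. **Lemma 4.1.** There is an absolute constant $c>0$ (in particular independent of $N$ and $\eta$) such that, in every setting as above, if $x^*,\lambda^*\in\mathcal H^\eta(\Omega;\mathbb R^n)$ for an integer $\eta\ge2$, then for every $N\ge1$ $$\operatorname{dist}\big[\mathcal T(X^*,U^*,\Lambda^*),\,\mathcal F(U^*)\big]\le\Big(\frac cN\Big)^{p-3/2}\big(\|x^*\|_{\mathcal H^p}+\|\lambda^*\|_{\mathcal H^p}\big),\qquad p=\min\{\eta,N+1\},$$ where the distance is taken with respect to $\|\cdot\|_{\mathcal Y}$. -/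

import Mathlib

open MeasureTheory

open scoped ContDiff ENNReal

noncomputable section

namespace GaussCollocation

/-- `ℝⁿ` with the Euclidean norm. -/
abbrev Vec (n : ℕ) : Type := EuclideanSpace ℝ (Fin n)

/-- The time interval `Ω = [-1, 1]`. -/
def Ω : Set ℝ := Set.Icc (-1) 1

/-! ### Sobolev spaces on `Ω` -/

/-- `h` is a weak derivative of order `k` of `g` on `Ω`:
`∫ φ⁽ᵏ⁾ g = (-1)ᵏ ∫ φ h` for all smooth `φ` compactly supported in `(-1, 1)`. -/
def HasWeakDeriv {n : ℕ} (k : ℕ) (g h : ℝ → Vec n) : Prop :=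
  ∀ φ : ℝ → ℝ, ContDiff ℝ ∞ φ → HasCompactSupport φ → tsupport φ ⊆ Set.Ioo (-1) 1 →
    ∫ t in Ω, iteratedDeriv k φ t • g t = (-1 : ℝ) ^ k • ∫ t in Ω, φ t • h t

/-- Membership in `H^p(Ω; ℝⁿ)`: the function is square integrable and has
square integrable weak derivatives through order `p`. -/
def MemSobolev {n : ℕ} (p : ℕ) (g : ℝ → Vec n) : Prop :=
  MemLp g 2 (volume.restrict Ω) ∧
    ∀ k ≤ p, ∃ h : ℝ → Vec n, MemLp h 2 (volume.restrict Ω) ∧ HasWeakDeriv k g h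

open Classical in
/-- The square integrable weak derivative of order `k` (unique up to null sets);
zero if there is none. -/
def weakDeriv {n : ℕ} (k : ℕ) (g : ℝ → Vec n) : ℝ → Vec n :=
  if hg : ∃ h : ℝ → Vec n, MemLp h 2 (volume.restrict Ω) ∧ HasWeakDeriv k g h
  then hg.choose else 0

/-- The norm of `H^p(Ω; ℝⁿ)`: `(∑_{k ≤ p} ∫_Ω |g⁽ᵏ⁾|²)^{1/2}`. -/
def sobolevNorm {n : ℕ} (p : ℕ) (g : ℝ → Vec n) : ℝ :=
  Real.sqrt (∑ k ∈ Finset.range (p + 1), ∫ t in Ω, ‖weakDeriv k g t‖ ^ 2)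

/-! ### The continuous control problem -/

/-- Feasibility for the control problem: `x ∈ C¹(Ω; ℝⁿ)`, `u ∈ C⁰(Ω; ℝᵐ)`,
`x' = f(x, u)` and `u ∈ U` on `Ω`, `x(-1) = x₀`. -/
structure IsFeasible {n m : ℕ} (f : Vec n × Vec m → Vec n) (U : Set (Vec m)) (x₀ : Vec n)
    (x : ℝ → Vec n) (u : ℝ → Vec m) : Prop where
  contDiffOn_state : ContDiffOn ℝ 1 x Ω
  continuousOn_control : ContinuousOn u Ω
  initial : x (-1) = x₀
  control_mem : ∀ t ∈ Ω, u t ∈ U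
  dynamics : ∀ t ∈ Ω, derivWithin x Ω t = f (x t, u t)

/-- `(x, u)` is a local minimizer of `C(x(1))` over the feasible pairs, with respect to the
norm topology of `C¹(Ω; ℝⁿ) × C⁰(Ω; ℝᵐ)`. -/
def IsLocalMinimizer {n m : ℕ} (f : Vec n × Vec m → Vec n) (C : Vec n → ℝ) (U : Set (Vec m))
    (x₀ : Vec n) (x : ℝ → Vec n) (u : ℝ → Vec m) : Prop :=
  IsFeasible f U x₀ x u ∧
    ∃ ε > 0, ∀ (y : ℝ → Vec n) (v : ℝ → Vec m), IsFeasible f U x₀ y v →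
      (∀ t ∈ Ω, ‖y t - x t‖ < ε ∧ ‖derivWithin y Ω t - derivWithin x Ω t‖ < ε ∧
        ‖v t - u t‖ < ε) →
      C (x 1) ≤ C (y 1)

/-- The first two derivatives of `g` exist and are Lipschitz continuous on the open set `S`
(hence they extend to Lipschitz functions on the closure of `S`). -/
def LipschitzDerivs {E F : Type*} [NormedAddCommGroup E] [NormedSpace ℝ E]
    [NormedAddCommGroup F] [NormedSpace ℝ F] (g : E → F) (S : Set E) : Prop :=
  ContDiffOn ℝ 2 g S ∧
    ∃ K : NNReal, LipschitzOnWith K (fderiv ℝ g) S ∧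
      LipschitzOnWith K (fderiv ℝ (fderiv ℝ g)) S

/-- Smoothness of the data near the trajectory `(x, u)`. -/
def SmoothNear {n m : ℕ} (f : Vec n × Vec m → Vec n) (C : Vec n → ℝ)
    (x : ℝ → Vec n) (u : ℝ → Vec m) : Prop :=
  ∃ (O : Set (Vec n × Vec m)) (ρ : ℝ), IsOpen O ∧ 0 < ρ ∧
    (∀ t ∈ Ω, Metric.closedBall (x t, u t) ρ ⊆ O) ∧
    LipschitzDerivs f O ∧ LipschitzDerivs C (Metric.ball (x 1) ρ)

/-- The Hamiltonian `H(x, u, λ) = λᵀ f(x, u)`. -/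
def hamiltonian {n m : ℕ} (f : Vec n × Vec m → Vec n) (x : Vec n) (u : Vec m) (l : Vec n) : ℝ :=
  inner ℝ l (f (x, u))

/-- `∇ₓ H(x, u, λ)`. -/
def gradX {n m : ℕ} (f : Vec n × Vec m → Vec n) (x : Vec n) (u : Vec m) (l : Vec n) : Vec n :=
  gradient (fun y => hamiltonian f y u l) x

/-- `∇ᵤ H(x, u, λ)`. -/
def gradU {n m : ℕ} (f : Vec n × Vec m → Vec n) (x : Vec n) (u : Vec m) (l : Vec n) : Vec m :=
  gradient (fun v => hamiltonian f x v l) u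

/-- `l` solves the costate equation `l' = -∇ₓ H(x, u, l)` on `Ω`, `l(1) = ∇C(x(1))`. -/
def IsCostate {n m : ℕ} (f : Vec n × Vec m → Vec n) (C : Vec n → ℝ)
    (x : ℝ → Vec n) (u : ℝ → Vec m) (l : ℝ → Vec n) : Prop :=
  (∀ t ∈ Ω, HasDerivWithinAt l (-gradX f (x t) (u t) (l t)) Ω t) ∧ l 1 = gradient C (x 1)

/-- The normal cone `N_U(u)`, empty when `u ∉ U`. -/
def normalCone {m : ℕ} (U : Set (Vec m)) (u : Vec m) : Set (Vec m) :=
  {w | u ∈ U ∧ ∀ v ∈ U, inner ℝ w (v - u) ≤ 0}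

/-! ### Gauss collocation -/

open Polynomial in
/-- The Legendre polynomial `P_N`, by Rodrigues' formula. -/
def legendre (N : ℕ) : ℝ[X] :=
  Polynomial.C (1 / ((2 : ℝ) ^ N * (N.factorial : ℝ))) * derivative^[N] ((X ^ 2 - 1) ^ N)

/-- The Gauss points `τ₁ < ⋯ < τ_N`: the roots of `P_N` in increasing order
(`gaussPoint N i` is `τ_{i+1}`). -/
def gaussPoint (N : ℕ) (i : Fin N) : ℝ :=
  ((legendre N).roots.sort (fun a b => a ≤ b)).getD i 0

/-- The Gauss quadrature weights `ω_i = 2 / ((1 - τ_i²) P_N'(τ_i)²)`. -/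
def gaussWeight (N : ℕ) (i : Fin N) : ℝ :=
  2 / ((1 - gaussPoint N i ^ 2) * ((legendre N).derivative.eval (gaussPoint N i)) ^ 2)

/-- The points `τ₀ = -1`, the Gauss points `τ₁, …, τ_N`, and `τ_{N+1} = 1`. -/
def node (N : ℕ) : Fin (N + 2) → ℝ :=
  Fin.cons (α := fun _ => ℝ) (-1) (Fin.snoc (α := fun _ => ℝ) (gaussPoint N) 1)

/-- The differentiation matrix `D_{ij} = L_j'(τ_i)`, `1 ≤ i ≤ N`, `0 ≤ j ≤ N`, where the `L_j`
are the Lagrange basis polynomials for `τ₀, …, τ_N`.  Row `i` here is the row `i + 1`. -/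
def diffMatrix (N : ℕ) : Matrix (Fin N) (Fin (N + 1)) ℝ := fun i j =>
  (Lagrange.basis Finset.univ (fun l : Fin (N + 1) => node N l.castSucc) j).derivative.eval
    (gaussPoint N i)

/-- The part `D†_{ij} = -(ω_j / ω_i) D_{ji}`, `1 ≤ i, j ≤ N`, of the matrix `D†`. -/
def adjMatrixInner (N : ℕ) : Matrix (Fin N) (Fin N) ℝ := fun i j =>
  -(gaussWeight N j / gaussWeight N i) * diffMatrix N j i.succ

/-- The matrix `D†_{ij}`, `1 ≤ i ≤ N`, `1 ≤ j ≤ N + 1` (both indices are shifted by one here);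
its last column is `D†_{i,N+1} = -∑_{j=1}^N D†_{ij}`. -/
def adjMatrix (N : ℕ) : Matrix (Fin N) (Fin (N + 1)) ℝ := fun i =>
  Fin.snoc (α := fun _ => ℝ) (adjMatrixInner N i) (-∑ j, adjMatrixInner N i j)

/-- The space `𝒴 = ℝⁿ × ℝ^{nN} × ℝⁿ × ℝⁿ × ℝ^{nN} × ℝⁿ × ℝ^{mN}`. -/
@[ext]
structure YSpace (n m N : ℕ) where
  y0 : Vec n
  y1 : Fin N → Vec n
  y2 : Vec n
  y3 : Vec n
  y4 : Fin N → Vec n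
  y5 : Vec n
  y6 : Fin N → Vec m

instance (n m N : ℕ) : Sub (YSpace n m N) where
  sub a b := ⟨a.y0 - b.y0, a.y1 - b.y1, a.y2 - b.y2, a.y3 - b.y3, a.y4 - b.y4, a.y5 - b.y5,
    a.y6 - b.y6⟩

/-- `‖z‖_ω = (∑ ω_i |z_i|²)^{1/2}`. -/
def omegaNorm {n N : ℕ} (z : Fin N → Vec n) : ℝ :=
  Real.sqrt (∑ i, gaussWeight N i * ‖z i‖ ^ 2)

/-- The vector sup-norm: the largest absolute value of a component. -/
def supNorm {m N : ℕ} (z : Fin N → Vec m) : ℝ :=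
  ‖(fun i k => z i k : Fin N → Fin m → ℝ)‖

/-- The norm of `𝒴`. -/
def yNorm {n m N : ℕ} (y : YSpace n m N) : ℝ :=
  ‖y.y0‖ + ‖y.y2‖ + ‖y.y3‖ + ‖y.y5‖ + supNorm y.y6 + omegaNorm y.y1 + omegaNorm y.y4

/-- The map `𝒯(X, U, Λ)`.  States and costates are indexed by `0, …, N + 1`; the control
`V i` is `U_{i+1}`, attached to the state `X_{i+1}`, for which the index is
`i.castSucc.succ`. -/
def residualMap {n m N : ℕ} (f : Vec n × Vec m → Vec n) (C : Vec n → ℝ) (x₀ : Vec n)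
    (X : Fin (N + 2) → Vec n) (V : Fin N → Vec m) (L : Fin (N + 2) → Vec n) : YSpace n m N where
  y0 := X 0 - x₀
  y1 i := (∑ j : Fin (N + 1), diffMatrix N i j • X j.castSucc) - f (X i.castSucc.succ, V i)
  y2 := X (Fin.last (N + 1)) - X 0 - ∑ j : Fin N, gaussWeight N j • f (X j.castSucc.succ, V j)
  y3 := L (Fin.last (N + 1)) - L 0 +
    ∑ i : Fin N, gaussWeight N i • gradX f (X i.castSucc.succ) (V i) (L i.castSucc.succ)
  y4 i := (∑ j : Fin (N + 1), adjMatrix N i j • L j.succ) +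
    gradX f (X i.castSucc.succ) (V i) (L i.castSucc.succ)
  y5 := L (Fin.last (N + 1)) - gradient C (X (Fin.last (N + 1)))
  y6 i := -gradU f (X i.castSucc.succ) (V i) (L i.castSucc.succ)

/-- The set `ℱ(U)`: the first six components vanish, the last one lies in the product of the
normal cones `N_U(U_i)`. -/
def inclusionSet {n m N : ℕ} (U : Set (Vec m)) (V : Fin N → Vec m) : Set (YSpace n m N) :=
  {y | y.y0 = 0 ∧ y.y1 = 0 ∧ y.y2 = 0 ∧ y.y3 = 0 ∧ y.y4 = 0 ∧ y.y5 = 0 ∧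
    ∀ i, y.y6 i ∈ normalCone U (V i)}

/-- The distance from a point to a subset of `𝒴` in the `𝒴`-norm (`∞` for the empty set). -/
def yDist {n m N : ℕ} (y : YSpace n m N) (S : Set (YSpace n m N)) : ℝ≥0∞ :=
  ⨅ z ∈ S, ENNReal.ofReal (yNorm (y - z))

/-- The vector `X*` or `Λ*`: the values at `τ₀, …, τ_{N+1}`. -/
def sampleNodes {n : ℕ} (N : ℕ) (x : ℝ → Vec n) : Fin (N + 2) → Vec n := fun j => x (node N j)

/-- The vector `U*`: the values at the Gauss points. -/
def sampleGauss {m : ℕ} (N : ℕ) (u : ℝ → Vec m) : Fin N → Vec m := fun i => u (gaussPoint N i)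

end GaussCollocation

end

open GaussCollocation

/-!
The distance is bounded by testing with the element of `ℱ(U*)` whose last component is
`-∇ᵤH(x*, u*, λ*)` itself. Two things have to be shown: that this element lies in `ℱ(U*)`, which is
the pointwise minimum principle for the local minimizer, and that the remaining components of the
residual have the stated size. The components `0` and `5` vanish, and because of the differential
equations for `x*` and `λ*` the others are defects of collocation: `∑ D_{ij} x(τ_j) - x'(τ_i)` and
its analogue for `D†`, and the error of Gauss quadrature for `x'`.

**The minimum principle** (`neg_gradU_mem_normalCone`). For a continuous direction `v` in which the
control may be moved, `exists_small_solution` provides a trajectory `x* + δ` for the control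
`u* + ε v` with `δ = O(ε)`, and differentiating `⟨λ*, δ⟩` shows that the cost changes by
`ε ∫ ⟨∇ᵤH, v⟩ + o(ε)`, so that this integral is nonnegative (`integral_inner_gradU_nonneg`). With
`v = max (0, -a) (w - u*)`, where `a = ⟨∇ᵤH, w - u*⟩`, it equals `-∫ max (0, -a)²`; hence `a ≥ 0`.

**Reduction to polynomials** (`defects_le`). A function whose weak derivative `h` of order `k + 1`
is square integrable is a polynomial of degree at most `k` plus an iterated primitive of `h`
(`exists_polynomial_ae_eq`). As polynomials are dense in `L²`, such a function is a limit of
polynomials `X_n`, pointwise and with first derivatives, such that `‖X_n^{(k+1)}‖` tends to at most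
`‖h‖`, and the defects pass to the limit. Vectors are treated componentwise.

**Polynomials** (`defects_polynomial_le`). Let `π` be the orthogonal projection of `x'` onto the
polynomials of degree less than `N`, `r = x' - π`, and `e` the primitive of `r` vanishing at `-1`.
By duality, `‖r‖ ≤ (e/N)^k ‖x^{(k+1)}‖` with Euler's number `e`
(`descFactorial_mul_polyNorm_sub_projection_le`, `pow_le_exp_mul_descFactorial`). The defects
vanish on polynomials of degree at most `N`, so only `e` contributes. The pointwise values of `r`
at the Gauss points, up to a polynomial that the quadrature handles exactly, cost a factor `√N`
because they are estimated through `sup v² ≤ C ‖v‖ ‖v'‖`. The matrices `D` and `D†` are estimated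
weakly: pairing `D e` with a polynomial `φ` of degree less than `N` leads to the quadrature sums of
`e φ'` and of `e P_N'`. For the former, `e = (1 - t²) g` decays at the endpoints and `φ` satisfies
the inverse inequality `∫ (1 - t²) φ'² ≤ N² ∫ φ²` (`gaussQuad_antideriv_mul_derivative_sq_le`). The
latter sum alternates; summation by parts turns it into increments of `e` between neighbouring
nodes with bounded coefficients (`gaussQuad_mul_derivative_legendre_sq_le`). Both rest on the bound
`ω_i ≤ (10 / N) √(1 - τ_i²)` (`gaussWeight_le`), which comes from a monotone energy of Legendre's
differential equation.
-/

namespace GaussCollocation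

open Polynomial

/-! ### The `L²` inner product of polynomials on `[-1, 1]` -/

/-- The integral over `[-1, 1]` as a linear functional on polynomials. -/
noncomputable def polyInt : ℝ[X] →ₗ[ℝ] ℝ where
  toFun p := ∫ t in (-1 : ℝ)..1, p.eval t
  map_add' p q := by
    simp only [eval_add]
    exact intervalIntegral.integral_add (p.continuous.intervalIntegrable _ _)
      (q.continuous.intervalIntegrable _ _)
  map_smul' c p := by simp

lemma polyInt_apply (p : ℝ[X]) : polyInt p = ∫ t in (-1 : ℝ)..1, p.eval t := rfl

lemma polyInt_C_mul (c : ℝ) (p : ℝ[X]) : polyInt (C c * p) = c * polyInt p := by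
  rw [← smul_eq_C_mul, map_smul, smul_eq_mul]

lemma polyInt_derivative (p : ℝ[X]) : polyInt (derivative p) = p.eval 1 - p.eval (-1) := by
  rw [polyInt_apply]
  exact intervalIntegral.integral_eq_sub_of_hasDerivAt (fun x _ => p.hasDerivAt x)
    ((derivative p).continuous.intervalIntegrable _ _)

/-- Integration by parts. -/
lemma polyInt_derivative_mul (p q : ℝ[X]) :
    polyInt (derivative p * q) =
      p.eval 1 * q.eval 1 - p.eval (-1) * q.eval (-1) - polyInt (p * derivative q) := by
  have h := polyInt_derivative (p * q)
  rw [derivative_mul, map_add, eval_mul, eval_mul] at h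
  linarith

lemma polyInt_nonneg {p : ℝ[X]} (h : ∀ t ∈ Set.Icc (-1 : ℝ) 1, 0 ≤ p.eval t) : 0 ≤ polyInt p :=
  intervalIntegral.integral_nonneg (by norm_num) h

lemma polyInt_mono {p q : ℝ[X]} (h : ∀ t ∈ Set.Icc (-1 : ℝ) 1, p.eval t ≤ q.eval t) :
    polyInt p ≤ polyInt q := by
  have := polyInt_nonneg (p := q - p) (fun t ht => by rw [eval_sub]; linarith [h t ht])
  rw [map_sub] at this
  linarith

lemma polyInt_C (c : ℝ) : polyInt (C c) = 2 * c := by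
  rw [polyInt_apply]
  simp only [eval_C, intervalIntegral.integral_const, smul_eq_mul]
  norm_num

lemma C_two : (C 2 : ℝ[X]) = 2 := map_ofNat C 2

lemma polyInt_X : polyInt X = 0 := by
  have h := polyInt_derivative (X ^ 2)
  rw [derivative_X_pow] at h
  norm_num at h
  rw [polyInt_C_mul] at h
  linarith

lemma polyInt_X_sq : polyInt (X ^ 2) = 2 / 3 := by
  have h := polyInt_derivative (X ^ 3)
  rw [derivative_X_pow] at h
  norm_num at h
  rw [polyInt_C_mul] at h
  linarith

lemma polyInt_sq_nonneg (p : ℝ[X]) : 0 ≤ polyInt (p * p) :=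
  polyInt_nonneg fun t _ => by rw [eval_mul]; exact mul_self_nonneg _

/-- A nonzero polynomial that is nonnegative on `[-1, 1]` has positive integral. -/
lemma polyInt_pos {p : ℝ[X]} (hp : p ≠ 0) (h : ∀ t ∈ Set.Icc (-1 : ℝ) 1, 0 ≤ p.eval t) :
    0 < polyInt p := by
  rw [polyInt_apply]
  refine intervalIntegral.integral_pos (by norm_num) p.continuous.continuousOn
    (fun x hx => h x (Set.Ioc_subset_Icc_self hx)) ?_
  by_contra! hc
  refine hp (eq_zero_of_infinite_isRoot p ?_)
  exact (Set.Icc_infinite (by norm_num : (-1 : ℝ) < 1)).mono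
    fun x hx => le_antisymm (hc x hx) (h x hx)

/-- Cauchy-Schwarz for `∫ w p q` with a polynomial weight `w ≥ 0` on `[-1, 1]`. -/
lemma polyInt_cauchySchwarz (w p q : ℝ[X]) (hw : ∀ t ∈ Set.Icc (-1 : ℝ) 1, 0 ≤ w.eval t) :
    polyInt (w * (p * q)) ^ 2 ≤ polyInt (w * (p * p)) * polyInt (w * (q * q)) := by
  have key : ∀ x : ℝ, 0 ≤ polyInt (w * (p * p)) * (x * x) + (2 * polyInt (w * (p * q))) * x +
      polyInt (w * (q * q)) := by
    intro x
    have h : 0 ≤ polyInt (w * ((C x * p + q) * (C x * p + q))) := polyInt_nonneg fun t ht => by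
      rw [eval_mul, eval_mul]
      exact mul_nonneg (hw t ht) (mul_self_nonneg _)
    have e : w * ((C x * p + q) * (C x * p + q)) =
        C (x * x) * (w * (p * p)) + C (2 * x) * (w * (p * q)) + w * (q * q) := by
      simp only [C_mul, map_ofNat]
      ring
    rw [e, map_add, map_add, polyInt_C_mul, polyInt_C_mul] at h
    linarith
  have := discrim_le_zero key
  rw [discrim] at this
  nlinarith

/-- The `L²` norm on `[-1, 1]`. -/
noncomputable def polyNorm (p : ℝ[X]) : ℝ := Real.sqrt (polyInt (p * p))

lemma polyNorm_nonneg (p : ℝ[X]) : 0 ≤ polyNorm p := Real.sqrt_nonneg _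

lemma polyNorm_sq (p : ℝ[X]) : polyNorm p ^ 2 = polyInt (p * p) :=
  Real.sq_sqrt (polyInt_sq_nonneg p)

lemma abs_polyInt_mul_le (p q : ℝ[X]) : |polyInt (p * q)| ≤ polyNorm p * polyNorm q := by
  refine abs_le_of_sq_le_sq ?_ (mul_nonneg (polyNorm_nonneg _) (polyNorm_nonneg _))
  rw [mul_pow, polyNorm_sq, polyNorm_sq]
  simpa using polyInt_cauchySchwarz 1 p q (by simp)

/-- The antiderivative of `p` that vanishes at `-1`. -/
noncomputable def antideriv (p : ℝ[X]) : ℝ[X] :=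
  p.sum (fun n a => C (a / (n + 1)) * X ^ (n + 1)) -
    C ((p.sum (fun n a => C (a / (n + 1)) * X ^ (n + 1))).eval (-1))

lemma derivative_antideriv (p : ℝ[X]) : derivative (antideriv p) = p := by
  rw [antideriv, derivative_sub, derivative_C, sub_zero, Polynomial.sum, derivative_sum]
  conv_rhs => rw [p.as_sum_support]
  refine Finset.sum_congr rfl fun n _ => ?_
  rw [derivative_C_mul, derivative_X_pow, ← C_mul_X_pow_eq_monomial]
  rw [Nat.add_sub_cancel, ← mul_assoc, ← C_mul]
  congr 1
  push_cast
  congr 1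
  field_simp

lemma antideriv_eval_neg_one (p : ℝ[X]) : (antideriv p).eval (-1) = 0 := by
  rw [antideriv, eval_sub, eval_C, sub_self]

lemma antideriv_eval_one (p : ℝ[X]) : (antideriv p).eval 1 = polyInt p := by
  have h := polyInt_derivative (antideriv p)
  rw [derivative_antideriv, antideriv_eval_neg_one, sub_zero] at h
  exact h.symm

/-- A polynomial whose derivative has degree less than `n` has degree less than `n + 1`. -/
lemma degree_lt_succ_of_derivative {p : ℝ[X]} {n : ℕ} (h : (derivative p).degree < n) :
    p.degree < (n + 1 : ℕ) := by
  rw [degree_lt_iff_coeff_zero] at h ⊢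
  intro m hm
  obtain ⟨k, rfl⟩ : ∃ k, m = k + 1 := ⟨m - 1, by omega⟩
  have := h k (by omega)
  rw [coeff_derivative] at this
  rcases mul_eq_zero.1 this with h0 | h0
  · exact h0
  · exfalso
    have : (0 : ℝ) < k + 1 := by positivity
    linarith

lemma degree_derivative_lt_of_succ {p : ℝ[X]} {n : ℕ} (h : p.degree < (n + 1 : ℕ)) :
    (derivative p).degree < n := by
  rw [degree_lt_iff_coeff_zero] at h ⊢
  intro m hm
  rw [coeff_derivative, h (m + 1) (by omega), zero_mul]

lemma degree_antideriv_lt {p : ℝ[X]} {n : ℕ} (h : p.degree < n) :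
    (antideriv p).degree < (n + 1 : ℕ) :=
  degree_lt_succ_of_derivative (by rwa [derivative_antideriv])

/-! ### Legendre polynomials -/

lemma taylor_one_X_sq_sub_one_pow (N : ℕ) :
    taylor 1 ((X ^ 2 - 1 : ℝ[X]) ^ N) = X ^ N * (X + C 2) ^ N := by
  have : taylor 1 (X ^ 2 - 1 : ℝ[X]) = X * (X + C 2) := by
    simp [taylor_apply, C_two]
    ring
  rw [taylor_pow, this, mul_pow]

lemma taylor_neg_one_X_sq_sub_one_pow (N : ℕ) :
    taylor (-1) ((X ^ 2 - 1 : ℝ[X]) ^ N) = X ^ N * (X + C (-2)) ^ N := by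
  have : taylor (-1) (X ^ 2 - 1 : ℝ[X]) = X * (X + C (-2)) := by
    simp [taylor_apply, C_two]
    ring
  rw [taylor_pow, this, mul_pow]

lemma eval_iterate_derivative_eq_taylor_coeff (p : ℝ[X]) (r : ℝ) (k : ℕ) :
    (derivative^[k] p).eval r = k.factorial * (taylor r p).coeff k := by
  rw [taylor_coeff, ← factorial_smul_hasseDeriv]
  simp

lemma eval_iterate_derivative_one_of_lt {N k : ℕ} (h : k < N) :
    (derivative^[k] ((X ^ 2 - 1 : ℝ[X]) ^ N)).eval 1 = 0 := by
  rw [eval_iterate_derivative_eq_taylor_coeff, taylor_one_X_sq_sub_one_pow, coeff_X_pow_mul',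
    if_neg (by omega), mul_zero]

lemma eval_iterate_derivative_neg_one_of_lt {N k : ℕ} (h : k < N) :
    (derivative^[k] ((X ^ 2 - 1 : ℝ[X]) ^ N)).eval (-1) = 0 := by
  rw [eval_iterate_derivative_eq_taylor_coeff, taylor_neg_one_X_sq_sub_one_pow, coeff_X_pow_mul',
    if_neg (by omega), mul_zero]

lemma legendre_eval_one (N : ℕ) : (legendre N).eval 1 = 1 := by
  rw [legendre, eval_mul, eval_C, eval_iterate_derivative_eq_taylor_coeff,
    taylor_one_X_sq_sub_one_pow, coeff_X_pow_mul', if_pos le_rfl, Nat.sub_self,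
    coeff_zero_eq_eval_zero]
  simp
  field_simp

lemma legendre_eval_neg_one (N : ℕ) : (legendre N).eval (-1) = (-1) ^ N := by
  rw [legendre, eval_mul, eval_C, eval_iterate_derivative_eq_taylor_coeff,
    taylor_neg_one_X_sq_sub_one_pow, coeff_X_pow_mul', if_pos le_rfl, Nat.sub_self,
    coeff_zero_eq_eval_zero]
  simp
  rw [show (-2 : ℝ) = (-1) * 2 by norm_num, mul_pow]
  field_simp

lemma legendre_eval_neg_one_sq (N : ℕ) : (legendre N).eval (-1) ^ 2 = 1 := by
  rw [legendre_eval_neg_one, ← pow_mul, mul_comm, pow_mul]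
  norm_num

lemma legendre_natDegree (N : ℕ) : (legendre N).natDegree = N := by
  have hX : (X ^ 2 - 1 : ℝ[X]).natDegree = 2 := by
    rw [← C_1]; exact natDegree_X_pow_sub_C
  have hm : ((X ^ 2 - 1 : ℝ[X]) ^ N).Monic := by
    rw [← C_1]; exact (monic_X_pow_sub_C 1 two_ne_zero).pow N
  have hd : ((X ^ 2 - 1 : ℝ[X]) ^ N).natDegree = 2 * N := by
    rw [natDegree_pow, hX, mul_comm]
  rw [legendre, natDegree_C_mul (by positivity)]
  refine le_antisymm ((natDegree_iterate_derivative _ _).trans (by omega)) ?_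
  refine le_natDegree_of_ne_zero ?_
  rw [coeff_iterate_derivative, ← two_mul, ← hd, hm.coeff_natDegree, hd, nsmul_eq_mul, mul_one]
  have := Nat.descFactorial_pos.2 (show N ≤ 2 * N by omega)
  positivity

lemma legendre_ne_zero (N : ℕ) : legendre N ≠ 0 := by
  intro h
  have := legendre_eval_one N
  simp [h] at this

lemma legendre_degree (N : ℕ) : (legendre N).degree = N := by
  rw [degree_eq_natDegree (legendre_ne_zero N), legendre_natDegree]

lemma polyInt_legendre_mul_eq_zero {N : ℕ} {q : ℝ[X]} (hq : q.degree < N) :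
    polyInt (legendre N * q) = 0 := by
  have key : ∀ k ≤ N, ∀ q : ℝ[X], q.degree < k →
      polyInt (derivative^[k] ((X ^ 2 - 1 : ℝ[X]) ^ N) * q) = 0 := by
    intro k
    induction k with
    | zero =>
      intro _ q hq
      have : q = 0 := by
        rw [← degree_eq_bot]
        exact Nat.WithBot.lt_zero_iff.1 (by simpa using hq)
      simp [this]
    | succ k ih =>
      intro hk q hq
      rw [Function.iterate_succ_apply', polyInt_derivative_mul,
        eval_iterate_derivative_one_of_lt (by omega),
        eval_iterate_derivative_neg_one_of_lt (by omega),
        ih (by omega) _ (degree_derivative_lt_of_succ hq)]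
      ring
  rw [legendre, mul_assoc, polyInt_C_mul, key N le_rfl q hq, mul_zero]

/-- Legendre's differential equation. -/
lemma legendre_ode (N : ℕ) :
    (1 - X ^ 2) * derivative (derivative (legendre N)) =
      C 2 * X * derivative (legendre N) - C ((N : ℝ) * (N + 1)) * legendre N := by
  set w : ℝ[X] := (X ^ 2 - 1) ^ N with hw
  have h0 : (X ^ 2 - 1) * derivative w = C (2 * (N : ℝ)) * (X * w) := by
    rcases N with _ | N
    · simp [hw]
    · rw [hw, derivative_pow]
      simp [C_two]
      ring
  have key : ∀ k : ℕ, (X ^ 2 - 1) * derivative^[k + 2] w +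
      C (2 * ((k : ℝ) + 1)) * X * derivative^[k + 1] w + C (((k : ℝ) + 1) * k) * derivative^[k] w =
      C (2 * (N : ℝ)) * (X * derivative^[k + 1] w + C ((k : ℝ) + 1) * derivative^[k] w) := by
    intro k
    induction k with
    | zero =>
      have := congrArg derivative h0
      simp only [derivative_mul, derivative_sub, derivative_X_pow, derivative_C, derivative_one,
        derivative_X] at this
      simp only [Function.iterate_succ_apply', Function.iterate_zero_apply]
      simp [C_two] at this ⊢
      linear_combination this
    | succ k ih =>
      have := congrArg derivative ih
      simp only [derivative_mul, derivative_sub, derivative_add, derivative_X_pow, derivative_C,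
        derivative_one, derivative_X, ← Function.iterate_succ_apply'] at this
      simp [C_two] at this ⊢
      linear_combination this
  have hN := key N
  rw [legendre, derivative_C_mul, derivative_C_mul, ← hw]
  simp only [Function.iterate_succ_apply'] at hN
  generalize (1 / ((2 : ℝ) ^ N * (N.factorial : ℝ))) = a
  simp [C_two] at hN ⊢
  linear_combination (-C a) * hN

/-- `((1 - t²) P_N')' = -N (N + 1) P_N`. -/
lemma derivative_legendre_ode (N : ℕ) :
    derivative ((1 - X ^ 2) * derivative (legendre N)) =
      -(C ((N : ℝ) * (N + 1)) * legendre N) := by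
  rw [derivative_mul, legendre_ode]
  simp [C_two]
  ring

lemma polyInt_legendre_sq (N : ℕ) :
    polyInt (legendre N * legendre N) = 2 / (2 * N + 1) := by
  have h1 := polyInt_derivative (X * (legendre N * legendre N))
  -- `t P_N' - N P_N` has degree less than `N`.
  have h2 : (X * derivative (legendre N) - C (N : ℝ) * legendre N).degree < (N : WithBot ℕ) := by
    rw [degree_lt_iff_coeff_zero]
    intro m hm
    rcases m with _ | m
    · obtain rfl : N = 0 := by omega
      simp
    · rw [coeff_sub, coeff_X_mul, coeff_C_mul, coeff_derivative]
      rcases hm.eq_or_lt with h | h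
      · rw [h]; push_cast; ring
      · rw [coeff_eq_zero_of_natDegree_lt (by rw [legendre_natDegree]; exact h)]; ring
  have h3 := polyInt_legendre_mul_eq_zero h2
  have h4 : derivative (X * (legendre N * legendre N)) =
      C (2 * (N : ℝ) + 1) * (legendre N * legendre N) +
        C 2 * (legendre N * (X * derivative (legendre N) - C (N : ℝ) * legendre N)) := by
    simp [derivative_mul, C_two]
    ring
  rw [h4, map_add, polyInt_C_mul, polyInt_C_mul, h3] at h1
  simp only [eval_mul, eval_X, legendre_eval_one] at h1
  have h5 := legendre_eval_neg_one_sq N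
  rw [eq_div_iff (by positivity)]
  nlinarith

/-! ### Gauss points and Gauss quadrature -/

lemma card_roots_legendre (N : ℕ) : (legendre N).roots.card = N := by
  have hw : ((X ^ 2 - 1 : ℝ[X]) ^ N).roots.card = 2 * N := by
    have h : (X ^ 2 - 1 : ℝ[X]) = (X - C 1) * (X - C (-1)) := by
      simp
      ring
    rw [roots_pow, h, roots_mul (mul_ne_zero (X_sub_C_ne_zero _) (X_sub_C_ne_zero _)),
      roots_X_sub_C, roots_X_sub_C]
    simp [mul_comm]
  have key : ∀ k : ℕ, 2 * N ≤ (derivative^[k] ((X ^ 2 - 1 : ℝ[X]) ^ N)).roots.card + k := by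
    intro k
    induction k with
    | zero => rw [Function.iterate_zero_apply, hw, add_zero]
    | succ k ih =>
      have := card_roots_le_derivative (derivative^[k] ((X ^ 2 - 1 : ℝ[X]) ^ N))
      rw [Function.iterate_succ_apply']
      omega
  have h1 := key N
  refine le_antisymm ((card_roots' _).trans (legendre_natDegree N).le) ?_
  rw [legendre, roots_C_mul _ (by positivity)]
  omega

lemma mem_roots_legendre {N : ℕ} {τ : ℝ} : τ ∈ (legendre N).roots ↔ (legendre N).eval τ = 0 := by
  rw [mem_roots (legendre_ne_zero N), IsRoot.def]

/-- If `P_N = s g` with `s ≠ 0` nonconstant, then `s` takes a negative value on `[-1, 1]`: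
otherwise `0 = ∫ P_N g = ∫ s g² > 0`. -/
lemma not_nonneg_of_legendre_eq_mul {N : ℕ} {s g : ℝ[X]} (h : legendre N = s * g)
    (hs : 0 < s.natDegree) (hpos : ∀ t ∈ Set.Icc (-1 : ℝ) 1, 0 ≤ s.eval t) : False := by
  have hne : s * g ≠ 0 := h ▸ legendre_ne_zero N
  have hs0 := left_ne_zero_of_mul hne
  have hg0 := right_ne_zero_of_mul hne
  have hdeg : g.degree < (N : WithBot ℕ) := by
    rw [degree_eq_natDegree hg0]
    have := legendre_natDegree N
    rw [h, natDegree_mul hs0 hg0] at this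
    exact_mod_cast (by omega : g.natDegree < N)
  have h0 := polyInt_legendre_mul_eq_zero hdeg
  rw [h, mul_assoc] at h0
  refine (polyInt_pos (mul_ne_zero hs0 (mul_ne_zero hg0 hg0)) fun t ht => ?_).ne' h0
  rw [eval_mul, eval_mul]
  exact mul_nonneg (hpos t ht) (mul_self_nonneg _)

lemma nodup_roots_legendre (N : ℕ) : (legendre N).roots.Nodup := by
  rw [Multiset.nodup_iff_count_le_one]
  intro τ
  rw [count_roots]
  by_contra! hc
  obtain ⟨g, hg⟩ := (le_rootMultiplicity_iff (legendre_ne_zero N) (a := τ) (n := 2)).1 hc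
  refine not_nonneg_of_legendre_eq_mul hg (by simp) fun t _ => ?_
  rw [eval_pow]
  exact sq_nonneg _

lemma roots_legendre_mem_Ioo {N : ℕ} {τ : ℝ} (h : (legendre N).eval τ = 0) :
    τ ∈ Set.Ioo (-1 : ℝ) 1 := by
  obtain ⟨g, hg⟩ := dvd_iff_isRoot.2 h
  constructor <;> by_contra! hc
  · refine not_nonneg_of_legendre_eq_mul hg (by simp) fun t ht => ?_
    rw [eval_sub, eval_X, eval_C]
    linarith [ht.1]
  · refine not_nonneg_of_legendre_eq_mul (s := C τ - X) (g := -g) (by rw [hg]; ring) ?_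
      fun t ht => ?_
    · rw [← neg_sub, natDegree_neg, natDegree_X_sub_C]
      exact one_pos
    · rw [eval_sub, eval_X, eval_C]
      linarith [ht.2]

lemma length_sort_roots_legendre (N : ℕ) :
    ((legendre N).roots.sort (fun a b => a ≤ b)).length = N := by
  rw [Multiset.length_sort, card_roots_legendre]

lemma gaussPoint_eq_get (N : ℕ) (i : Fin N) :
    gaussPoint N i = ((legendre N).roots.sort (fun a b => a ≤ b)).get
      (i.cast (length_sort_roots_legendre N).symm) := by
  rw [gaussPoint, List.getD_eq_getElem _ _ (by rw [length_sort_roots_legendre]; exact i.2)]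
  rfl

lemma gaussPoint_strictMono (N : ℕ) : StrictMono (gaussPoint N) := by
  have hnd : ((legendre N).roots.sort (fun a b => a ≤ b)).Nodup := by
    rw [← Multiset.coe_nodup, Multiset.sort_eq]
    exact nodup_roots_legendre N
  have h : ((legendre N).roots.sort (fun a b => a ≤ b)).SortedLT :=
    ((Multiset.pairwise_sort _ _).and hnd).imp (fun h => lt_of_le_of_ne h.1 h.2) |>.sortedLT
  intro i j hij
  rw [gaussPoint_eq_get, gaussPoint_eq_get]
  exact h.strictMono_get (by simpa using hij)

lemma legendre_eval_gaussPoint (N : ℕ) (i : Fin N) :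
    (legendre N).eval (gaussPoint N i) = 0 := by
  rw [← mem_roots_legendre, ← Multiset.mem_sort (r := fun a b : ℝ => a ≤ b), gaussPoint_eq_get]
  exact List.get_mem _ _

lemma gaussPoint_mem_Ioo (N : ℕ) (i : Fin N) : gaussPoint N i ∈ Set.Ioo (-1 : ℝ) 1 :=
  roots_legendre_mem_Ioo (legendre_eval_gaussPoint N i)

lemma gaussPoint_mem_Icc (N : ℕ) (i : Fin N) : gaussPoint N i ∈ Set.Icc (-1 : ℝ) 1 :=
  Set.Ioo_subset_Icc_self (gaussPoint_mem_Ioo N i)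

lemma one_sub_gaussPoint_sq_pos (N : ℕ) (i : Fin N) : 0 < 1 - gaussPoint N i ^ 2 := by
  obtain ⟨h1, h2⟩ := gaussPoint_mem_Ioo N i
  nlinarith

lemma eval_derivative_legendre_gaussPoint_ne_zero (N : ℕ) (i : Fin N) :
    (derivative (legendre N)).eval (gaussPoint N i) ≠ 0 := by
  intro h
  have h1 := (one_lt_rootMultiplicity_iff_isRoot (legendre_ne_zero N)).2
    ⟨legendre_eval_gaussPoint N i, h⟩
  have h2 := Multiset.nodup_iff_count_le_one.1 (nodup_roots_legendre N) (gaussPoint N i)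
  rw [count_roots] at h2
  omega

lemma gaussWeight_pos (N : ℕ) (i : Fin N) : 0 < gaussWeight N i := by
  have h1 := one_sub_gaussPoint_sq_pos N i
  have h2 := eval_derivative_legendre_gaussPoint_ne_zero N i
  rw [gaussWeight]
  positivity

lemma degree_mul_lt {a b c : ℕ} {p q : ℝ[X]} (hp : p.degree < (a : WithBot ℕ))
    (hq : q.degree < (b : WithBot ℕ)) (h : a + b ≤ c + 1) :
    (p * q).degree < (c : WithBot ℕ) := by
  by_cases h0 : p * q = 0
  · rw [h0, degree_zero]
    exact WithBot.bot_lt_coe _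
  have hp0 := left_ne_zero_of_mul h0
  have hq0 := right_ne_zero_of_mul h0
  rw [degree_eq_natDegree h0, natDegree_mul hp0 hq0]
  rw [degree_eq_natDegree hp0] at hp
  rw [degree_eq_natDegree hq0] at hq
  have h1 : p.natDegree < a := by exact_mod_cast hp
  have h2 : q.natDegree < b := by exact_mod_cast hq
  exact_mod_cast (by omega : p.natDegree + q.natDegree < c)

/-- The Gauss quadrature functional `∑ ω_i p(τ_i)`. -/
noncomputable def gaussQuad (N : ℕ) (p : ℝ[X]) : ℝ :=
  ∑ i, gaussWeight N i * p.eval (gaussPoint N i)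

/-- The linear functional with weights `∫ ℓ_i`, where the `ℓ_i` are the Lagrange basis polynomials
of the Gauss points, integrates polynomials of degree less than `2 N` exactly. -/
lemma polyInt_eq_sum_lagrange {N : ℕ} {p : ℝ[X]} (hp : p.degree < ((2 * N : ℕ) : WithBot ℕ)) :
    polyInt p = ∑ i, polyInt (Lagrange.basis Finset.univ (gaussPoint N) i) *
      p.eval (gaussPoint N i) := by
  set P := legendre N
  have hdm := EuclideanDomain.div_add_mod p P
  have hmod : (p % P).degree < (N : WithBot ℕ) := by
    rw [← legendre_degree N]
    exact degree_mod_lt p (legendre_ne_zero N)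
  have hdiv : (p / P).degree < (N : WithBot ℕ) := by
    by_cases h : P.degree ≤ p.degree
    · have h1 := degree_add_div (legendre_ne_zero N) h
      have hne : p / P ≠ 0 := fun h0 => by
        rw [Polynomial.div_eq_zero_iff (legendre_ne_zero N)] at h0
        exact absurd h (not_le.2 h0)
      rw [legendre_degree, degree_eq_natDegree hne] at h1
      rw [← h1] at hp
      rw [degree_eq_natDegree hne]
      have h2 : N + (p / P).natDegree < 2 * N := by exact_mod_cast hp
      exact_mod_cast (by omega : (p / P).natDegree < N)
    · rw [(Polynomial.div_eq_zero_iff (legendre_ne_zero N)).2 (not_le.1 h), degree_zero]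
      exact WithBot.bot_lt_coe N
  have heval : ∀ i, p.eval (gaussPoint N i) = (p % P).eval (gaussPoint N i) := by
    intro i
    conv_lhs => rw [← hdm]
    rw [eval_add, eval_mul, legendre_eval_gaussPoint, zero_mul, zero_add]
  have h1 : polyInt p = polyInt (p % P) := by
    conv_lhs => rw [← hdm]
    rw [map_add, polyInt_legendre_mul_eq_zero hdiv, zero_add]
  have h2 := Lagrange.eq_interpolate (s := Finset.univ) (v := gaussPoint N) (f := p % P)
    (gaussPoint_strictMono N).injective.injOn (by simpa using hmod)
  rw [h1, h2, Lagrange.interpolate_apply, map_sum]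
  refine Finset.sum_congr rfl fun i _ => ?_
  rw [polyInt_C_mul, heval, mul_comm]

lemma polyInt_lagrange_basis (N : ℕ) (i : Fin N) :
    polyInt (Lagrange.basis Finset.univ (gaussPoint N) i) = gaussWeight N i := by
  set P := legendre N with hP
  obtain ⟨g, hg⟩ := dvd_iff_isRoot.2 (legendre_eval_gaussPoint N i)
  have hg0 : g ≠ 0 := right_ne_zero_of_mul (hg ▸ legendre_ne_zero N)
  have hgdeg : g.natDegree + 1 = N := by
    have := legendre_natDegree N
    rw [hg, natDegree_mul (X_sub_C_ne_zero _) hg0, natDegree_X_sub_C] at this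
    omega
  have hgi : g.eval (gaussPoint N i) = (derivative P).eval (gaussPoint N i) := by
    rw [hP, hg]
    simp
  have hgj : ∀ j, j ≠ i → g.eval (gaussPoint N j) = 0 := by
    intro j hj
    have := legendre_eval_gaussPoint N j
    rw [hg, eval_mul, eval_sub, eval_X, eval_C] at this
    exact (mul_eq_zero.1 this).resolve_left
      (sub_ne_zero.2 fun h => hj ((gaussPoint_strictMono N).injective h))
  have hP' : (derivative P).degree < (N : WithBot ℕ) :=
    degree_derivative_lt_of_succ (by rw [legendre_degree]; exact_mod_cast Nat.lt_succ_self N)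
  have hg1 : g.degree < (N : WithBot ℕ) := by
    rw [degree_eq_natDegree hg0]
    exact_mod_cast (by omega : g.natDegree < N)
  have hex : polyInt (derivative P * g) = polyInt (Lagrange.basis Finset.univ (gaussPoint N) i) *
      (derivative P).eval (gaussPoint N i) ^ 2 := by
    rw [polyInt_eq_sum_lagrange, Finset.sum_eq_single i]
    · rw [eval_mul, hgi, sq]
    · intro j _ hj
      rw [eval_mul, hgj j hj]
      ring
    · simp
    · exact degree_mul_lt hP' hg1 (by omega)
  have hg1' : (derivative g).degree < (N : WithBot ℕ) :=
    (degree_derivative_le).trans_lt hg1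
  rw [polyInt_derivative_mul, polyInt_legendre_mul_eq_zero hg1', legendre_eval_one] at hex
  have e1 := legendre_eval_one N
  have e2 : P.eval (-1) = P.eval (-1) := rfl
  have e3 := legendre_eval_neg_one_sq N
  rw [← hP] at e1 e3
  nth_rewrite 1 [hP] at e1
  nth_rewrite 1 [hP] at e2
  rw [hg, eval_mul, eval_sub, eval_X, eval_C] at e1 e2
  obtain ⟨h1, h2⟩ := gaussPoint_mem_Ioo N i
  have h3 := eval_derivative_legendre_gaussPoint_ne_zero N i
  rw [← hP] at h3
  have h4 := one_sub_gaussPoint_sq_pos N i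
  rw [gaussWeight, eq_div_iff (by positivity)]
  set τ := gaussPoint N i
  linear_combination (-(1 - τ ^ 2)) * hex + (1 + τ) * e1 + (1 - τ) * P.eval (-1) * e2 +
    (1 - τ) * e3

/-- Gauss quadrature is exact for polynomials of degree less than `2 N`. -/
lemma gaussQuad_eq_polyInt {N : ℕ} {p : ℝ[X]} (hp : p.degree < ((2 * N : ℕ) : WithBot ℕ)) :
    gaussQuad N p = polyInt p := by
  rw [polyInt_eq_sum_lagrange hp, gaussQuad]
  simp_rw [polyInt_lagrange_basis]

lemma gaussQuad_mul_eq_polyInt {N a b : ℕ} {p q : ℝ[X]} (hp : p.degree < (a : WithBot ℕ))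
    (hq : q.degree < (b : WithBot ℕ)) (hab : a + b ≤ 2 * N + 1) :
    gaussQuad N (p * q) = polyInt (p * q) :=
  gaussQuad_eq_polyInt (degree_mul_lt hp hq hab)

lemma sum_gaussWeight {N : ℕ} (hN : 1 ≤ N) : ∑ i, gaussWeight N i = 2 := by
  have h := gaussQuad_eq_polyInt (N := N) (p := C 1)
    ((degree_C_le).trans_lt (by exact_mod_cast (by omega : 0 < 2 * N)))
  rw [polyInt_C] at h
  simpa [gaussQuad] using h

/-! ### An upper bound for the Gauss weights -/

/-- A polynomial whose derivative has the sign of `-t` on `[-1, 1]` is largest at `0`. -/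
lemma eval_le_eval_zero {G : ℝ[X]}
    (hG : ∀ t ∈ Set.Icc (-1 : ℝ) 1, t * (derivative G).eval t ≤ 0) {t : ℝ}
    (ht : t ∈ Set.Icc (-1 : ℝ) 1) : G.eval t ≤ G.eval 0 := by
  rcases le_total 0 t with h | h
  · refine antitoneOn_of_deriv_nonpos (convex_Icc 0 1) G.continuous.continuousOn
      G.differentiable.differentiableOn (fun x hx => ?_) ⟨le_rfl, zero_le_one⟩ ⟨h, ht.2⟩ h
    rw [interior_Icc] at hx
    rw [Polynomial.deriv]
    have := hG x ⟨by linarith [hx.1], hx.2.le⟩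
    exact nonpos_of_mul_nonpos_right this hx.1
  · refine monotoneOn_of_deriv_nonneg (convex_Icc (-1) 0) G.continuous.continuousOn
      G.differentiable.differentiableOn (fun x hx => ?_) ⟨ht.1, h⟩ ⟨by norm_num, le_rfl⟩ h
    rw [interior_Icc] at hx
    rw [Polynomial.deriv]
    have := hG x ⟨hx.1.le, by linarith [hx.2]⟩
    nlinarith [hx.2]

/-- The mean of `1 - t²` with respect to the density `P_N²` is at least `2/5`.  With
`z = (1 - t²) P_N'`, integrating the derivatives of `(t - t³) P_N²`, `(1 - t²) z P_N` and `t z²`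
gives three linear relations between the integrals of `P_N²`, `t² P_N²`, `t z P_N` and `z²`,
which determine `∫ t² P_N² / ∫ P_N²`. -/
lemma polyInt_one_sub_sq_mul_legendre_sq {N : ℕ} (hN : 1 ≤ N) :
    2 / 5 * polyInt (legendre N * legendre N) ≤
      polyInt ((1 - X ^ 2) * (legendre N * legendre N)) := by
  set P := legendre N with hP
  set ν : ℝ := (N : ℝ) * (N + 1) with hν
  set z : ℝ[X] := (1 - X ^ 2) * derivative P with hz
  have hz' : derivative z = -(C ν * P) := derivative_legendre_ode N
  have hN' : (1 : ℝ) ≤ N := by exact_mod_cast hN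
  have hν2 : 2 ≤ ν := by nlinarith
  have hA := polyInt_sq_nonneg P
  have e1 := polyInt_derivative ((X - X ^ 3) * (P * P))
  have e2 := polyInt_derivative (P * ((1 - X ^ 2) * z))
  have e3 := polyInt_derivative (X * (z * z))
  have d1 : derivative ((X - X ^ 3) * (P * P)) =
      P * P - C 3 * (X ^ 2 * (P * P)) + C 2 * (X * z * P) := by
    have : (C 3 : ℝ[X]) = 3 := map_ofNat C 3
    simp [derivative_mul, hz, C_two, this]
    ring
  have d2 : derivative (P * ((1 - X ^ 2) * z)) =
      z * z - C 2 * (X * z * P) - C ν * ((1 - X ^ 2) * (P * P)) := by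
    rw [derivative_mul, derivative_mul, hz']
    simp [hz, C_two]
    ring
  have d3 : derivative (X * (z * z)) = z * z - C (2 * ν) * (X * z * P) := by
    rw [derivative_mul, derivative_mul, hz']
    simp [C_two]
    ring
  have dJ : (1 - X ^ 2) * (P * P) = P * P - X ^ 2 * (P * P) := by ring
  rw [d1, map_add, map_sub, polyInt_C_mul, polyInt_C_mul] at e1
  rw [d2, map_sub, map_sub, polyInt_C_mul, polyInt_C_mul, dJ, map_sub] at e2
  rw [d3, map_sub, polyInt_C_mul] at e3
  rw [dJ, map_sub]
  simp [hz] at e1 e2 e3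
  generalize polyInt (P * P) = A at *
  generalize polyInt (X ^ 2 * (P * P)) = B at *
  generalize polyInt (X * z * P) = K at *
  generalize polyInt (z * z) = Z at *
  have hK : K = (3 * B - A) / 2 := by linarith
  have hB : B * (4 * ν - 3) = A * (2 * ν - 1) := by
    subst hK
    nlinarith
  nlinarith

lemma le_legendre_energy_at_zero {N : ℕ} (hN : 1 ≤ N) :
    (N : ℝ) / 5 ≤ (derivative (legendre N)).eval 0 ^ 2 +
      (N : ℝ) * (N + 1) * (legendre N).eval 0 ^ 2 := by
  set P := legendre N with hP
  set ν : ℝ := (N : ℝ) * (N + 1) with hν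
  set z : ℝ[X] := (1 - X ^ 2) * derivative P with hz
  have hz' : derivative z = -(C ν * P) := derivative_legendre_ode N
  have hN' : (1 : ℝ) ≤ N := by exact_mod_cast hN
  have hν0 : 0 ≤ ν := by positivity
  -- The energy `z² + ν (1 - t²) P²` has derivative `-2 ν t P²`, so it is largest at `0`.
  set G : ℝ[X] := z * z + C ν * ((1 - X ^ 2) * (P * P)) with hG
  have hG' : derivative G = -(C (2 * ν) * (X * (P * P))) := by
    have h1 : derivative (z * z) = derivative z * z + z * derivative z := derivative_mul
    rw [hG, derivative_add, h1, hz', derivative_C_mul, derivative_mul, derivative_mul]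
    simp [hz, C_two]
    ring
  have hmax : ∀ t ∈ Set.Icc (-1 : ℝ) 1, G.eval t ≤ (C (G.eval 0)).eval t := by
    intro t ht
    rw [eval_C]
    refine eval_le_eval_zero (fun s _ => ?_) ht
    rw [hG']
    simp only [eval_neg, eval_mul, eval_C, eval_X]
    have : 0 ≤ 2 * ν * (s * P.eval s) ^ 2 := by positivity
    nlinarith
  have h1 := polyInt_mono hmax
  rw [polyInt_C, hG, map_add, polyInt_C_mul] at h1
  have h2 := polyInt_one_sub_sq_mul_legendre_sq hN
  rw [polyInt_legendre_sq] at h2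
  have h3 := polyInt_sq_nonneg z
  have h4 : (N : ℝ) / 5 * 2 ≤ ν * (2 / 5 * (2 / (2 * N + 1))) := by
    rw [hν, mul_div_assoc', mul_div_assoc', le_div_iff₀ (by positivity)]
    nlinarith
  have h5 := mul_le_mul_of_nonneg_left h2 hν0
  have h6 : G.eval 0 = (derivative P).eval 0 ^ 2 + ν * P.eval 0 ^ 2 := by
    simp [hG, hz]
    ring
  rw [← h6]
  linarith

/-- Lower bound for `z = (1 - t²) P_N'` at the Gauss points: by Legendre's equation, the energy
`(1 - t²)^{-1/2} ((z - t P_N / 2)² + ((N + 1/2)² (1 - t²) + 1/4) P_N²)`, which comes from the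
equation satisfied by `(1 - t²)^{1/4} P_N` in the variable `arccos t`, is smallest at `0`. -/
lemma le_sq_derivative_legendre_gaussPoint {N : ℕ} (hN : 1 ≤ N) (i : Fin N) :
    (N : ℝ) / 5 * Real.sqrt (1 - gaussPoint N i ^ 2) ≤
      ((1 - gaussPoint N i ^ 2) * (derivative (legendre N)).eval (gaussPoint N i)) ^ 2 := by
  set P := legendre N with hP
  set ν : ℝ := (N : ℝ) * (N + 1) with hν
  set z : ℝ[X] := (1 - X ^ 2) * derivative P with hz
  have hz' : derivative z = -(C ν * P) := derivative_legendre_ode N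
  set A : ℝ[X] := (z - C (1 / 2) * (X * P)) ^ 2 +
    (C (ν + 1 / 4) * (1 - X ^ 2) + C (1 / 4)) * P ^ 2 with hA
  have hA' : ∀ t : ℝ, (1 - t ^ 2) * (derivative A).eval t + t * A.eval t =
      1 / 2 * (t * P.eval t ^ 2) := by
    intro t
    have hd : derivative A = C 2 * (z - C (1 / 2) * (X * P)) *
        (-(C ν * P) - C (1 / 2) * (P + X * derivative P)) +
        (C (ν + 1 / 4) * (-(C 2 * X)) * P ^ 2 +
          (C (ν + 1 / 4) * (1 - X ^ 2) + C (1 / 4)) * (C 2 * P * derivative P)) := by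
      simp only [hA, derivative_add, derivative_mul, derivative_sub, derivative_pow, hz',
        derivative_C, derivative_X, derivative_one]
      simp only [Nat.cast_ofNat, C_two]
      ring
    have hzt : z.eval t = (1 - t ^ 2) * (derivative P).eval t := by simp [hz]
    rw [hd]
    simp only [hA, eval_add, eval_mul, eval_pow, eval_sub, eval_C, eval_X, eval_one, eval_neg, hzt,
      hν]
    ring
  have hN' : (1 : ℝ) ≤ N := by exact_mod_cast hN
  have hApos : ∀ t ∈ Set.Ioo (-1 : ℝ) 1, 0 ≤ A.eval t := by
    intro t ht
    have : 0 ≤ 1 - t ^ 2 := by nlinarith [ht.1, ht.2]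
    simp only [hA, eval_add, eval_mul, eval_pow, eval_sub, eval_C, eval_X, eval_one]
    positivity
  have hder : ∀ t ∈ Set.Ioo (-1 : ℝ) 1, HasDerivAt (fun t => A.eval t ^ 2 / (1 - t ^ 2))
      (t * (A.eval t * P.eval t ^ 2 / (1 - t ^ 2) ^ 2)) t := by
    intro t ht
    have h0 : 1 - t ^ 2 ≠ 0 := by nlinarith [ht.1, ht.2]
    have h1 := ((A.hasDerivAt t).pow 2).div
      ((hasDerivAt_const t (1 : ℝ)).sub ((hasDerivAt_id t).pow 2)) h0
    refine h1.congr_deriv ?_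
    have h2 := hA' t
    rw [mul_div_assoc']
    congr 1
    simp
    linear_combination (2 * A.eval t) * h2
  have hmin : ∀ t ∈ Set.Ioo (-1 : ℝ) 1, A.eval 0 ^ 2 ≤ A.eval t ^ 2 / (1 - t ^ 2) := by
    intro t ht
    have hcont : ContinuousOn (fun t : ℝ => A.eval t ^ 2 / (1 - t ^ 2)) (Set.Ioo (-1) 1) :=
      fun s hs => (hder s hs).continuousAt.continuousWithinAt
    have h0 : A.eval 0 ^ 2 = A.eval 0 ^ 2 / (1 - (0 : ℝ) ^ 2) := by simp
    rw [h0]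
    rcases le_total 0 t with h | h
    · have hsub : Set.Icc 0 t ⊆ Set.Ioo (-1 : ℝ) 1 := fun s hs =>
        ⟨by linarith [hs.1], lt_of_le_of_lt hs.2 ht.2⟩
      refine monotoneOn_of_deriv_nonneg (convex_Icc 0 t) (hcont.mono hsub)
        (fun s hs => (hder s (hsub (interior_subset hs))).differentiableAt.differentiableWithinAt)
        (fun s hs => ?_) ⟨le_rfl, h⟩ ⟨h, le_rfl⟩ h
      have hs' := hsub (interior_subset hs)
      rw [(hder s hs').deriv]
      have := hApos s hs'
      have : 0 ≤ s := (interior_subset hs).1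
      positivity
    · have hsub : Set.Icc t 0 ⊆ Set.Ioo (-1 : ℝ) 1 := fun s hs =>
        ⟨lt_of_lt_of_le ht.1 hs.1, by linarith [hs.2]⟩
      refine antitoneOn_of_deriv_nonpos (convex_Icc t 0) (hcont.mono hsub)
        (fun s hs => (hder s (hsub (interior_subset hs))).differentiableAt.differentiableWithinAt)
        (fun s hs => ?_) ⟨le_rfl, h⟩ ⟨h, le_rfl⟩ h
      have hs' := hsub (interior_subset hs)
      rw [(hder s hs').deriv]
      have := hApos s hs'
      have : s ≤ 0 := (interior_subset hs).2
      exact mul_nonpos_of_nonpos_of_nonneg this (by positivity)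
  set τ := gaussPoint N i
  have hτ := gaussPoint_mem_Ioo N i
  have hpos := one_sub_gaussPoint_sq_pos N i
  have hAτ : A.eval τ = ((1 - τ ^ 2) * (derivative P).eval τ) ^ 2 := by
    have : P.eval τ = 0 := legendre_eval_gaussPoint N i
    simp only [hA, hz, eval_add, eval_mul, eval_pow, eval_sub, eval_C, eval_X, eval_one, this]
    ring
  have hA0 : (N : ℝ) / 5 ≤ A.eval 0 := by
    refine (le_legendre_energy_at_zero hN).trans ?_
    have : A.eval 0 = (derivative P).eval 0 ^ 2 + (ν + 1 / 2) * P.eval 0 ^ 2 := by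
      simp only [hA, hz, eval_add, eval_mul, eval_pow, eval_sub, eval_C, eval_X, eval_one]
      ring
    rw [this]
    nlinarith [sq_nonneg (P.eval 0)]
  have h1 := hmin τ hτ
  rw [le_div_iff₀ hpos] at h1
  rw [← hAτ]
  refine abs_le_of_sq_le_sq' ?_ (hApos τ hτ) |>.2
  rw [mul_pow, Real.sq_sqrt hpos.le]
  refine le_trans ?_ h1
  gcongr

lemma gaussWeight_le {N : ℕ} (hN : 1 ≤ N) (i : Fin N) :
    gaussWeight N i ≤ 10 / N * Real.sqrt (1 - gaussPoint N i ^ 2) := by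
  have h1 := le_sq_derivative_legendre_gaussPoint hN i
  have h2 := one_sub_gaussPoint_sq_pos N i
  have h3 := eval_derivative_legendre_gaussPoint_ne_zero N i
  have hN' : (1 : ℝ) ≤ N := by exact_mod_cast hN
  rw [gaussWeight, div_le_iff₀ (by positivity)]
  set s := Real.sqrt (1 - gaussPoint N i ^ 2) with hs
  have hs0 : 0 < s := Real.sqrt_pos.2 h2
  have hs2 : s ^ 2 = 1 - gaussPoint N i ^ 2 := Real.sq_sqrt h2.le
  rw [← hs2] at h1 ⊢
  set d := (derivative (legendre N)).eval (gaussPoint N i)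
  have h4 : (N : ℝ) / 5 ≤ s ^ 3 * d ^ 2 := by
    refine le_of_mul_le_mul_right ?_ hs0
    nlinarith
  calc (2 : ℝ) = 10 / N * (N / 5) := by field_simp; norm_num
    _ ≤ 10 / N * (s ^ 3 * d ^ 2) := by gcongr
    _ = _ := by ring

/-- Summed form of `gaussWeight_le`. -/
lemma sum_gaussWeight_div_sqrt_le {N : ℕ} (hN : 1 ≤ N) :
    ∑ i, gaussWeight N i / Real.sqrt (1 - gaussPoint N i ^ 2) ≤ 10 := by
  have hN' : (1 : ℝ) ≤ N := by exact_mod_cast hN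
  calc ∑ i, gaussWeight N i / Real.sqrt (1 - gaussPoint N i ^ 2) ≤ ∑ _i : Fin N, 10 / (N : ℝ) := by
        refine Finset.sum_le_sum fun i _ => ?_
        rw [div_le_iff₀ (Real.sqrt_pos.2 (one_sub_gaussPoint_sq_pos N i))]
        exact gaussWeight_le hN i
    _ = 10 := by
        simp
        field_simp

/-! ### Spectral inequalities for Legendre expansions -/

/-- `p` is orthogonal to all polynomials of degree less than `n`. -/
def OrthLT (n : ℕ) (p : ℝ[X]) : Prop :=
  ∀ q : ℝ[X], q.degree < (n : WithBot ℕ) → polyInt (p * q) = 0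

/-- Splitting off the top Legendre coefficient. -/
lemma exists_eq_add_legendre {n : ℕ} {p : ℝ[X]} (hp : p.degree < ((n + 1 : ℕ) : WithBot ℕ)) :
    ∃ (q : ℝ[X]) (a : ℝ), q.degree < (n : WithBot ℕ) ∧ p = q + C a * legendre n := by
  have hlc : (legendre n).coeff n ≠ 0 := by
    have := leadingCoeff_ne_zero.2 (legendre_ne_zero n)
    rwa [leadingCoeff, legendre_natDegree] at this
  refine ⟨p - C (p.coeff n / (legendre n).coeff n) * legendre n, p.coeff n / (legendre n).coeff n,
    ?_, by ring⟩
  rw [degree_lt_iff_coeff_zero] at hp ⊢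
  intro m hm
  rw [coeff_sub, coeff_C_mul]
  rcases hm.eq_or_lt with h | h
  · rw [← h]
    field_simp
    ring
  · have h0 : (legendre n).coeff m = 0 :=
      coeff_eq_zero_of_natDegree_lt (by rw [legendre_natDegree]; exact h)
    rw [hp m h, h0]
    ring

lemma eq_zero_of_degree_lt_zero {p : ℝ[X]} (hp : p.degree < ((0 : ℕ) : WithBot ℕ)) : p = 0 := by
  rw [← degree_eq_bot]
  exact Nat.WithBot.lt_zero_iff.1 (by simpa using hp)

lemma polyInt_add_sq (q P : ℝ[X]) (a : ℝ) (h : polyInt (P * q) = 0) :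
    polyInt ((q + C a * P) * (q + C a * P)) = polyInt (q * q) + a ^ 2 * polyInt (P * P) := by
  have e : (q + C a * P) * (q + C a * P) = q * q + C (2 * a) * (P * q) + C (a ^ 2) * (P * P) := by
    simp [C_two]
    ring
  rw [e, map_add, map_add, polyInt_C_mul, polyInt_C_mul, h]
  ring

lemma polyInt_weight_derivative_legendre_mul (n : ℕ) (q : ℝ[X]) :
    polyInt ((1 - X ^ 2) * (derivative (legendre n) * derivative q)) =
      n * (n + 1) * polyInt (legendre n * q) := by
  have h := polyInt_derivative_mul q ((1 - X ^ 2) * derivative (legendre n))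
  rw [derivative_legendre_ode] at h
  have e1 : derivative q * ((1 - X ^ 2) * derivative (legendre n)) =
      (1 - X ^ 2) * (derivative (legendre n) * derivative q) := by ring
  have e2 : q * -(C ((n : ℝ) * (n + 1)) * legendre n) =
      -(C ((n : ℝ) * (n + 1)) * (legendre n * q)) := by ring
  rw [e1, e2, map_neg, polyInt_C_mul] at h
  simp at h
  rw [h]

/-- Inverse inequality: `∫ (1 - t²) p'² ≤ n² ∫ p²` for `deg p < n`. -/
lemma polyInt_weight_derivative_sq_le {n : ℕ} {p : ℝ[X]} (hp : p.degree < (n : WithBot ℕ)) :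
    polyInt ((1 - X ^ 2) * (derivative p * derivative p)) ≤ (n : ℝ) ^ 2 * polyInt (p * p) := by
  induction n generalizing p with
  | zero =>
    rw [eq_zero_of_degree_lt_zero hp]
    simp
  | succ n ih =>
    obtain ⟨q, a, hq, rfl⟩ := exists_eq_add_legendre hp
    have h0 := polyInt_legendre_mul_eq_zero hq
    have h1 := polyInt_weight_derivative_legendre_mul n q
    have h2 := polyInt_weight_derivative_legendre_mul n (legendre n)
    have e : (1 - X ^ 2) * (derivative (q + C a * legendre n) *
        derivative (q + C a * legendre n)) = (1 - X ^ 2) * (derivative q * derivative q) +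
        C (2 * a) * ((1 - X ^ 2) * (derivative (legendre n) * derivative q)) +
        C (a ^ 2) * ((1 - X ^ 2) * (derivative (legendre n) * derivative (legendre n))) := by
      simp [C_two]
      ring
    rw [polyInt_add_sq _ _ _ h0, e, map_add, map_add, polyInt_C_mul, polyInt_C_mul, h1, h2, h0]
    have h3 := polyInt_sq_nonneg q
    have h4 := mul_nonneg (sq_nonneg a) (polyInt_sq_nonneg (legendre n))
    have h5 := ih hq
    have hn : (0 : ℝ) ≤ n := Nat.cast_nonneg n
    push_cast
    nlinarith [mul_nonneg hn h3, mul_nonneg hn h4]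

/-- Point evaluation at an endpoint, where all the Legendre polynomials have modulus one. -/
lemma eval_endpoint_sq_le {n : ℕ} {p : ℝ[X]} (hp : p.degree < (n : WithBot ℕ)) {t : ℝ}
    (ht : t = 1 ∨ t = -1) : p.eval t ^ 2 ≤ (n : ℝ) ^ 2 / 2 * polyInt (p * p) := by
  induction n generalizing p with
  | zero =>
    rw [eq_zero_of_degree_lt_zero hp]
    simp
  | succ n ih =>
    obtain ⟨q, a, hq, rfl⟩ := exists_eq_add_legendre hp
    have h0 := polyInt_legendre_mul_eq_zero hq
    rw [polyInt_add_sq _ _ _ h0, polyInt_legendre_sq, eval_add, eval_mul, eval_C]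
    have hP : (legendre n).eval t ^ 2 = 1 := by
      rcases ht with rfl | rfl
      · rw [legendre_eval_one]; norm_num
      · exact legendre_eval_neg_one_sq n
    have h5 := ih hq
    have h3 := polyInt_sq_nonneg q
    have hn : (0 : ℝ) ≤ n := Nat.cast_nonneg n
    set x := q.eval t
    set y := a * (legendre n).eval t with hy
    have hy2 : y ^ 2 = a ^ 2 := by rw [hy, mul_pow, hP, mul_one]
    set u := polyInt (q * q)
    set b : ℝ := (2 * n + 1) / 2 with hb
    have hb0 : 0 < b := by positivity
    have ha : a ^ 2 * (2 / (2 * n + 1)) = y ^ 2 / b := by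
      rw [hy2, hb]
      field_simp
    rw [ha]
    push_cast
    have hc : ((n : ℝ) + 1) ^ 2 / 2 = n ^ 2 / 2 + b := by rw [hb]; ring
    rw [hc]
    set α : ℝ := (n : ℝ) ^ 2 / 2 with hα
    have hα0 : 0 ≤ α := by positivity
    set v := y ^ 2 / b with hv
    have hyv : y ^ 2 = b * v := by rw [hv]; field_simp
    have hv0 : 0 ≤ v := by positivity
    have h6 : 2 * (x * y) ≤ b * u + α * v := by
      refine abs_le_of_sq_le_sq' ?_ (by positivity) |>.2
      have : (x * y) ^ 2 ≤ (α * u) * (b * v) := by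
        rw [mul_pow, hyv]
        gcongr
      nlinarith [sq_nonneg (b * u - α * v)]
    nlinarith

/-- If `r` is orthogonal to the polynomials of degree less than `n`, its antiderivative is
`(1 - t²) g` with `n² ∫ (1 - t²) g² ≤ ∫ r²`. -/
lemma OrthLT.exists_antideriv {n : ℕ} (hn : 1 ≤ n) {r : ℝ[X]} (hr : OrthLT n r) :
    ∃ g : ℝ[X], antideriv r = (1 - X ^ 2) * g ∧
      (n : ℝ) ^ 2 * polyInt ((1 - X ^ 2) * (g * g)) ≤ polyInt (r * r) := by
  have key : ∀ M : ℕ, ∀ r : ℝ[X], r.degree < (M : WithBot ℕ) → OrthLT n r →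
      ∃ g : ℝ[X], derivative ((1 - X ^ 2) * g) = r ∧
        (n : ℝ) ^ 2 * polyInt ((1 - X ^ 2) * (g * g)) ≤ polyInt (r * r) := by
    intro M
    induction M with
    | zero =>
      intro r hr _
      rw [eq_zero_of_degree_lt_zero hr]
      exact ⟨0, by simp⟩
    | succ M ih =>
      intro r hdeg hr
      rcases lt_or_ge M n with hM | hM
      · have h0 : r = 0 := by
          have := hr r (hdeg.trans_le (by exact_mod_cast hM))
          by_contra hne
          refine (polyInt_pos (mul_ne_zero hne hne) fun t _ => ?_).ne' this
          rw [eval_mul]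
          exact mul_self_nonneg _
        rw [h0]
        exact ⟨0, by simp⟩
      · obtain ⟨q, a, hq, rfl⟩ := exists_eq_add_legendre hdeg
        have hqo : OrthLT n q := fun s hs => by
          have h1 := hr s hs
          rw [add_mul, mul_assoc, map_add, polyInt_C_mul,
            polyInt_legendre_mul_eq_zero (hs.trans_le (by exact_mod_cast hM))] at h1
          linarith
        obtain ⟨g, hg, hgn⟩ := ih q hq hqo
        have hM0 : (0 : ℝ) < M := by exact_mod_cast (by omega : 0 < M)
        set ν : ℝ := (M : ℝ) * (M + 1) with hν
        have hν0 : 0 < ν := by positivity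
        have hνi : (C ν⁻¹ : ℝ[X]) * C ν = 1 := by
          rw [← C_mul, inv_mul_cancel₀ hν0.ne', C_1]
        refine ⟨g + C (-(a * ν⁻¹)) * derivative (legendre M), ?_, ?_⟩
        · rw [mul_add, derivative_add, hg,
            show (1 - X ^ 2) * (C (-(a * ν⁻¹)) * derivative (legendre M)) =
              C (-(a * ν⁻¹)) * ((1 - X ^ 2) * derivative (legendre M)) by ring,
            derivative_C_mul, derivative_legendre_ode, ← hν, C_neg, C_mul]
          linear_combination (C a * legendre M) * hνi
        · have h0 := polyInt_legendre_mul_eq_zero hq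
          have hcross : polyInt ((1 - X ^ 2) * (derivative (legendre M) * g)) = 0 := by
            have h := polyInt_derivative_mul (legendre M) ((1 - X ^ 2) * g)
            rw [hg, h0] at h
            rw [show (1 - X ^ 2) * (derivative (legendre M) * g) =
              derivative (legendre M) * ((1 - X ^ 2) * g) by ring, h]
            simp
          have h2 := polyInt_weight_derivative_legendre_mul M (legendre M)
          set b := -(a * ν⁻¹) with hb
          have e : (1 - X ^ 2) * ((g + C b * derivative (legendre M)) *
              (g + C b * derivative (legendre M))) = (1 - X ^ 2) * (g * g) +
              C (2 * b) * ((1 - X ^ 2) * (derivative (legendre M) * g)) +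
              C (b ^ 2) * ((1 - X ^ 2) * (derivative (legendre M) * derivative (legendre M))) := by
            rw [C_mul, C_pow, C_two]
            ring
          rw [polyInt_add_sq _ _ _ h0, e, map_add, map_add, polyInt_C_mul, polyInt_C_mul, h2,
            hcross, ← hν]
          have h3 := mul_nonneg (sq_nonneg a) (polyInt_sq_nonneg (legendre M))
          have h4 : (n : ℝ) ^ 2 ≤ ν := by
            have : (n : ℝ) ≤ M := by exact_mod_cast hM
            nlinarith
          have h5 : (n : ℝ) ^ 2 * (b ^ 2 * (ν * polyInt (legendre M * legendre M))) ≤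
              a ^ 2 * polyInt (legendre M * legendre M) := by
            have : b ^ 2 * (ν * polyInt (legendre M * legendre M)) =
                (a ^ 2 * polyInt (legendre M * legendre M)) / ν := by
              rw [hb]
              field_simp
            rw [this, mul_div_assoc', div_le_iff₀ hν0]
            nlinarith
          nlinarith
  obtain ⟨g, hg, hgn⟩ := key (r.natDegree + 1) r
    (degree_le_natDegree.trans_lt (by exact_mod_cast Nat.lt_succ_self _)) hr
  refine ⟨g, ?_, hgn⟩
  have hd : derivative (antideriv r - (1 - X ^ 2) * g) = 0 := by
    rw [derivative_sub, derivative_antideriv, hg, sub_self]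
  have h1 := eq_C_of_derivative_eq_zero hd
  generalize (antideriv r - (1 - X ^ 2) * g).coeff 0 = c at h1
  have h2 := congrArg (eval (-1)) h1
  rw [eval_sub, antideriv_eval_neg_one, eval_C] at h2
  simp at h2
  rw [← h2, C_0] at h1
  exact sub_eq_zero.1 h1

lemma OrthLT.antideriv_eval_one {n : ℕ} (hn : 1 ≤ n) {r : ℝ[X]} (hr : OrthLT n r) :
    (antideriv r).eval 1 = 0 := by
  obtain ⟨g, hg, -⟩ := hr.exists_antideriv hn
  simp [hg]

lemma OrthLT.polyNorm_antideriv_le {n : ℕ} (hn : 1 ≤ n) {r : ℝ[X]} (hr : OrthLT n r) :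
    n * polyNorm (antideriv r) ≤ polyNorm r := by
  obtain ⟨g, hg, h⟩ := hr.exists_antideriv hn
  refine abs_le_of_sq_le_sq' ?_ (polyNorm_nonneg _) |>.2
  rw [mul_pow, polyNorm_sq, polyNorm_sq, hg]
  refine le_trans ?_ h
  gcongr
  refine polyInt_mono fun t ht => ?_
  simp only [eval_mul, eval_sub, eval_one, eval_pow, eval_X]
  have h1 : 0 ≤ 1 - t ^ 2 := by nlinarith [ht.1, ht.2]
  have h2 : 0 ≤ t ^ 2 := sq_nonneg t
  have h3 := mul_nonneg (mul_nonneg h1 h2) (mul_self_nonneg (g.eval t))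
  nlinarith

/-! ### Best approximation by polynomials -/

/-- Orthogonal projection onto the polynomials of degree less than `n`. -/
lemma exists_projection (n : ℕ) (g : ℝ[X]) :
    ∃ π : ℝ[X], π.degree < (n : WithBot ℕ) ∧ OrthLT n (g - π) := by
  induction n with
  | zero =>
    refine ⟨0, by simp, fun q hq => ?_⟩
    rw [eq_zero_of_degree_lt_zero hq]
    simp
  | succ n ih =>
    obtain ⟨π, hπ, ho⟩ := ih
    set P := legendre n with hP
    have hh : polyInt (P * P) ≠ 0 := by
      rw [hP, polyInt_legendre_sq]
      positivity
    refine ⟨π + C (polyInt (g * P) / polyInt (P * P)) * P, ?_, ?_⟩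
    · refine (degree_add_le _ _).trans_lt (max_lt ?_ ?_)
      · exact hπ.trans (by exact_mod_cast Nat.lt_succ_self n)
      · refine degree_mul_lt (a := 1) (b := n + 1) (degree_C_lt) ?_ (by omega)
        rw [hP, legendre_degree]
        exact_mod_cast Nat.lt_succ_self n
    · intro q hq
      obtain ⟨s, a, hs, rfl⟩ := exists_eq_add_legendre hq
      have h1 := ho s hs
      have h2 := polyInt_legendre_mul_eq_zero hs
      have h3 := polyInt_legendre_mul_eq_zero hπ
      rw [← hP] at h2 h3 ⊢
      generalize hc : polyInt (g * P) / polyInt (P * P) = c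
      have hc' : polyInt (g * P) = c * polyInt (P * P) := by
        rw [← hc]
        field_simp
      have e : (g - (π + C c * P)) * (s + C a * P) = (g - π) * s - C c * (P * s) +
          (C a * (g * P) - C a * (P * π) - C (a * c) * (P * P)) := by
        rw [C_mul]
        ring
      rw [e, map_add, map_sub, map_sub, map_sub, polyInt_C_mul, polyInt_C_mul, polyInt_C_mul,
        polyInt_C_mul, h1, h2, h3, hc']
      ring

lemma polyNorm_sub_projection_le {n : ℕ} {g π : ℝ[X]} (hπ : π.degree < (n : WithBot ℕ))
    (ho : OrthLT n (g - π)) {q : ℝ[X]} (hq : q.degree < (n : WithBot ℕ)) :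
    polyNorm (g - π) ≤ polyNorm (g - q) := by
  have h1 := abs_polyInt_mul_le (g - π) (g - q)
  have h2 := ho (π - q) ((degree_sub_le _ _).trans_lt (max_lt hπ hq))
  rw [show (g - π) * (g - q) = (g - π) * (g - π) + (g - π) * (π - q) by ring, map_add, h2, add_zero,
    ← polyNorm_sq, abs_of_nonneg (sq_nonneg _), sq] at h1
  rcases (polyNorm_nonneg (g - π)).eq_or_lt with h | h
  · rw [← h]
    exact polyNorm_nonneg _
  · exact le_of_mul_le_mul_left h1 h

/-- The rate of best approximation in `L²`, by duality: the antiderivative of `g - π` is smaller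
than `g - π` by a factor `n`, and it is paired with `g'` up to polynomials of lower degree. -/
lemma descFactorial_mul_polyNorm_sub_projection_le {k n : ℕ} (hk : k ≤ n) {g π : ℝ[X]}
    (hπ : π.degree < (n : WithBot ℕ)) (ho : OrthLT n (g - π)) :
    n.descFactorial k * polyNorm (g - π) ≤ polyNorm (derivative^[k] g) := by
  induction k generalizing n g π with
  | zero =>
    have := polyNorm_sub_projection_le hπ ho (q := 0) (by
      rw [degree_zero]
      exact WithBot.bot_lt_coe _)
    simpa using this
  | succ k ih =>
    obtain ⟨m, rfl⟩ : ∃ m, n = m + 1 := ⟨n - 1, by omega⟩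
    obtain ⟨ρ, hρ, hρo⟩ := exists_projection m (derivative g)
    have h1 := ih (by omega) hρ hρo
    rw [← Function.iterate_succ_apply] at h1
    refine le_trans ?_ h1
    rw [Nat.succ_descFactorial_succ]
    have hm : (0 : ℝ) ≤ (m.descFactorial k : ℝ) := Nat.cast_nonneg _
    suffices h : ((m + 1 : ℕ) : ℝ) * polyNorm (g - π) ≤ polyNorm (derivative g - ρ) by
      push_cast at h ⊢
      nlinarith
    have hv := ho.polyNorm_antideriv_le (by omega)
    have hv1 := ho.antideriv_eval_one (by omega)
    set r := g - π with hr
    have h2 : polyInt (r * r) = -polyInt (antideriv r * (derivative g - ρ)) := by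
      have e1 := ho (π - antideriv ρ) ((degree_sub_le _ _).trans_lt
        (max_lt hπ (degree_antideriv_lt hρ)))
      have e2 := polyInt_derivative_mul (antideriv r) (g - antideriv ρ)
      rw [hv1, antideriv_eval_neg_one, derivative_antideriv, derivative_sub,
        derivative_antideriv] at e2
      rw [show r * (g - antideriv ρ) = r * r + r * (π - antideriv ρ) by rw [hr]; ring, map_add,
        e1] at e2
      linarith
    have h3 := abs_polyInt_mul_le (antideriv r) (derivative g - ρ)
    have h4 : polyNorm r ^ 2 ≤ polyNorm (antideriv r) * polyNorm (derivative g - ρ) := by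
      rw [polyNorm_sq, h2]
      exact (neg_le_abs _).trans h3
    rcases (polyNorm_nonneg r).eq_or_lt with h | h
    · rw [← h, mul_zero]
      exact polyNorm_nonneg _
    · have h5 := polyNorm_nonneg (derivative g - ρ)
      refine le_of_mul_le_mul_right ?_ h
      nlinarith

/-- `(N / e)^k ≤ N! / (N - k)!`. -/
lemma pow_le_exp_mul_descFactorial {k N : ℕ} (hk : k ≤ N) :
    (N : ℝ) ^ k ≤ Real.exp 1 ^ k * N.descFactorial k := by
  induction k generalizing N with
  | zero => simp
  | succ k ih =>
    obtain ⟨M, rfl⟩ : ∃ M, N = M + 1 := ⟨N - 1, by omega⟩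
    have h1 := ih (N := M) (by omega)
    rw [Nat.succ_descFactorial_succ]
    push_cast
    -- `(1 + 1 / M)^k ≤ (1 + 1 / M)^M ≤ e`.
    have h2 : ((M : ℝ) + 1) ^ k ≤ Real.exp 1 * (M : ℝ) ^ k := by
      rcases Nat.eq_zero_or_pos M with rfl | hM
      · obtain rfl : k = 0 := by omega
        simp
      · have hM0 : (0 : ℝ) < M := by exact_mod_cast hM
        have h3 : 1 + 1 / (M : ℝ) ≤ Real.exp (1 / M) := by
          linarith [Real.add_one_le_exp (1 / (M : ℝ))]
        have h4 : (1 + 1 / (M : ℝ)) ^ k ≤ Real.exp 1 := by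
          calc (1 + 1 / (M : ℝ)) ^ k ≤ (1 + 1 / (M : ℝ)) ^ M :=
                pow_le_pow_right₀ (by simp) (by omega)
            _ ≤ Real.exp (1 / M) ^ M := by gcongr
            _ = Real.exp 1 := by
                rw [← Real.exp_nat_mul]
                congr 1
                field_simp
        calc ((M : ℝ) + 1) ^ k = (1 + 1 / (M : ℝ)) ^ k * (M : ℝ) ^ k := by
              rw [← mul_pow]
              congr 1
              field_simp
          _ ≤ _ := by gcongr
    calc ((M : ℝ) + 1) ^ (k + 1) = ((M : ℝ) + 1) * ((M : ℝ) + 1) ^ k := by ring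
      _ ≤ ((M : ℝ) + 1) * (Real.exp 1 * (Real.exp 1 ^ k * M.descFactorial k)) := by
        gcongr
        exact h2.trans (mul_le_mul_of_nonneg_left h1 (Real.exp_pos 1).le)
      _ = _ := by ring

/-! ### Pointwise bounds for polynomials vanishing at the endpoints -/

lemma eval_le_eval_of_derivative_nonneg {p : ℝ[X]} {a b : ℝ} (hab : a ≤ b)
    (h : ∀ t ∈ Set.Icc a b, 0 ≤ (derivative p).eval t) : p.eval a ≤ p.eval b := by
  refine monotoneOn_of_deriv_nonneg (convex_Icc a b) p.continuous.continuousOn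
    p.differentiable.differentiableOn (fun x hx => ?_) ⟨le_rfl, hab⟩ ⟨hab, le_rfl⟩ hab
  rw [Polynomial.deriv]
  exact h x (interior_subset hx)

lemma antideriv_eval_nonneg {w : ℝ[X]} (hw : ∀ t ∈ Set.Icc (-1 : ℝ) 1, 0 ≤ w.eval t) {t : ℝ}
    (ht : t ∈ Set.Icc (-1 : ℝ) 1) : 0 ≤ (antideriv w).eval t := by
  rw [← antideriv_eval_neg_one w]
  refine eval_le_eval_of_derivative_nonneg ht.1 fun s hs => ?_
  rw [derivative_antideriv]
  exact hw s ⟨hs.1, hs.2.trans ht.2⟩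

lemma antideriv_eval_le {w : ℝ[X]} (hw : ∀ t ∈ Set.Icc (-1 : ℝ) 1, 0 ≤ w.eval t) {t : ℝ}
    (ht : t ∈ Set.Icc (-1 : ℝ) 1) : (antideriv w).eval t ≤ polyInt w := by
  rw [← antideriv_eval_one w]
  refine eval_le_eval_of_derivative_nonneg ht.2 fun s hs => ?_
  rw [derivative_antideriv]
  exact hw s ⟨ht.1.trans hs.1, hs.2⟩

/-- `p(t)² = 2 ∫_{-1}^t p p'`, combined with the inequality of the means. -/
lemma eval_sq_le_of_eval_neg_one {p : ℝ[X]} (hp : p.eval (-1) = 0) {c : ℝ} (hc : 0 < c) {t : ℝ}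
    (ht : t ∈ Set.Icc (-1 : ℝ) 1) :
    p.eval t ^ 2 ≤ c * polyInt (p * p) + c⁻¹ * polyInt (derivative p * derivative p) := by
  set w : ℝ[X] := C c * (p * p) + C c⁻¹ * (derivative p * derivative p) with hw
  have hwpos : ∀ t ∈ Set.Icc (-1 : ℝ) 1, 0 ≤ w.eval t := by
    intro t _
    simp only [hw, eval_add, eval_mul, eval_C]
    have := mul_self_nonneg (p.eval t)
    have := mul_self_nonneg ((derivative p).eval t)
    positivity
  have h1 := antideriv_eval_le hwpos ht
  rw [hw, map_add, polyInt_C_mul, polyInt_C_mul, ← hw] at h1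
  refine le_trans ?_ h1
  have h2 := eval_le_eval_of_derivative_nonneg (p := antideriv w - p ^ 2) ht.1 fun s _ => by
    rw [derivative_sub, derivative_antideriv, derivative_pow]
    simp only [hw, eval_sub, eval_add, eval_mul, eval_C, eval_pow]
    set x := p.eval s
    set y := (derivative p).eval s
    have : 0 ≤ c * (x - c⁻¹ * y) ^ 2 := by positivity
    have e : c * (x - c⁻¹ * y) ^ 2 = c * (x * x) + c⁻¹ * (y * y) - 2 * x * y := by
      field_simp
      ring
    push_cast
    simp only [pow_one]
    linarith
  rw [eval_sub, eval_sub, antideriv_eval_neg_one, eval_pow, eval_pow, hp] at h2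
  linarith

lemma polyNorm_le_of_eval_neg_one {p : ℝ[X]} (hp : p.eval (-1) = 0) :
    polyNorm p ≤ 4 * polyNorm (derivative p) := by
  have h := polyInt_mono (p := p * p)
    (q := C (1 / 4 * polyInt (p * p) + (1 / 4)⁻¹ * polyInt (derivative p * derivative p)))
    fun t ht => by
      rw [eval_mul, ← sq, eval_C]
      exact eval_sq_le_of_eval_neg_one hp (by norm_num) ht
  rw [polyInt_C] at h
  refine abs_le_of_sq_le_sq' ?_ (mul_nonneg (by norm_num) (polyNorm_nonneg _)) |>.2
  rw [mul_pow, polyNorm_sq, polyNorm_sq]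
  linarith

/-- A weighted variant of `eval_sq_le_of_eval_neg_one`: `e = (1 - t²) g` decays at the endpoints,
because `1 - s² ≤ √(1 - t²) √(1 - s²)` for `s` between `t` and the nearest endpoint. -/
lemma eval_sq_le_of_eq_weight_mul {e g : ℝ[X]} (he : e = (1 - X ^ 2) * g) {c : ℝ} (hc : 0 < c)
    {t : ℝ} (ht : t ∈ Set.Icc (-1 : ℝ) 1) :
    e.eval t ^ 2 ≤ Real.sqrt (1 - t ^ 2) * (c * polyInt ((1 - X ^ 2) * (g * g)) +
      c⁻¹ * polyInt (derivative e * derivative e)) := by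
  set v := derivative e with hv
  set w : ℝ[X] := C c * ((1 - X ^ 2) * (g * g)) + C c⁻¹ * (v * v) with hw
  set m := Real.sqrt (1 - t ^ 2) with hm
  have hm0 : 0 ≤ m := Real.sqrt_nonneg _
  have hwpos : ∀ t ∈ Set.Icc (-1 : ℝ) 1, 0 ≤ w.eval t := by
    intro t ht
    simp only [hw, eval_add, eval_mul, eval_C, eval_sub, eval_one, eval_pow, eval_X]
    have h1 : 0 ≤ 1 - t ^ 2 := by nlinarith [ht.1, ht.2]
    have := mul_self_nonneg (g.eval t)
    have := mul_self_nonneg (v.eval t)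
    positivity
  have e1 : e.eval 1 = 0 := by simp [he]
  have e2 : e.eval (-1) = 0 := by simp [he]
  have hle := antideriv_eval_le hwpos ht
  have hge := antideriv_eval_nonneg hwpos ht
  have hI : polyInt w = c * polyInt ((1 - X ^ 2) * (g * g)) + c⁻¹ * polyInt (v * v) := by
    rw [hw, map_add, polyInt_C_mul, polyInt_C_mul]
  rw [← hI]
  have key : ∀ s ∈ Set.Icc (-1 : ℝ) 1, t ^ 2 ≤ s ^ 2 →
      |2 * (e.eval s * v.eval s)| ≤ m * w.eval s := by
    intro s hs hst
    have h0 : 0 ≤ 1 - s ^ 2 := by nlinarith [hs.1, hs.2]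
    set q := Real.sqrt (1 - s ^ 2) with hq
    have hq2 : q ^ 2 = 1 - s ^ 2 := Real.sq_sqrt h0
    have hq0 : 0 ≤ q := Real.sqrt_nonneg _
    have hqm : q ≤ m := Real.sqrt_le_sqrt (by linarith)
    simp only [he, hw, eval_add, eval_mul, eval_C, eval_sub, eval_one, eval_pow, eval_X, ← hq2]
    set x := g.eval s
    set y := v.eval s
    have h1 : |2 * (q ^ 2 * x * y)| = q * (2 * ((q * |x|) * |y|)) := by
      rw [abs_mul, abs_mul, abs_mul, abs_of_nonneg (sq_nonneg q), abs_two]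
      ring
    have h2 : 2 * ((q * |x|) * |y|) ≤ c * (q ^ 2 * (x * x)) + c⁻¹ * (y * y) := by
      have : 0 ≤ c * (q * |x| - c⁻¹ * |y|) ^ 2 := by positivity
      have e : c * (q * |x| - c⁻¹ * |y|) ^ 2 =
          c * (q ^ 2 * |x| ^ 2) + c⁻¹ * |y| ^ 2 - 2 * ((q * |x|) * |y|) := by
        field_simp
        ring
      rw [sq_abs, sq_abs] at e
      nlinarith
    rw [h1]
    have h3 : 0 ≤ 2 * ((q * |x|) * |y|) := by positivity
    calc q * (2 * ((q * |x|) * |y|)) ≤ m * (2 * ((q * |x|) * |y|)) := by gcongr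
      _ ≤ _ := by gcongr
  rcases le_total t 0 with h | h
  · have h2 := eval_le_eval_of_derivative_nonneg (p := C m * antideriv w - e ^ 2) ht.1
      fun s hs => by
        have := (abs_le.1 (key s ⟨hs.1, hs.2.trans ht.2⟩ (by nlinarith [hs.2]))).2
        rw [derivative_sub, derivative_C_mul, derivative_antideriv, derivative_pow]
        simp only [eval_sub, eval_mul, eval_C, eval_pow]
        push_cast
        simp only [pow_one]
        linarith
    simp only [eval_sub, eval_mul, eval_C, eval_pow, antideriv_eval_neg_one, e2] at h2
    have := mul_le_mul_of_nonneg_left hle hm0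
    linarith
  · have h2 := eval_le_eval_of_derivative_nonneg (p := C m * antideriv w + e ^ 2) ht.2
      fun s hs => by
        have := (abs_le.1 (key s ⟨ht.1.trans hs.1, hs.2⟩ (by nlinarith [hs.1]))).1
        rw [derivative_add, derivative_C_mul, derivative_antideriv, derivative_pow]
        simp only [eval_add, eval_mul, eval_C, eval_pow]
        push_cast
        simp only [pow_one]
        linarith
    simp only [eval_add, eval_mul, eval_C, eval_pow, antideriv_eval_one, e1] at h2
    have := mul_nonneg hm0 hge
    linarith

/-! ### Stability of the Gauss quadrature of `e φ'` -/

/-- Pairing of `e = ∫ r`, where `r` is orthogonal to polynomials of degree less than `N`, with the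
derivative of a polynomial. -/
lemma gaussQuad_antideriv_mul_derivative_sq_le {N : ℕ} (hN : 1 ≤ N) {r φ : ℝ[X]}
    (hr : OrthLT N r) (hφ : φ.degree < (N : WithBot ℕ)) :
    gaussQuad N (antideriv r * derivative φ) ^ 2 ≤
      20 * N * polyInt (r * r) * polyInt (φ * φ) := by
  have hN0 : (0 : ℝ) < N := by exact_mod_cast hN
  obtain ⟨g, hg, hgn⟩ := hr.exists_antideriv hN
  set e := antideriv r with he
  have hpt : ∀ t ∈ Set.Icc (-1 : ℝ) 1,
      e.eval t ^ 2 ≤ Real.sqrt (1 - t ^ 2) * (2 / N * polyInt (r * r)) := by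
    intro t ht
    refine (eval_sq_le_of_eq_weight_mul hg hN0 ht).trans ?_
    rw [he, derivative_antideriv]
    gcongr
    have : (N : ℝ) * polyInt ((1 - X ^ 2) * (g * g)) ≤ (N : ℝ)⁻¹ * polyInt (r * r) := by
      rw [inv_mul_eq_div, le_div_iff₀ hN0]
      linarith
    calc _ ≤ (N : ℝ)⁻¹ * polyInt (r * r) + (N : ℝ)⁻¹ * polyInt (r * r) := by linarith
      _ = _ := by ring
  set s : Fin N → ℝ := fun i => Real.sqrt (1 - gaussPoint N i ^ 2) with hs
  have hs0 : ∀ i, 0 < s i := fun i => Real.sqrt_pos.2 (one_sub_gaussPoint_sq_pos N i)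
  have hs2 : ∀ i, s i ^ 2 = 1 - gaussPoint N i ^ 2 := fun i =>
    Real.sq_sqrt (one_sub_gaussPoint_sq_pos N i).le
  have hω := gaussWeight_pos N
  set a : Fin N → ℝ := fun i => Real.sqrt (gaussWeight N i) * (e.eval (gaussPoint N i) / s i)
  set b : Fin N → ℝ := fun i =>
    Real.sqrt (gaussWeight N i) * (s i * (derivative φ).eval (gaussPoint N i))
  have hab : gaussQuad N (e * derivative φ) = ∑ i, a i * b i := by
    refine Finset.sum_congr rfl fun i _ => ?_
    rw [show a i * b i = (Real.sqrt (gaussWeight N i) * Real.sqrt (gaussWeight N i)) *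
      (e.eval (gaussPoint N i) * (derivative φ).eval (gaussPoint N i)) * (s i / s i) by
        simp only [a, b]; ring, Real.mul_self_sqrt (hω i).le, div_self (hs0 i).ne', eval_mul,
      mul_one]
  have ha : ∑ i, a i ^ 2 ≤ 20 / N * polyInt (r * r) := by
    have h1 : ∀ i, a i ^ 2 ≤ gaussWeight N i / s i * (2 / N * polyInt (r * r)) := by
      intro i
      simp only [a]
      rw [mul_pow, Real.sq_sqrt (hω i).le, div_pow, div_mul_eq_mul_div, mul_div_assoc]
      refine mul_le_mul_of_nonneg_left ?_ (hω i).le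
      rw [div_le_div_iff₀ (pow_pos (hs0 i) 2) (hs0 i)]
      have := hpt _ (gaussPoint_mem_Icc N i)
      have := mul_le_mul_of_nonneg_right this (hs0 i).le
      refine this.trans (le_of_eq ?_)
      simp only [hs]
      ring
    calc ∑ i, a i ^ 2 ≤ ∑ i, gaussWeight N i / s i * (2 / N * polyInt (r * r)) :=
          Finset.sum_le_sum fun i _ => h1 i
      _ = (∑ i, gaussWeight N i / s i) * (2 / N * polyInt (r * r)) := by rw [Finset.sum_mul]
      _ ≤ 10 * (2 / N * polyInt (r * r)) := by
          have := polyInt_sq_nonneg r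
          exact mul_le_mul_of_nonneg_right (sum_gaussWeight_div_sqrt_le hN) (by positivity)
      _ = _ := by ring
  have hb : ∑ i, b i ^ 2 ≤ (N : ℝ) ^ 2 * polyInt (φ * φ) := by
    have h1 : ∑ i, b i ^ 2 = gaussQuad N ((1 - X ^ 2) * (derivative φ * derivative φ)) := by
      refine Finset.sum_congr rfl fun i _ => ?_
      simp only [b]
      rw [mul_pow, mul_pow, Real.sq_sqrt (hω i).le, hs2]
      simp only [eval_mul, eval_sub, eval_one, eval_pow, eval_X]
      ring
    obtain ⟨n, rfl⟩ : ∃ n, N = n + 1 := ⟨N - 1, by omega⟩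
    have hφ' := degree_derivative_lt_of_succ hφ
    have h2 : ((1 : ℝ[X]) - X ^ 2).degree < ((3 : ℕ) : WithBot ℕ) := by
      refine (degree_sub_le _ _).trans_lt (max_lt ?_ ?_)
      · rw [degree_one]; exact_mod_cast (by norm_num : 0 < 3)
      · rw [degree_X_pow]; exact_mod_cast (by norm_num : 2 < 3)
    rw [h1, ← mul_assoc, gaussQuad_mul_eq_polyInt
      (degree_mul_lt (c := n + 2) h2 hφ' (by omega)) hφ' (by omega), mul_assoc]
    exact polyInt_weight_derivative_sq_le hφ
  rw [hab]
  refine (Finset.sum_mul_sq_le_sq_mul_sq _ a b).trans ?_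
  calc (∑ i, a i ^ 2) * ∑ i, b i ^ 2 ≤
        (20 / N * polyInt (r * r)) * ((N : ℝ) ^ 2 * polyInt (φ * φ)) := by
        have := polyInt_sq_nonneg r
        have : 0 ≤ ∑ i, b i ^ 2 := Finset.sum_nonneg fun i _ => sq_nonneg _
        gcongr
    _ = _ := by field_simp

/-! ### Extrapolation to the right endpoint -/

/-- Interpolating a decreasing step function and evaluating to the right of the nodes gives values
of alternating sign, by induction along Neville's recursion. -/
lemma interpolate_step_sign {t : ℕ → ℝ} {x : ℝ} (m d a : ℕ)
    (ht : StrictMonoOn t (Set.Icc a (a + d))) (hx : t (a + d) ≤ x) (ham : a ≤ m)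
    (hm : m ≤ a + d + 1) :
    0 ≤ (-1 : ℝ) ^ (a + d + 1 - m) * (Lagrange.interpolate (Finset.Icc a (a + d)) t
      (fun j => if j < m then (1 : ℝ) else 0)).eval x := by
  have hinj : ∀ a d, StrictMonoOn t (Set.Icc a (a + d)) →
      Set.InjOn t (Finset.Icc a (a + d) : Finset ℕ) := fun a d h => by
    rw [Finset.coe_Icc]
    exact h.injOn
  induction d generalizing a with
  | zero =>
    rcases ham.eq_or_lt with rfl | h
    · simp
    · obtain rfl : m = a + 1 := by omega
      simp
  | succ d ih =>
    rcases ham.eq_or_lt with rfl | h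
    · have : Lagrange.interpolate (Finset.Icc a (a + (d + 1))) t
          (fun j => if j < a then (1 : ℝ) else 0) = 0 := by
        rw [Lagrange.interpolate_apply]
        refine Finset.sum_eq_zero fun j hj => ?_
        rw [if_neg (by rw [Finset.mem_Icc] at hj; omega), C_0, zero_mul]
      rw [this]
      simp
    rcases hm.eq_or_lt with rfl | h'
    · have : Lagrange.interpolate (Finset.Icc a (a + (d + 1))) t
          (fun j => if j < a + (d + 1) + 1 then (1 : ℝ) else 0) =
          Lagrange.interpolate (Finset.Icc a (a + (d + 1))) t 1 :=
        Lagrange.interpolate_eq_of_values_eq_on _ _ fun j hj => by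
          rw [Finset.mem_Icc] at hj
          simp
          omega
      rw [this, Lagrange.interpolate_one (hinj _ _ ht) ⟨a, by simp⟩]
      simp
    · have hIcc1 : (Finset.Icc a (a + (d + 1))).erase (a + (d + 1)) = Finset.Icc a (a + d) := by
        ext j; simp; omega
      have hIcc2 : (Finset.Icc a (a + (d + 1))).erase a = Finset.Icc (a + 1) (a + 1 + d) := by
        ext j; simp; omega
      have hlt : t a < t (a + (d + 1)) :=
        ht ⟨le_rfl, by omega⟩ ⟨by omega, le_rfl⟩ (by omega)
      have hle : t (a + d) ≤ t (a + (d + 1)) :=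
        ht.monotoneOn ⟨by omega, by omega⟩ ⟨by omega, le_rfl⟩ (by omega)
      have h1 := ih a (ht.mono (Set.Icc_subset_Icc le_rfl (by omega))) (hle.trans hx) ham (by omega)
      have h2 := ih (a + 1) (ht.mono (Set.Icc_subset_Icc (by omega) (by omega)))
        (by rw [show a + 1 + d = a + (d + 1) by omega]; exact hx) h (by omega)
      rw [Lagrange.interpolate_eq_add_interpolate_erase _ (hinj _ _ ht)
        (i := a) (j := a + (d + 1)) (by simp) (by simp) (by omega), hIcc1, hIcc2]
      simp only [eval_add, eval_mul, Lagrange.basisDivisor, eval_C, eval_sub, eval_X]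
      set u := (Lagrange.interpolate (Finset.Icc a (a + d)) t
        (fun j => if j < m then (1 : ℝ) else 0)).eval x
      set w := (Lagrange.interpolate (Finset.Icc (a + 1) (a + 1 + d)) t
        (fun j => if j < m then (1 : ℝ) else 0)).eval x
      rw [show a + 1 + d + 1 - m = a + d + 1 - m + 1 by omega, pow_succ] at h2
      rw [show a + (d + 1) + 1 - m = a + d + 1 - m + 1 by omega, pow_succ]
      set s := (-1 : ℝ) ^ (a + d + 1 - m)
      have e : s * -1 * (u * ((t a - t (a + (d + 1)))⁻¹ * (x - t (a + (d + 1)))) +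
          w * ((t (a + (d + 1)) - t a)⁻¹ * (x - t a))) =
          (s * u) * ((t (a + (d + 1)) - t a)⁻¹ * (x - t (a + (d + 1)))) +
          (s * -1 * w) * ((t (a + (d + 1)) - t a)⁻¹ * (x - t a)) := by
        rw [← neg_sub (t (a + (d + 1))) (t a), inv_neg]
        ring
      rw [e]
      have h3 : 0 < t (a + (d + 1)) - t a := by linarith
      have h4 : 0 ≤ x - t (a + (d + 1)) := by linarith
      have h5 : 0 ≤ x - t a := by linarith
      positivity

/-- Consecutive values of `interpolate_step_sign` have opposite signs, so that both are bounded by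
their difference, which is the value of a Lagrange basis polynomial. -/
lemma interpolate_step_sq_le {t : ℕ → ℝ} {x : ℝ} {n : ℕ} (ht : StrictMonoOn t (Set.Icc 0 n))
    (hx : t n ≤ x) {j : ℕ} (hj : j ≤ n) {k : ℕ} (hk : k = j ∨ k = j + 1) :
    (∑ i ∈ Finset.range k, (Lagrange.basis (Finset.Icc 0 n) t i).eval x) ^ 2 ≤
      (Lagrange.basis (Finset.Icc 0 n) t j).eval x ^ 2 := by
  have hS : ∀ m ≤ n + 1, (∑ i ∈ Finset.range m, (Lagrange.basis (Finset.Icc 0 n) t i).eval x) =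
      (Lagrange.interpolate (Finset.Icc 0 n) t (fun j => if j < m then (1 : ℝ) else 0)).eval x := by
    intro m hm
    rw [Lagrange.interpolate_apply, eval_finsetSum]
    have : ∀ i ∈ Finset.Icc 0 n, (C (if i < m then (1 : ℝ) else 0) *
        Lagrange.basis (Finset.Icc 0 n) t i).eval x =
        if i < m then (Lagrange.basis (Finset.Icc 0 n) t i).eval x else 0 := by
      intro i _
      split_ifs <;> simp
    rw [Finset.sum_congr rfl this, ← Finset.sum_filter]
    refine Finset.sum_congr ?_ fun _ _ => rfl
    ext i
    simp
    omega
  have h0 := interpolate_step_sign (x := x) j n 0 (by simpa using ht) (by simpa using hx)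
    (Nat.zero_le _) (by omega)
  have h1 := interpolate_step_sign (x := x) (j + 1) n 0 (by simpa using ht) (by simpa using hx)
    (Nat.zero_le _) (by omega)
  simp only [zero_add] at h0 h1
  rw [← hS j (by omega)] at h0
  rw [← hS (j + 1) (by omega), Finset.sum_range_succ] at h1
  set K := ∑ i ∈ Finset.range j, (Lagrange.basis (Finset.Icc 0 n) t i).eval x with hK
  set L := (Lagrange.basis (Finset.Icc 0 n) t j).eval x with hL
  rw [show n + 1 - j = n + 1 - (j + 1) + 1 by omega, pow_succ] at h0
  have hs : ((-1 : ℝ) ^ (n + 1 - (j + 1))) ^ 2 = 1 := by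
    rw [← pow_mul, mul_comm, pow_mul]
    norm_num
  have hprod : K * (K + L) ≤ 0 := by
    have := mul_nonneg h0 h1
    have e : (-1 : ℝ) ^ (n + 1 - (j + 1)) * -1 * K * ((-1 : ℝ) ^ (n + 1 - (j + 1)) * (K + L)) =
      -(((-1 : ℝ) ^ (n + 1 - (j + 1))) ^ 2 * (K * (K + L))) := by ring
    rw [e, hs] at this
    linarith
  rcases hk with rfl | rfl
  · rw [← hK]
    nlinarith [sq_nonneg (K + L)]
  · rw [Finset.sum_range_succ, ← hK, ← hL]
    nlinarith [sq_nonneg K]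

/-- The points `τ_0, …, τ_{N+1}` as a sequence (with value `1` from the index `N + 1` on). -/
noncomputable def nodeSeq (N k : ℕ) : ℝ :=
  if k = 0 then -1 else if h : k - 1 < N then gaussPoint N ⟨k - 1, h⟩ else 1

lemma nodeSeq_zero (N : ℕ) : nodeSeq N 0 = -1 := by simp [nodeSeq]

lemma nodeSeq_succ (N : ℕ) (i : Fin N) : nodeSeq N (i + 1) = gaussPoint N i := by
  simp [nodeSeq]

lemma nodeSeq_last (N : ℕ) : nodeSeq N (N + 1) = 1 := by simp [nodeSeq]

lemma exists_nodeSeq_eq {N k : ℕ} (h1 : 1 ≤ k) (h2 : k ≤ N) :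
    ∃ i : Fin N, k = i + 1 ∧ nodeSeq N k = gaussPoint N i := by
  refine ⟨⟨k - 1, by omega⟩, by simp; omega, ?_⟩
  rw [← nodeSeq_succ]
  congr
  simp
  omega

lemma nodeSeq_lt_succ {N k : ℕ} (hk : k ≤ N) : nodeSeq N k < nodeSeq N (k + 1) := by
  rcases Nat.eq_zero_or_pos k with rfl | h0
  · rw [nodeSeq_zero]
    rcases Nat.eq_zero_or_pos N with rfl | hN
    · rw [nodeSeq_last]; norm_num
    · rw [nodeSeq_succ N ⟨0, hN⟩]
      exact (gaussPoint_mem_Ioo N _).1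
  · obtain ⟨i, hi, hi'⟩ := exists_nodeSeq_eq h0 hk
    rw [hi']
    rcases hk.eq_or_lt with rfl | h
    · rw [nodeSeq_last]
      exact (gaussPoint_mem_Ioo _ _).2
    · obtain ⟨j, hj, hj'⟩ := exists_nodeSeq_eq (by omega : 1 ≤ k + 1) (by omega : k + 1 ≤ N)
      rw [hj']
      exact gaussPoint_strictMono N (by rw [Fin.lt_def]; omega)

lemma nodeSeq_strictMonoOn (N : ℕ) : StrictMonoOn (nodeSeq N) (Set.Icc 0 (N + 1)) := by
  refine strictMonoOn_of_lt_add_one Set.ordConnected_Icc fun k _ _ hk => ?_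
  exact nodeSeq_lt_succ (by have := hk.2; omega)

lemma nodeSeq_mem_Icc {N k : ℕ} (hk : k ≤ N + 1) : nodeSeq N k ∈ Set.Icc (-1 : ℝ) 1 := by
  have h := (nodeSeq_strictMonoOn N).monotoneOn
  constructor
  · rw [← nodeSeq_zero N]
    exact h ⟨le_rfl, Nat.zero_le _⟩ ⟨Nat.zero_le _, hk⟩ (Nat.zero_le _)
  · rw [← nodeSeq_last N]
    exact h ⟨Nat.zero_le _, hk⟩ ⟨Nat.zero_le _, le_rfl⟩ hk

/-- The extrapolation weight of a Gauss point, from `∫ P_N s' = 0` for `deg s ≤ N`. -/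
lemma eval_one_eq_gaussQuad {N : ℕ} {s : ℝ[X]} (hs : s.degree < ((N + 1 : ℕ) : WithBot ℕ))
    (h0 : s.eval (-1) = 0) : s.eval 1 = gaussQuad N (s * derivative (legendre N)) := by
  have h1 := polyInt_derivative_mul s (legendre N)
  have h2 := polyInt_legendre_mul_eq_zero (degree_derivative_lt_of_succ hs)
  have hP' : (derivative (legendre N)).degree < (N : WithBot ℕ) :=
    degree_derivative_lt_of_succ (by rw [legendre_degree]; exact_mod_cast Nat.lt_succ_self N)
  rw [gaussQuad_mul_eq_polyInt hs hP' (by omega)]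
  rw [mul_comm, h2, legendre_eval_one, h0] at h1
  linarith

lemma basis_eval_one_sq_le {N : ℕ} (hN : 1 ≤ N) {j : ℕ} (i : Fin N) (hj : j = i + 1) :
    (Lagrange.basis (Finset.Icc 0 N) (nodeSeq N) j).eval 1 = gaussWeight N i *
      (derivative (legendre N)).eval (gaussPoint N i) ∧
    (Lagrange.basis (Finset.Icc 0 N) (nodeSeq N) j).eval 1 ^ 2 ≤
      20 / (N * Real.sqrt (1 - gaussPoint N i ^ 2)) := by
  have hN0 : (0 : ℝ) < N := by exact_mod_cast hN
  have hinj : Set.InjOn (nodeSeq N) (Finset.Icc 0 N : Finset ℕ) := by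
    rw [Finset.coe_Icc]
    exact ((nodeSeq_strictMonoOn N).mono (Set.Icc_subset_Icc le_rfl (by omega))).injOn
  have hjm : j ∈ Finset.Icc 0 N := by simp; omega
  have h1 : (Lagrange.basis (Finset.Icc 0 N) (nodeSeq N) j).eval 1 = gaussWeight N i *
      (derivative (legendre N)).eval (gaussPoint N i) := by
    rw [eval_one_eq_gaussQuad, gaussQuad, Finset.sum_eq_single i]
    · rw [eval_mul, ← nodeSeq_succ N i, ← hj, Lagrange.eval_basis_self hinj hjm, one_mul]
    · intro k _ hk
      rw [eval_mul, ← nodeSeq_succ N k, Lagrange.eval_basis_of_ne]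
      · ring
      · rw [hj]
        intro h
        exact hk (Fin.ext (by omega))
      · simp
    · simp
    · rw [Lagrange.degree_basis hinj hjm]
      simp only [Nat.card_Icc]
      exact_mod_cast Nat.lt_succ_self N
    · rw [← nodeSeq_zero N, Lagrange.eval_basis_of_ne (by omega) (by simp)]
  refine ⟨h1, ?_⟩
  rw [h1]
  have hpos := one_sub_gaussPoint_sq_pos N i
  have hne := eval_derivative_legendre_gaussPoint_ne_zero N i
  have hw := gaussWeight_le hN i
  set s := Real.sqrt (1 - gaussPoint N i ^ 2) with hs
  have hs0 : 0 < s := Real.sqrt_pos.2 hpos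
  have hs2 : s ^ 2 = 1 - gaussPoint N i ^ 2 := Real.sq_sqrt hpos.le
  have h2 : (gaussWeight N i * (derivative (legendre N)).eval (gaussPoint N i)) ^ 2 =
      gaussWeight N i * (2 / s ^ 2) := by
    rw [hs2, mul_pow, sq (gaussWeight N i), mul_assoc]
    congr 1
    rw [gaussWeight]
    field_simp
  rw [h2]
  calc gaussWeight N i * (2 / s ^ 2) ≤ 10 / N * s * (2 / s ^ 2) := by gcongr
    _ = _ := by field_simp; norm_num

/-- An increasing function whose increments dominate the arc length `∫ (1 - t²)^{-1/2} dt` up to a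
constant factor. -/
noncomputable def arcFun (t : ℝ) : ℝ := Real.sqrt (1 + t) - Real.sqrt (1 - t)

lemma sqrt_sub_sqrt_ge {x y : ℝ} (hy : 0 ≤ y) (hyx : y < x) :
    (x - y) / (2 * Real.sqrt x) ≤ Real.sqrt x - Real.sqrt y := by
  have hx : 0 < x := hy.trans_lt hyx
  rw [div_le_iff₀ (by have := Real.sqrt_pos.2 hx; positivity)]
  have h1 := Real.sq_sqrt hx.le
  have h2 := Real.sq_sqrt hy
  nlinarith [sq_nonneg (Real.sqrt x - Real.sqrt y)]

lemma arcFun_sub_ge_right {a b : ℝ} (ha : 0 ≤ a) (hab : a < b) (hb : b ≤ 1) :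
    (b - a) / Real.sqrt (1 - a ^ 2) ≤ 2 * (arcFun b - arcFun a) := by
  have h1 : Real.sqrt (1 - a) ≤ Real.sqrt (1 - a ^ 2) := Real.sqrt_le_sqrt (by nlinarith)
  have h2 : 0 < Real.sqrt (1 - a) := Real.sqrt_pos.2 (by linarith)
  have h3 := sqrt_sub_sqrt_ge (x := 1 - a) (y := 1 - b) (by linarith) (by linarith)
  have h4 : Real.sqrt (1 + a) ≤ Real.sqrt (1 + b) := Real.sqrt_le_sqrt (by linarith)
  have h5 : (b - a) / Real.sqrt (1 - a ^ 2) ≤ (b - a) / Real.sqrt (1 - a) :=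
    div_le_div_of_nonneg_left (by linarith) h2 h1
  have h6 : (1 - a - (1 - b)) / (2 * Real.sqrt (1 - a)) = (b - a) / Real.sqrt (1 - a) / 2 := by
    field_simp
    ring
  rw [arcFun, arcFun]
  linarith

lemma arcFun_sub_ge_left {a b : ℝ} (ha : -1 ≤ a) (hab : a < b) (hb : b ≤ 0) :
    (b - a) / Real.sqrt (1 - b ^ 2) ≤ 2 * (arcFun b - arcFun a) := by
  have h := arcFun_sub_ge_right (a := -b) (b := -a) (by linarith) (by linarith) (by linarith)
  simp only [arcFun, neg_sq, sub_neg_eq_add] at h ⊢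
  simp only [← sub_eq_add_neg] at h
  rw [show b - a = -a + b by ring]
  linarith

lemma arcFun_sub_ge {a b : ℝ} (ha : -1 ≤ a) (hab : a < b) (hb : b ≤ 1) {c : ℝ}
    (hc : c ^ 2 ≤ 1 / 3) :
    (b - a) / Real.sqrt (1 - c ^ 2) ≤ 2 * (arcFun b - arcFun a) := by
  have h1 := sqrt_sub_sqrt_ge (x := 1 - a) (y := 1 - b) (by linarith) (by linarith)
  have h2 := sqrt_sub_sqrt_ge (x := 1 + b) (y := 1 + a) (by linarith) (by linarith)
  have h3 : Real.sqrt (1 - a) ≤ Real.sqrt 2 := Real.sqrt_le_sqrt (by linarith)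
  have h4 : Real.sqrt (1 + b) ≤ Real.sqrt 2 := Real.sqrt_le_sqrt (by linarith)
  have h5 : Real.sqrt 2 / 2 ≤ Real.sqrt (1 - c ^ 2) := by
    refine Real.le_sqrt_of_sq_le ?_
    rw [div_pow, Real.sq_sqrt (by norm_num)]
    linarith
  have hs : 0 < Real.sqrt 2 := Real.sqrt_pos.2 (by norm_num)
  have h6 : (b - a) / Real.sqrt (1 - c ^ 2) ≤ (b - a) / (Real.sqrt 2 / 2) :=
    div_le_div_of_nonneg_left (by linarith) (by positivity) h5
  have h7 : (b - a) / (2 * Real.sqrt 2) ≤ (1 - a - (1 - b)) / (2 * Real.sqrt (1 - a)) := by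
    rw [show 1 - a - (1 - b) = b - a by ring]
    exact div_le_div_of_nonneg_left (by linarith)
      (by have := Real.sqrt_pos.2 (by linarith : 0 < 1 - a); positivity) (by linarith)
  have h8 : (b - a) / (2 * Real.sqrt 2) ≤ (1 + b - (1 + a)) / (2 * Real.sqrt (1 + b)) := by
    rw [show 1 + b - (1 + a) = b - a by ring]
    exact div_le_div_of_nonneg_left (by linarith)
      (by have := Real.sqrt_pos.2 (by linarith : 0 < 1 + b); positivity) (by linarith)
  have h9 : (b - a) / (Real.sqrt 2 / 2) = 4 * ((b - a) / (2 * Real.sqrt 2)) := by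
    field_simp
    norm_num
  rw [arcFun, arcFun]
  linarith

/-- Every gap between consecutive points has a Gauss point as an endpoint, relative to which its
length is controlled.  For the gap around `0`, this endpoint is the Gauss point of least modulus,
and `∑ ω_i τ_i² = 2/3` bounds that modulus. -/
lemma exists_gap_le {N : ℕ} (hN : 1 ≤ N) {k : ℕ} (hk : k ≤ N) :
    ∃ i : Fin N, (k = i + 1 ∨ k + 1 = i + 1) ∧
      (nodeSeq N (k + 1) - nodeSeq N k) / Real.sqrt (1 - gaussPoint N i ^ 2) ≤
        2 * (arcFun (nodeSeq N (k + 1)) - arcFun (nodeSeq N k)) := by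
  have hlt := nodeSeq_lt_succ hk
  have hkm := nodeSeq_mem_Icc (N := N) (k := k) (by omega)
  have hkm' := nodeSeq_mem_Icc (N := N) (k := k + 1) (by omega)
  set a := nodeSeq N k with ha
  set b := nodeSeq N (k + 1) with hb
  have hleft : 0 < k → ∃ i : Fin N, k = i + 1 ∧ a = gaussPoint N i := fun h =>
    exists_nodeSeq_eq h hk
  have hright : k < N → ∃ i : Fin N, k + 1 = i + 1 ∧ b = gaussPoint N i := fun h => by
    obtain ⟨i, hi, hi'⟩ := exists_nodeSeq_eq (N := N) (k := k + 1) (by omega) h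
    exact ⟨i, hi, hi'⟩
  have hk0 : -1 < a → 0 < k := fun h => by
    rcases Nat.eq_zero_or_pos k with h0 | h0
    · rw [ha, h0, nodeSeq_zero] at h
      exact absurd h (lt_irrefl _)
    · exact h0
  have hkN : b < 1 → k < N := fun h => by
    rcases hk.eq_or_lt with h0 | h0
    · rw [hb, h0, nodeSeq_last] at h
      exact absurd h (lt_irrefl _)
    · exact h0
  rcases le_or_gt 0 a with h0 | h0
  · obtain ⟨i, hi, hi'⟩ := hleft (hk0 (by linarith))
    refine ⟨i, Or.inl hi, ?_⟩
    rw [← hi']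
    exact arcFun_sub_ge_right h0 hlt hkm'.2
  rcases le_or_gt b 0 with h1 | h1
  · obtain ⟨i, hi, hi'⟩ := hright (hkN (by linarith))
    refine ⟨i, Or.inr hi, ?_⟩
    rw [← hi']
    exact arcFun_sub_ge_left hkm.1 hlt h1
  have hmono := (nodeSeq_strictMonoOn N).monotoneOn
  have hout : ∀ j : Fin N, gaussPoint N j ≤ a ∨ b ≤ gaussPoint N j := by
    intro j
    rw [← nodeSeq_succ]
    rcases le_or_gt ((j : ℕ) + 1) k with h | h
    · exact Or.inl (hmono ⟨Nat.zero_le _, by omega⟩ ⟨Nat.zero_le _, by omega⟩ h)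
    · exact Or.inr (hmono ⟨Nat.zero_le _, by omega⟩ ⟨Nat.zero_le _, by omega⟩ h)
  have hc : ∀ c : ℝ, (∀ j : Fin N, c ^ 2 ≤ gaussPoint N j ^ 2) → c ^ 2 ≤ 1 / 3 := by
    intro c hc
    have hN2 : 2 ≤ N := by
      by_contra h
      obtain rfl : N = 1 := by omega
      have h3 := gaussQuad_eq_polyInt (N := 1) (p := X) (by rw [degree_X]; norm_num)
      have hω := gaussWeight_pos 1 0
      rw [polyInt_X, gaussQuad] at h3
      simp at h3
      rcases h3 with h3 | h3
      · exact absurd h3 hω.ne'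
      · rcases hout 0 with h | h <;> linarith
    have h3 := gaussQuad_eq_polyInt (N := N) (p := X ^ 2)
      (by rw [degree_X_pow]; exact_mod_cast (by omega : 2 < 2 * N))
    rw [polyInt_X_sq, gaussQuad] at h3
    have h4 : ∑ i, gaussWeight N i * c ^ 2 ≤ 2 / 3 := by
      rw [← h3]
      refine Finset.sum_le_sum fun i _ => ?_
      rw [eval_pow, eval_X]
      exact mul_le_mul_of_nonneg_left (hc i) (gaussWeight_pos N i).le
    rw [← Finset.sum_mul, sum_gaussWeight hN] at h4
    linarith
  have habs : ∀ c : ℝ, (c = a ∨ c = b) → c ^ 2 ≤ a ^ 2 → c ^ 2 ≤ b ^ 2 → c ^ 2 ≤ 1 / 3 := by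
    intro c _ hca hcb
    refine hc c fun j => ?_
    rcases hout j with h | h <;> nlinarith
  rcases le_total (a ^ 2) (b ^ 2) with h | h
  · have h3 := habs a (Or.inl rfl) le_rfl h
    obtain ⟨i, hi, hi'⟩ := hleft (hk0 (by nlinarith))
    refine ⟨i, Or.inl hi, ?_⟩
    rw [← hi']
    exact arcFun_sub_ge hkm.1 hlt hkm'.2 h3
  · have h3 := habs b (Or.inr rfl) h le_rfl
    obtain ⟨i, hi, hi'⟩ := hright (hkN (by nlinarith))
    refine ⟨i, Or.inr hi, ?_⟩
    rw [← hi']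
    exact arcFun_sub_ge hkm.1 hlt hkm'.2 h3

lemma eval_sub_sq_le (e : ℝ[X]) {a b : ℝ} (hab : a < b) :
    (e.eval b - e.eval a) ^ 2 ≤ (b - a) *
      ((antideriv (derivative e * derivative e)).eval b -
        (antideriv (derivative e * derivative e)).eval a) := by
  set A := antideriv (derivative e * derivative e) with hA
  set c := (e.eval b - e.eval a) / (b - a) with hc
  have hba : 0 < b - a := sub_pos.2 hab
  have h := eval_le_eval_of_derivative_nonneg (p := C (c ^ 2) * X - C (2 * c) * e + A) hab.le
    fun s _ => by
      rw [derivative_add, derivative_sub, derivative_C_mul, derivative_C_mul, hA,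
        derivative_antideriv, derivative_X]
      simp only [eval_add, eval_sub, eval_mul, eval_C, eval_one]
      nlinarith [sq_nonneg (c - (derivative e).eval s)]
  simp only [eval_add, eval_sub, eval_mul, eval_C, eval_X] at h
  have h2 : c * (b - a) = e.eval b - e.eval a := by
    rw [hc]
    field_simp
  have h3 : (e.eval b - e.eval a) ^ 2 = (b - a) * (c ^ 2 * (b - a)) := by
    rw [← h2]
    ring
  rw [h3]
  refine mul_le_mul_of_nonneg_left ?_ hba.le
  nlinarith

/-- Summation by parts turns the quadrature sum into a combination of increments of `e` with
coefficients controlled by `interpolate_step_sq_le`. -/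
lemma gaussQuad_mul_derivative_legendre_sq_le {N : ℕ} (hN : 1 ≤ N) {e : ℝ[X]}
    (h0 : e.eval (-1) = 0) (h1 : e.eval 1 = 0) :
    gaussQuad N (e * derivative (legendre N)) ^ 2 ≤
      120 / N * polyInt (derivative e * derivative e) := by
  have hN0 : (0 : ℝ) < N := by exact_mod_cast hN
  set t := nodeSeq N with ht
  set ℓ : ℕ → ℝ := fun j => (Lagrange.basis (Finset.Icc 0 N) t j).eval 1 with hℓ
  set κ : ℕ → ℝ := fun k => ∑ i ∈ Finset.range k, ℓ i with hκ
  set A := antideriv (derivative e * derivative e) with hA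
  have hsum : gaussQuad N (e * derivative (legendre N)) =
      ∑ j ∈ Finset.range (N + 1), ℓ j * e.eval (t j) := by
    rw [Finset.sum_range_succ', ht, nodeSeq_zero, h0, mul_zero, add_zero, gaussQuad,
      Finset.sum_range]
    refine Finset.sum_congr rfl fun i _ => ?_
    have hb : ℓ (i + 1) = _ := (basis_eval_one_sq_le hN i rfl).1
    rw [eval_mul, nodeSeq_succ, hb]
    ring
  have habel : ∀ n, ∑ j ∈ Finset.range n, ℓ j * e.eval (t j) =
      κ n * e.eval (t n) -
        ∑ j ∈ Finset.range n, κ (j + 1) * (e.eval (t (j + 1)) - e.eval (t j)) := by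
    intro n
    induction n with
    | zero => simp [hκ]
    | succ n ih =>
      rw [Finset.sum_range_succ, ih, Finset.sum_range_succ _ n]
      have : κ (n + 1) = κ n + ℓ n := by simp only [hκ, Finset.sum_range_succ]
      rw [this]
      ring
  rw [hsum, habel, ht, nodeSeq_last, h1, mul_zero, zero_sub, neg_sq, ← ht]
  have hgap : ∀ j ∈ Finset.range (N + 1), 0 < t (j + 1) - t j := fun j hj =>
    sub_pos.2 (nodeSeq_lt_succ (by rw [Finset.mem_range] at hj; omega))
  have hAinc : ∀ j ∈ Finset.range (N + 1),
      (e.eval (t (j + 1)) - e.eval (t j)) ^ 2 ≤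
        (t (j + 1) - t j) * (A.eval (t (j + 1)) - A.eval (t j)) := fun j hj =>
    eval_sub_sq_le e (sub_pos.1 (hgap j hj))
  set d : ℕ → ℝ := fun j => e.eval (t (j + 1)) - e.eval (t j) with hd
  have hκ2 : ∀ j ∈ Finset.range (N + 1), κ (j + 1) ^ 2 * (t (j + 1) - t j) ≤
      40 / N * (arcFun (t (j + 1)) - arcFun (t j)) := by
    intro j hj
    have hjN : j ≤ N := by rw [Finset.mem_range] at hj; omega
    obtain ⟨i, hi, hi'⟩ := exists_gap_le hN hjN
    have hb := (basis_eval_one_sq_le hN i rfl).2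
    have hm : StrictMonoOn t (Set.Icc 0 N) :=
      (nodeSeq_strictMonoOn N).mono (Set.Icc_subset_Icc le_rfl (by omega))
    have h2 : κ (j + 1) ^ 2 ≤ (Lagrange.basis (Finset.Icc 0 N) t (i + 1)).eval 1 ^ 2 :=
      interpolate_step_sq_le hm (nodeSeq_mem_Icc (by omega)).2 (j := i + 1) (by omega)
        (by omega)
    have h3 := h2.trans hb
    set s := Real.sqrt (1 - gaussPoint N i ^ 2)
    calc κ (j + 1) ^ 2 * (t (j + 1) - t j) ≤ 20 / (N * s) * (t (j + 1) - t j) :=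
          mul_le_mul_of_nonneg_right h3 (hgap j hj).le
      _ = 20 / N * ((t (j + 1) - t j) / s) := by rw [div_mul_div_comm]; ring
      _ ≤ 20 / N * (2 * (arcFun (t (j + 1)) - arcFun (t j))) := by gcongr
      _ = _ := by ring
  have hκsum : ∑ j ∈ Finset.range (N + 1), κ (j + 1) ^ 2 * (t (j + 1) - t j) ≤ 120 / N := by
    refine (Finset.sum_le_sum hκ2).trans ?_
    rw [← Finset.mul_sum, Finset.sum_range_sub (fun j => arcFun (t j)), ht, nodeSeq_last,
      nodeSeq_zero]
    have h2 : Real.sqrt 2 ≤ 3 / 2 := Real.sqrt_le_iff.2 ⟨by norm_num, by norm_num⟩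
    have h3 : arcFun 1 - arcFun (-1) ≤ 3 := by
      simp [arcFun]
      norm_num
      linarith
    calc 40 / (N : ℝ) * (arcFun 1 - arcFun (-1)) ≤ 40 / N * 3 := by gcongr
      _ = _ := by ring
  have hAsum : ∑ j ∈ Finset.range (N + 1), (A.eval (t (j + 1)) - A.eval (t j)) =
      polyInt (derivative e * derivative e) := by
    rw [Finset.sum_range_sub (fun j => A.eval (t j)), ht, nodeSeq_last, nodeSeq_zero, hA,
      antideriv_eval_one, antideriv_eval_neg_one, sub_zero]
  have hCS : (∑ j ∈ Finset.range (N + 1), κ (j + 1) * d j) ^ 2 ≤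
      (∑ j ∈ Finset.range (N + 1), κ (j + 1) ^ 2 * (t (j + 1) - t j)) *
      ∑ j ∈ Finset.range (N + 1), (A.eval (t (j + 1)) - A.eval (t j)) := by
    refine Finset.sum_sq_le_sum_mul_sum_of_sq_le_mul _ (fun j hj => ?_) (fun j hj => ?_)
      fun j hj => ?_
    · exact mul_nonneg (sq_nonneg _) (hgap j hj).le
    · have h2 := hAinc j hj
      have h3 : 0 ≤ (t (j + 1) - t j) * (A.eval (t (j + 1)) - A.eval (t j)) :=
        (sq_nonneg _).trans h2
      exact nonneg_of_mul_nonneg_right h3 (hgap j hj)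
    · rw [mul_pow, mul_assoc]
      exact mul_le_mul_of_nonneg_left (hAinc j hj) (sq_nonneg _)
  rw [hAsum] at hCS
  exact hCS.trans (mul_le_mul_of_nonneg_right hκsum (polyInt_sq_nonneg _))

/-! ### Collocation residuals of polynomials -/

lemma node_zero (N : ℕ) : node N 0 = -1 := rfl

lemma node_last (N : ℕ) : node N (Fin.last (N + 1)) = 1 := by
  rw [node, ← Fin.succ_last, Fin.cons_succ, Fin.snoc_last]

lemma node_castSucc_succ (N : ℕ) (i : Fin N) : node N i.castSucc.succ = gaussPoint N i := by
  rw [node, Fin.cons_succ, Fin.snoc_castSucc]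

lemma node_injective_castSucc (N : ℕ) :
    Function.Injective (fun l : Fin (N + 1) => node N l.castSucc) := by
  have h : ∀ l : Fin (N + 1), node N l.castSucc = nodeSeq N l := by
    intro l
    refine Fin.cases ?_ (fun i => ?_) l
    · rw [Fin.castSucc_zero, node_zero, Fin.val_zero, nodeSeq_zero]
    · rw [← Fin.succ_castSucc, node_castSucc_succ, Fin.val_succ, nodeSeq_succ]
  intro a b hab
  simp only [h] at hab
  exact Fin.ext ((nodeSeq_strictMonoOn N).injOn ⟨Nat.zero_le _, by omega⟩
    ⟨Nat.zero_le _, by omega⟩ hab)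

/-- The collocation defect `∑_j D_{ij} x(τ_j) - y(τ_i)`, where `y` stands for `x'`. -/
noncomputable def stateDefect (N : ℕ) (x y : ℝ → ℝ) (i : Fin N) : ℝ :=
  (∑ j : Fin (N + 1), diffMatrix N i j * x (node N j.castSucc)) - y (gaussPoint N i)

/-- The collocation defect `∑_j D†_{ij} x(τ_j) - y(τ_i)`, where `y` stands for `x'`. -/
noncomputable def costateDefect (N : ℕ) (x y : ℝ → ℝ) (i : Fin N) : ℝ :=
  (∑ j : Fin (N + 1), adjMatrix N i j * x (node N j.succ)) - y (gaussPoint N i)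

/-- The quadrature defect `x(1) - x(-1) - ∑ ω_i y(τ_i)`, where `y` stands for `x'`. -/
noncomputable def quadDefect (N : ℕ) (x y : ℝ → ℝ) : ℝ :=
  x 1 - x (-1) - ∑ i, gaussWeight N i * y (gaussPoint N i)

/-- `∑ ω_i z_i²`. -/
noncomputable def weightedSq {N : ℕ} (z : Fin N → ℝ) : ℝ := ∑ i, gaussWeight N i * z i ^ 2

lemma sum_diffMatrix_mul_eval {N : ℕ} {s : ℝ[X]} (hs : s.degree < ((N + 1 : ℕ) : WithBot ℕ))
    (i : Fin N) : ∑ j : Fin (N + 1), diffMatrix N i j * s.eval (node N j.castSucc) =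
      (derivative s).eval (gaussPoint N i) := by
  conv_rhs => rw [Lagrange.eq_interpolate (s := Finset.univ) (f := s)
    (node_injective_castSucc N).injOn (by simpa using hs), Lagrange.interpolate_apply,
    derivative_sum, eval_finsetSum]
  refine Finset.sum_congr rfl fun j _ => ?_
  rw [derivative_C_mul, eval_mul, eval_C, diffMatrix, mul_comm]

lemma degree_lt_succ {n : ℕ} {p : ℝ[X]} (hp : p.degree < (n : WithBot ℕ)) :
    p.degree < ((n + 1 : ℕ) : WithBot ℕ) :=
  hp.trans (by exact_mod_cast Nat.lt_succ_self n)

/-- The matrix `D` tested against a polynomial `φ`, by exactness of the quadrature. -/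
lemma sum_weight_diffMatrix {N : ℕ} {x : ℝ → ℝ} (hx : x (-1) = 0) {φ : ℝ[X]}
    (hφ : φ.degree < (N : WithBot ℕ)) :
    ∑ i, gaussWeight N i * (φ.eval (gaussPoint N i) *
      ∑ j : Fin (N + 1), diffMatrix N i j * x (node N j.castSucc)) =
    φ.eval 1 * (∑ i, gaussWeight N i * (x (gaussPoint N i) *
      (derivative (legendre N)).eval (gaussPoint N i))) -
    ∑ i, gaussWeight N i * (x (gaussPoint N i) * (derivative φ).eval (gaussPoint N i)) := by
  set t : Fin (N + 1) → ℝ := fun l => node N l.castSucc with ht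
  set s := Lagrange.interpolate Finset.univ t (fun l => x (t l)) with hs
  have hinj : Set.InjOn t (Finset.univ : Finset (Fin (N + 1))) := (node_injective_castSucc N).injOn
  have hdeg : s.degree < ((N + 1 : ℕ) : WithBot ℕ) := by
    have := Lagrange.degree_interpolate_lt (fun l => x (t l)) hinj
    rwa [Finset.card_univ, Fintype.card_fin] at this
  have hst : ∀ l, s.eval (t l) = x (t l) := fun l =>
    Lagrange.eval_interpolate_at_node _ hinj (Finset.mem_univ l)
  have hs0 : s.eval (-1) = 0 := (hst 0).trans hx
  have hsτ : ∀ i : Fin N, s.eval (gaussPoint N i) = x (gaussPoint N i) := by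
    intro i
    have := hst i.succ
    rwa [ht, show (fun l : Fin (N + 1) => node N l.castSucc) i.succ = node N i.castSucc.succ by
      simp only [Fin.succ_castSucc], node_castSucc_succ] at this
  have h1 : ∀ i : Fin N, ∑ j : Fin (N + 1), diffMatrix N i j * x (node N j.castSucc) =
      (derivative s).eval (gaussPoint N i) := by
    intro i
    rw [← sum_diffMatrix_mul_eval hdeg]
    exact Finset.sum_congr rfl fun j _ => by rw [← hst j]
  have h2 : gaussQuad N (φ * derivative s) = φ.eval 1 * gaussQuad N (s * derivative (legendre N)) -
      gaussQuad N (s * derivative φ) := by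
    have hs' := degree_derivative_lt_of_succ hdeg
    have hφ' : (derivative φ).degree < (N : WithBot ℕ) := degree_derivative_le.trans_lt hφ
    rw [gaussQuad_mul_eq_polyInt hφ hs' (by omega), gaussQuad_mul_eq_polyInt hdeg hφ' (by omega),
      ← eval_one_eq_gaussQuad hdeg hs0, mul_comm φ, polyInt_derivative_mul, hs0]
    ring
  simp only [gaussQuad, eval_mul, hsτ] at h2
  simp only [h1]
  exact h2

lemma sum_adjMatrix_mul {N : ℕ} (x : ℝ → ℝ) (i : Fin N) :
    ∑ j : Fin (N + 1), adjMatrix N i j * x (node N j.succ) =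
      ∑ j : Fin N, adjMatrixInner N i j * (x (gaussPoint N j) - x 1) := by
  rw [Fin.sum_univ_castSucc]
  simp only [adjMatrix, Fin.snoc_castSucc, Fin.snoc_last, Fin.succ_last, node_last,
    node_castSucc_succ]
  simp only [mul_sub, Finset.sum_sub_distrib, ← Finset.sum_mul]
  ring

/-- The matrix `D†` tested against a polynomial `φ`.  The test function is continued to the
polynomial `ψ = φ - φ(-1) P_N / P_N(-1)`, which vanishes at `-1` and agrees with `φ` at the Gauss
points. -/
lemma sum_weight_adjMatrix {N : ℕ} (x : ℝ → ℝ) {φ ψ : ℝ[X]} (hφ : φ.degree < (N : WithBot ℕ))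
    (hψ : ψ = φ - C (φ.eval (-1) / (legendre N).eval (-1)) * legendre N) :
    ψ.degree < ((N + 1 : ℕ) : WithBot ℕ) ∧ ψ.eval (-1) = 0 ∧
    (∀ i, ψ.eval (gaussPoint N i) = φ.eval (gaussPoint N i)) ∧
    ∑ i, gaussWeight N i * (φ.eval (gaussPoint N i) *
      ∑ j : Fin (N + 1), adjMatrix N i j * x (node N j.succ)) =
    -∑ i, gaussWeight N i * ((x (gaussPoint N i) - x 1) *
      (derivative ψ).eval (gaussPoint N i)) := by
  have hP0 : (legendre N).eval (-1) ≠ 0 := by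
    intro h
    have := legendre_eval_neg_one_sq N
    simp [h] at this
  have hdeg : ψ.degree < ((N + 1 : ℕ) : WithBot ℕ) := by
    rw [hψ]
    refine (degree_sub_le _ _).trans_lt (max_lt (degree_lt_succ hφ) ?_)
    refine degree_mul_lt (a := 1) (b := N + 1) degree_C_lt ?_ (by omega)
    rw [legendre_degree]
    exact_mod_cast Nat.lt_succ_self N
  have h0 : ψ.eval (-1) = 0 := by
    rw [hψ, eval_sub, eval_mul, eval_C, div_mul_cancel₀ _ hP0, sub_self]
  have hτ : ∀ i, ψ.eval (gaussPoint N i) = φ.eval (gaussPoint N i) := fun i => by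
    rw [hψ, eval_sub, eval_mul, legendre_eval_gaussPoint, mul_zero, sub_zero]
  refine ⟨hdeg, h0, hτ, ?_⟩
  have hω : ∀ i, gaussWeight N i ≠ 0 := fun i => (gaussWeight_pos N i).ne'
  have h1 : ∀ j : Fin N, (derivative ψ).eval (gaussPoint N j) =
      ∑ i : Fin N, diffMatrix N j i.succ * φ.eval (gaussPoint N i) := by
    intro j
    rw [← sum_diffMatrix_mul_eval hdeg, Fin.sum_univ_succ, Fin.castSucc_zero, node_zero, h0,
      mul_zero, zero_add]
    refine Finset.sum_congr rfl fun i _ => ?_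
    rw [← Fin.succ_castSucc, node_castSucc_succ, hτ]
  simp only [sum_adjMatrix_mul, h1, Finset.mul_sum]
  rw [Finset.sum_comm, ← Finset.sum_neg_distrib]
  refine Finset.sum_congr rfl fun j _ => ?_
  rw [← Finset.sum_neg_distrib]
  refine Finset.sum_congr rfl fun i _ => ?_
  rw [adjMatrixInner]
  field_simp [hω i]

/-- A vector of values at the Gauss points whose pairing with every polynomial of degree less than
`N` is bounded by `√B` times the norm of the polynomial has weighted square sum at most `B`, unless
it vanishes (the sign of `B` is not prescribed). -/
lemma weightedSq_le_of_forall {N : ℕ} {z : Fin N → ℝ} {B : ℝ}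
    (h : ∀ φ : ℝ[X], φ.degree < (N : WithBot ℕ) →
      (∑ i, gaussWeight N i * (φ.eval (gaussPoint N i) * z i)) ^ 2 ≤ B * polyInt (φ * φ)) :
    weightedSq z ≤ B ∨ weightedSq z = 0 := by
  have hinj : Set.InjOn (gaussPoint N) (Finset.univ : Finset (Fin N)) :=
    (gaussPoint_strictMono N).injective.injOn
  set φ := Lagrange.interpolate Finset.univ (gaussPoint N) z with hφ
  have hdeg : φ.degree < (N : WithBot ℕ) := by
    have := Lagrange.degree_interpolate_lt z hinj
    rwa [Finset.card_univ, Fintype.card_fin] at this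
  have hval : ∀ i, φ.eval (gaussPoint N i) = z i := fun i =>
    Lagrange.eval_interpolate_at_node _ hinj (Finset.mem_univ i)
  have h1 := h φ hdeg
  rw [← gaussQuad_mul_eq_polyInt (N := N) hdeg hdeg (by omega)] at h1
  simp only [gaussQuad, eval_mul, hval] at h1
  simp only [← sq] at h1
  change weightedSq z ^ 2 ≤ B * weightedSq z at h1
  have h0 : 0 ≤ weightedSq z :=
    Finset.sum_nonneg fun i _ => mul_nonneg (gaussWeight_pos N i).le (sq_nonneg _)
  rcases h0.eq_or_lt with h2 | h2
  · exact Or.inr h2.symm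
  · refine Or.inl (le_of_mul_le_mul_right ?_ h2)
    rwa [← sq]

lemma weightedSq_eq_zero {N : ℕ} {z : Fin N → ℝ} (h : weightedSq z = 0) : z = 0 := by
  have h1 := (Finset.sum_eq_zero_iff_of_nonneg fun i _ =>
    mul_nonneg (gaussWeight_pos N i).le (sq_nonneg (z i))).1 h
  funext i
  have := (mul_eq_zero.1 (h1 i (Finset.mem_univ i))).resolve_left (gaussWeight_pos N i).ne'
  exact pow_eq_zero_iff (two_ne_zero) |>.1 this

lemma stateDefect_eq_zero {N : ℕ} {q : ℝ[X]} (hq : q.degree < ((N + 1 : ℕ) : WithBot ℕ))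
    (i : Fin N) : stateDefect N q.eval (derivative q).eval i = 0 := by
  rw [stateDefect, sum_diffMatrix_mul_eval hq, sub_self]

lemma costateDefect_eq_zero {N : ℕ} {q : ℝ[X]} (hq : q.degree < ((N + 1 : ℕ) : WithBot ℕ))
    (i : Fin N) : costateDefect N q.eval (derivative q).eval i = 0 := by
  refine congrFun (weightedSq_eq_zero (z := costateDefect N q.eval (derivative q).eval) ?_) i
  have h0 : 0 ≤ weightedSq (costateDefect N q.eval (derivative q).eval) :=
    Finset.sum_nonneg fun i _ => mul_nonneg (gaussWeight_pos N i).le (sq_nonneg _)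
  suffices h : weightedSq (costateDefect N q.eval (derivative q).eval) ≤ 0 ∨ _ by
    rcases h with h | h
    · exact le_antisymm h h0
    · exact h
  refine weightedSq_le_of_forall fun φ hφ => ?_
  obtain ⟨hψ, hψ0, hψτ, hsum⟩ := sum_weight_adjMatrix (x := q.eval) hφ rfl
  set ψ := φ - C (φ.eval (-1) / (legendre N).eval (-1)) * legendre N
  have hq' := degree_derivative_lt_of_succ hq
  have hψ' := degree_derivative_lt_of_succ hψ
  have hq1 : (q - C (q.eval 1)).degree < ((N + 1 : ℕ) : WithBot ℕ) :=
    (degree_sub_le _ _).trans_lt (max_lt hq (degree_C_le.trans_lt (by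
      exact_mod_cast Nat.succ_pos N)))
  have h1 : gaussQuad N ((q - C (q.eval 1)) * derivative ψ) +
      gaussQuad N (derivative q * ψ) = 0 := by
    rw [gaussQuad_mul_eq_polyInt hq1 hψ' (by omega), gaussQuad_mul_eq_polyInt hq' hψ (by omega),
      mul_comm, polyInt_derivative_mul, hψ0]
    rw [derivative_sub, derivative_C, sub_zero, mul_comm ψ]
    simp
  simp only [gaussQuad, eval_mul, eval_sub, eval_C, hψτ] at h1
  have h2 : ∑ i, gaussWeight N i * (φ.eval (gaussPoint N i) *
      costateDefect N q.eval (derivative q).eval i) = 0 := by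
    have h3 : ∀ i, gaussWeight N i * (φ.eval (gaussPoint N i) *
        costateDefect N q.eval (derivative q).eval i) =
        gaussWeight N i * (φ.eval (gaussPoint N i) *
          ∑ j : Fin (N + 1), adjMatrix N i j * q.eval (node N j.succ)) -
        gaussWeight N i * (φ.eval (gaussPoint N i) *
          (derivative q).eval (gaussPoint N i)) := by
      intro i
      rw [costateDefect]
      ring
    rw [Finset.sum_congr rfl fun i _ => h3 i, Finset.sum_sub_distrib, hsum, ← neg_add',
      neg_eq_zero, ← h1]
    congr 1
    exact Finset.sum_congr rfl fun i _ => by ring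
  rw [h2]
  simp

/-- `∑ ω_i p(τ_i)² ≤ 2 sup p²`. -/
lemma gaussQuad_sq_le {N : ℕ} (hN : 1 ≤ N) {p : ℝ[X]} {B : ℝ}
    (h : ∀ t ∈ Set.Icc (-1 : ℝ) 1, p.eval t ^ 2 ≤ B) : gaussQuad N (p * p) ≤ 2 * B := by
  rw [← sum_gaussWeight hN, Finset.sum_mul]
  refine Finset.sum_le_sum fun i _ => ?_
  rw [eval_mul, ← sq]
  exact mul_le_mul_of_nonneg_left (h _ (gaussPoint_mem_Icc N i)) (gaussWeight_pos N i).le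

lemma gaussQuad_mul_sq_le (N : ℕ) (p q : ℝ[X]) :
    gaussQuad N (p * q) ^ 2 ≤ gaussQuad N (p * p) * gaussQuad N (q * q) := by
  refine Finset.sum_sq_le_sum_mul_sum_of_sq_le_mul _ (fun i _ => ?_) (fun i _ => ?_) fun i _ => ?_
  · rw [eval_mul]
    exact mul_nonneg (gaussWeight_pos N i).le (mul_self_nonneg _)
  · rw [eval_mul]
    exact mul_nonneg (gaussWeight_pos N i).le (mul_self_nonneg _)
  · rw [eval_mul, eval_mul, eval_mul]
    exact le_of_eq (by ring)

lemma gaussQuad_sub (N : ℕ) (p q : ℝ[X]) :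
    gaussQuad N (p - q) = gaussQuad N p - gaussQuad N q := by
  simp only [gaussQuad, eval_sub, mul_sub, Finset.sum_sub_distrib]

/-- Two approximations of `x'`: the `L²` residual `v`, orthogonal to the polynomials of degree less
than `N`, and a residual `w` that is uniformly small, with `w'` orthogonal to the polynomials of
degree less than `N - 1`. Here `B = (e / N)^k ‖x^{(k+1)}‖`. -/
lemma exists_residuals {N k : ℕ} (hN : 1 ≤ N) (hk : 1 ≤ k) (hkN : k ≤ N) (x : ℝ[X]) {B : ℝ}
    (hB : B = (Real.exp 1 / N) ^ k * polyNorm (derivative^[k + 1] x)) :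
    ∃ v w : ℝ[X], OrthLT N v ∧ (derivative x - v).degree < (N : WithBot ℕ) ∧
      (derivative x - w).degree < (N : WithBot ℕ) ∧ polyInt (v * v) ≤ B ^ 2 ∧
      polyInt (w * w) ≤ 16 * B ^ 2 ∧
      ∀ t ∈ Set.Icc (-1 : ℝ) 1, w.eval t ^ 2 ≤ 8 * N * B ^ 2 := by
  have hN0 : (0 : ℝ) < N := by exact_mod_cast hN
  obtain ⟨M, rfl⟩ : ∃ M, N = M + 1 := ⟨N - 1, by omega⟩
  obtain ⟨l, rfl⟩ : ∃ l, k = l + 1 := ⟨k - 1, by omega⟩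
  set E := polyNorm (derivative^[l + 1 + 1] x) with hE
  have hE0 : 0 ≤ E := polyNorm_nonneg _
  have hB0 : 0 ≤ B := by rw [hB]; positivity
  obtain ⟨π, hπ, hπo⟩ := exists_projection (M + 1) (derivative x)
  obtain ⟨ρ, hρ, hρo⟩ := exists_projection M (derivative (derivative x))
  have hdesc := pow_le_exp_mul_descFactorial (k := l + 1) (N := M + 1) hkN
  -- A quantity that is at most `E` after multiplication by `N! / (N - k)!` is at most `B`.
  have hscale : ∀ a : ℝ, 0 ≤ a → ((M + 1).descFactorial (l + 1) : ℝ) * a ≤ E → a ≤ B := by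
    intro a ha h
    have h1 : ((M + 1 : ℕ) : ℝ) ^ (l + 1) * a ≤ Real.exp 1 ^ (l + 1) * E := by
      calc ((M + 1 : ℕ) : ℝ) ^ (l + 1) * a
          ≤ Real.exp 1 ^ (l + 1) * (M + 1).descFactorial (l + 1) * a := by gcongr
        _ = Real.exp 1 ^ (l + 1) * ((M + 1).descFactorial (l + 1) * a) := by ring
        _ ≤ _ := by gcongr
    rw [hB, div_pow, div_mul_eq_mul_div, le_div_iff₀ (by positivity)]
    linarith
  have hv := hscale _ (polyNorm_nonneg _)
    (descFactorial_mul_polyNorm_sub_projection_le hkN hπ hπo)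
  have hr : polyNorm (derivative (derivative x) - ρ) / (M + 1 : ℕ) ≤ B := by
    refine hscale _ (div_nonneg (polyNorm_nonneg _) hN0.le) ?_
    have h1 := descFactorial_mul_polyNorm_sub_projection_le (by omega : l ≤ M) hρ hρo
    rw [← Function.iterate_succ_apply, ← Function.iterate_succ_apply] at h1
    rw [Nat.succ_descFactorial_succ]
    refine le_trans (le_of_eq ?_) h1
    push_cast
    field_simp
  set r := derivative (derivative x) - ρ with hr'
  rw [div_le_iff₀ hN0] at hr
  set w := antideriv r with hw
  have hw0 : w.eval (-1) = 0 := antideriv_eval_neg_one r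
  have hw' : derivative w = r := derivative_antideriv r
  have hwn : polyNorm w ≤ 4 * B := by
    rcases Nat.eq_zero_or_pos M with rfl | hM
    · have h1 := polyNorm_le_of_eval_neg_one hw0
      rw [hw'] at h1
      push_cast at hr
      linarith
    · have h1 := hρo.polyNorm_antideriv_le hM
      have hM0 : (1 : ℝ) ≤ M := by exact_mod_cast hM
      have h2 : (M : ℝ) * polyNorm w ≤ M * (2 * B) := by
        refine (h1.trans hr).trans ?_
        push_cast
        nlinarith
      have := le_of_mul_le_mul_left h2 (by linarith)
      linarith
  have hrsq : polyInt (r * r) ≤ (B * (M + 1 : ℕ)) ^ 2 := by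
    rw [← polyNorm_sq]
    exact pow_le_pow_left₀ (polyNorm_nonneg _) hr 2
  have hwsq : polyInt (w * w) ≤ 16 * B ^ 2 := by
    rw [← polyNorm_sq]
    refine (pow_le_pow_left₀ (polyNorm_nonneg _) hwn 2).trans (le_of_eq (by ring))
  refine ⟨derivative x - π, w, hπo, by rwa [sub_sub_cancel], ?_, ?_, hwsq, ?_⟩
  · refine degree_lt_succ_of_derivative ?_
    rw [derivative_sub, hw', hr', sub_sub_cancel]
    exact hρ
  · rw [← polyNorm_sq]
    exact pow_le_pow_left₀ (polyNorm_nonneg _) hv 2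
  · intro t ht
    set n : ℝ := ((M + 1 : ℕ) : ℝ) with hn
    have h1 := eval_sq_le_of_eval_neg_one hw0 (c := n / 4) (by positivity) ht
    rw [hw'] at h1
    calc w.eval t ^ 2 ≤ n / 4 * polyInt (w * w) + (n / 4)⁻¹ * polyInt (r * r) := h1
      _ ≤ n / 4 * (16 * B ^ 2) + (n / 4)⁻¹ * (B * n) ^ 2 := by gcongr
      _ = 8 * n * B ^ 2 := by field_simp; ring

lemma polyInt_sub_sq_le (v w : ℝ[X]) :
    polyInt ((v - w) * (v - w)) ≤ 2 * polyInt (v * v) + 2 * polyInt (w * w) := by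
  rw [← polyInt_C_mul, ← polyInt_C_mul, ← map_add]
  refine polyInt_mono fun t _ => ?_
  simp only [eval_mul, eval_sub, eval_add, eval_C]
  nlinarith [sq_nonneg (v.eval t + w.eval t)]

/-- The common part of the bounds for the two collocation defects: both, tested with `φ`, are
combinations of an endpoint value of `φ` and quadrature sums of `e φ'`, `e P_N'` and `φ v`. -/
lemma weightedSq_le_of_pairing {N : ℕ} (hN : 1 ≤ N) {v w x : ℝ[X]} {B : ℝ} (hv : OrthLT N v)
    (hxv : (derivative x - v).degree < (N : WithBot ℕ))
    (hxw : (derivative x - w).degree < (N : WithBot ℕ)) (hvB : polyInt (v * v) ≤ B ^ 2)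
    (hwB : polyInt (w * w) ≤ 16 * B ^ 2)
    (hws : ∀ t ∈ Set.Icc (-1 : ℝ) 1, w.eval t ^ 2 ≤ 8 * N * B ^ 2) {z : Fin N → ℝ}
    (hz : ∀ φ : ℝ[X], φ.degree < (N : WithBot ℕ) → ∃ a : ℝ,
      a ^ 2 ≤ (N : ℝ) ^ 2 / 2 * polyInt (φ * φ) ∧
      ∑ i, gaussWeight N i * (φ.eval (gaussPoint N i) * z i) =
        a * gaussQuad N (antideriv v * derivative (legendre N)) -
          gaussQuad N (antideriv v * derivative φ) - gaussQuad N (φ * v)) :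
    weightedSq z ≤ 540 * N * B ^ 2 := by
  have hN1 : (1 : ℝ) ≤ N := by exact_mod_cast hN
  have hNB : 0 ≤ (N : ℝ) * B ^ 2 := by positivity
  have hB2 : B ^ 2 ≤ N * B ^ 2 := le_mul_of_one_le_left (sq_nonneg _) hN1
  have hQv : gaussQuad N (v * v) ≤ 100 * N * B ^ 2 := by
    have h1 : gaussQuad N ((v - w) * (v - w)) = polyInt ((v - w) * (v - w)) := by
      have : (v - w).degree < (N : WithBot ℕ) := by
        rw [show v - w = (derivative x - w) - (derivative x - v) by ring]
        exact (degree_sub_le _ _).trans_lt (max_lt hxw hxv)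
      exact gaussQuad_mul_eq_polyInt this this (by omega)
    have h2 := polyInt_sub_sq_le v w
    have h3 := gaussQuad_sq_le hN hws
    have h4 : gaussQuad N (v * v) ≤
        2 * gaussQuad N ((v - w) * (v - w)) + 2 * gaussQuad N (w * w) := by
      simp only [gaussQuad, Finset.mul_sum, ← Finset.sum_add_distrib]
      refine Finset.sum_le_sum fun i _ => ?_
      simp only [eval_mul, eval_sub]
      have := mul_nonneg (gaussWeight_pos N i).le
        (sq_nonneg (v.eval (gaussPoint N i) - 2 * w.eval (gaussPoint N i)))
      nlinarith
    rw [h1] at h4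
    nlinarith
  suffices h : weightedSq z ≤ 540 * N * B ^ 2 ∨ weightedSq z = 0 by
    rcases h with h | h
    · exact h
    · rw [h]; positivity
  refine weightedSq_le_of_forall fun φ hφ => ?_
  obtain ⟨a, ha, hsum⟩ := hz φ hφ
  have hφ0 := polyInt_sq_nonneg φ
  have h1 := gaussQuad_antideriv_mul_derivative_sq_le hN hv hφ
  have h2 := gaussQuad_mul_derivative_legendre_sq_le hN (antideriv_eval_neg_one v)
    (hv.antideriv_eval_one hN)
  rw [derivative_antideriv] at h2
  have h3 := gaussQuad_mul_sq_le N φ v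
  rw [gaussQuad_mul_eq_polyInt hφ hφ (by omega)] at h3
  rw [hsum]
  set T := polyInt (φ * φ)
  set q1 := gaussQuad N (antideriv v * derivative (legendre N))
  set q2 := gaussQuad N (antideriv v * derivative φ)
  set q3 := gaussQuad N (φ * v)
  have b1 : (a * q1) ^ 2 ≤ 60 * (N * B ^ 2) * T := by
    calc (a * q1) ^ 2 = a ^ 2 * q1 ^ 2 := by ring
      _ ≤ ((N : ℝ) ^ 2 / 2 * T) * (120 / N * B ^ 2) := by
          refine mul_le_mul ha (h2.trans ?_) (sq_nonneg _) (by positivity)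
          gcongr
      _ = _ := by field_simp; ring
  have b2 : q2 ^ 2 ≤ 20 * (N * B ^ 2) * T := by
    refine h1.trans ?_
    calc 20 * (N : ℝ) * polyInt (v * v) * T ≤ 20 * N * B ^ 2 * T := by gcongr
      _ = _ := by ring
  have b3 : q3 ^ 2 ≤ 100 * (N * B ^ 2) * T := by
    refine h3.trans ?_
    calc T * gaussQuad N (v * v) ≤ T * (100 * N * B ^ 2) := by gcongr
      _ = _ := by ring
  nlinarith [sq_nonneg (a * q1 + q2), sq_nonneg (a * q1 + q3), sq_nonneg (q2 - q3)]

/-- The three defects of a polynomial `x`. In the collocation defects `x` may be replaced by the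
primitive of `v` that vanishes at `-1`, and in the quadrature defect `x'` may be replaced by `w`,
because the defects vanish on polynomials of degree at most `N`. -/
lemma defects_polynomial_le {N k : ℕ} (hN : 1 ≤ N) (hk : 1 ≤ k) (hkN : k ≤ N) (x : ℝ[X]) {B : ℝ}
    (hB : B = (Real.exp 1 / N) ^ k * polyNorm (derivative^[k + 1] x)) :
    weightedSq (stateDefect N x.eval (derivative x).eval) ≤ 540 * N * B ^ 2 ∧
    weightedSq (costateDefect N x.eval (derivative x).eval) ≤ 540 * N * B ^ 2 ∧
    quadDefect N x.eval (derivative x).eval ^ 2 ≤ 540 * N * B ^ 2 := by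
  obtain ⟨v, w, hv, hxv, hxw, hvB, hwB, hws⟩ := exists_residuals hN hk hkN x hB
  set e := antideriv v with he
  have he0 : e.eval (-1) = 0 := antideriv_eval_neg_one v
  have he1 : e.eval 1 = 0 := hv.antideriv_eval_one hN
  have he' : derivative e = v := derivative_antideriv v
  set q := x - e with hq
  have hqdeg : q.degree < ((N + 1 : ℕ) : WithBot ℕ) := by
    refine degree_lt_succ_of_derivative ?_
    rw [hq, derivative_sub, he']
    exact hxv
  have hx : x = q + e := by rw [hq]; ring
  refine ⟨?_, ?_, ?_⟩
  · refine weightedSq_le_of_pairing hN hv hxv hxw hvB hwB hws fun φ hφ =>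
      ⟨φ.eval 1, eval_endpoint_sq_le hφ (Or.inl rfl), ?_⟩
    have h1 : ∀ i, stateDefect N x.eval (derivative x).eval i =
        (∑ j : Fin (N + 1), diffMatrix N i j * e.eval (node N j.castSucc)) -
          v.eval (gaussPoint N i) := by
      intro i
      have h2 := stateDefect_eq_zero hqdeg i
      rw [stateDefect] at h2 ⊢
      rw [hx, derivative_add, he']
      simp only [eval_add, mul_add, Finset.sum_add_distrib]
      linarith
    simp only [h1, mul_sub, Finset.sum_sub_distrib]
    rw [sum_weight_diffMatrix (x := e.eval) he0 hφ]
    simp only [gaussQuad, eval_mul, he]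
  · refine weightedSq_le_of_pairing hN hv hxv hxw hvB hwB hws fun φ hφ =>
      ⟨φ.eval (-1) / (legendre N).eval (-1), ?_, ?_⟩
    · rw [div_pow, legendre_eval_neg_one_sq, div_one]
      exact eval_endpoint_sq_le hφ (Or.inr rfl)
    have h1 : ∀ i, costateDefect N x.eval (derivative x).eval i =
        (∑ j : Fin (N + 1), adjMatrix N i j * e.eval (node N j.succ)) -
          v.eval (gaussPoint N i) := by
      intro i
      have h2 := costateDefect_eq_zero hqdeg i
      rw [costateDefect] at h2 ⊢
      rw [hx, derivative_add, he']
      simp only [eval_add, mul_add, Finset.sum_add_distrib]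
      linarith
    simp only [h1, mul_sub, Finset.sum_sub_distrib]
    rw [(sum_weight_adjMatrix (x := e.eval) hφ rfl).2.2.2, he1]
    simp only [gaussQuad, eval_mul, ← he, derivative_sub, derivative_C_mul, eval_sub, eval_C,
      sub_zero, mul_sub, Finset.sum_sub_distrib, Finset.mul_sum, neg_sub]
    congr 2
    exact Finset.sum_congr rfl fun i _ => by ring
  · have h1 : quadDefect N x.eval (derivative x).eval = polyInt w - gaussQuad N w := by
      have h2 : gaussQuad N (derivative x - w) = polyInt (derivative x - w) :=
        gaussQuad_eq_polyInt (hxw.trans_le (by exact_mod_cast (by omega : N ≤ 2 * N)))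
      rw [gaussQuad_sub, map_sub, polyInt_derivative] at h2
      change x.eval 1 - x.eval (-1) - gaussQuad N (derivative x) = _
      linarith
    have hint : polyInt w ^ 2 ≤ 32 * B ^ 2 := by
      have := polyInt_cauchySchwarz 1 w 1 (by simp)
      rw [one_mul, one_mul, mul_one, mul_one, mul_one, ← C_1, polyInt_C] at this
      linarith
    have hsum : gaussQuad N w ^ 2 ≤ 32 * (N * B ^ 2) := by
      have h2 := gaussQuad_mul_sq_le N w 1
      have h3 := gaussQuad_sq_le hN hws
      have h4 : gaussQuad N (1 * 1) = 2 := by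
        simp [gaussQuad, sum_gaussWeight hN]
      rw [mul_one, h4] at h2
      linarith
    have hN1 : (1 : ℝ) ≤ N := by exact_mod_cast hN
    have hB2 : B ^ 2 ≤ N * B ^ 2 := le_mul_of_one_le_left (sq_nonneg _) hN1
    rw [h1]
    nlinarith [sq_nonneg (polyInt w + gaussQuad N w)]

end GaussCollocation

namespace GaussCollocation
open Polynomial Filter Topology

/-! ### Weak derivatives and iterated primitives -/

/-- Test functions on `(-1, 1)`. -/
structure IsTest (φ : ℝ → ℝ) : Prop where
  contDiff : ContDiff ℝ ∞ φ
  hasCompactSupport : HasCompactSupport φ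
  tsupport_subset : tsupport φ ⊆ Set.Ioo (-1) 1

lemma setIntegral_Ω (f : ℝ → ℝ) : ∫ t in Ω, f t = ∫ t in (-1 : ℝ)..1, f t := by
  rw [Ω, integral_Icc_eq_integral_Ioc, intervalIntegral.integral_of_le (by norm_num)]

lemma intervalIntegrable_iff_integrableOn_Ω {f : ℝ → ℝ} :
    IntervalIntegrable f volume (-1) 1 ↔ IntegrableOn f Ω :=
  intervalIntegrable_iff_integrableOn_Icc_of_le (by norm_num)

lemma uIcc_eq_Ω : Set.uIcc (-1 : ℝ) 1 = Ω := Set.uIcc_of_le (by norm_num)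

lemma integrableOn_of_continuousOn {f : ℝ → ℝ} (hf : ContinuousOn f Ω) : IntegrableOn f Ω :=
  hf.integrableOn_Icc

namespace IsTest

variable {φ : ℝ → ℝ}

lemma isTest_deriv (h : IsTest φ) : IsTest (deriv φ) where
  contDiff := (contDiff_infty_iff_deriv.1 h.contDiff).2
  hasCompactSupport := h.hasCompactSupport.deriv
  tsupport_subset := tsupport_deriv_subset.trans h.tsupport_subset

lemma isTest_iteratedDeriv (h : IsTest φ) (k : ℕ) : IsTest (iteratedDeriv k φ) := by
  induction k with
  | zero => rwa [iteratedDeriv_zero]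
  | succ k ih => rw [iteratedDeriv_succ]; exact ih.isTest_deriv

lemma eq_zero (h : IsTest φ) {t : ℝ} (ht : t ∉ Set.Ioo (-1 : ℝ) 1) : φ t = 0 :=
  image_eq_zero_of_notMem_tsupport fun h' => ht (h.tsupport_subset h')

lemma eq_zero_left (h : IsTest φ) : φ (-1) = 0 := h.eq_zero (by simp)

lemma eq_zero_right (h : IsTest φ) : φ 1 = 0 := h.eq_zero (by simp)

lemma continuous (h : IsTest φ) : Continuous φ := h.contDiff.continuous

lemma integrableOn_mul (h : IsTest φ) {w : ℝ → ℝ} (hw : IntegrableOn w Ω) :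
    IntegrableOn (fun t => φ t * w t) Ω :=
  hw.continuousOn_mul h.continuous.continuousOn isCompact_Icc

end IsTest

/-- The primitive of `f` that vanishes at `-1`. -/
noncomputable def prim (f : ℝ → ℝ) (t : ℝ) : ℝ := ∫ s in (-1 : ℝ)..t, f s

lemma continuousOn_prim {f : ℝ → ℝ} (hf : IntegrableOn f Ω) : ContinuousOn (prim f) Ω := by
  rw [← uIcc_eq_Ω] at hf ⊢
  exact intervalIntegral.continuousOn_primitive_interval hf

lemma continuousOn_prim_iterate {f : ℝ → ℝ} (hf : IntegrableOn f Ω) (k : ℕ) :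
    ContinuousOn (prim^[k + 1] f) Ω := by
  induction k with
  | zero => exact continuousOn_prim hf
  | succ k ih =>
    rw [Function.iterate_succ_apply']
    exact continuousOn_prim (integrableOn_of_continuousOn ih)

lemma integrableOn_prim_iterate {f : ℝ → ℝ} (hf : IntegrableOn f Ω) (k : ℕ) :
    IntegrableOn (prim^[k] f) Ω := by
  cases k with
  | zero => exact hf
  | succ k => exact integrableOn_of_continuousOn (continuousOn_prim_iterate hf k)

lemma hasDerivWithinAt_prim {f : ℝ → ℝ} (hf : ContinuousOn f Ω) {t : ℝ} (ht : t ∈ Ω) :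
    HasDerivWithinAt (prim f) (f t) Ω t := by
  have hint : IntervalIntegrable f volume (-1) t := by
    refine (hf.mono ?_).intervalIntegrable
    rw [Set.uIcc_of_le ht.1]
    exact Set.Icc_subset_Icc_right ht.2
  have : Fact (t ∈ Set.Icc (-1 : ℝ) 1) := ⟨ht⟩
  exact intervalIntegral.integral_hasDerivWithinAt_right (s := Set.Icc (-1) 1)
    (t := Set.Icc (-1) 1) hint
    (hf.stronglyMeasurableAtFilter_nhdsWithin measurableSet_Icc t) (hf t ht)

/-- The primitive of a polynomial is its polynomial antiderivative. -/
lemma prim_eval (p : ℝ[X]) : prim p.eval = (antideriv p).eval := by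
  funext t
  have h := intervalIntegral.integral_eq_sub_of_hasDerivAt (a := -1) (b := t)
    (fun s _ => (antideriv p).hasDerivAt s)
    (by rw [derivative_antideriv]; exact p.continuous.intervalIntegrable _ _)
  rw [derivative_antideriv, antideriv_eval_neg_one, sub_zero] at h
  exact h

lemma prim_iterate_eval (p : ℝ[X]) (k : ℕ) : prim^[k] p.eval = (antideriv^[k] p).eval := by
  induction k with
  | zero => rfl
  | succ k ih => rw [Function.iterate_succ_apply', ih, prim_eval, Function.iterate_succ_apply']

lemma derivative_iterate_antideriv_iterate (p : ℝ[X]) (k : ℕ) :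
    derivative^[k] (antideriv^[k] p) = p := by
  induction k with
  | zero => rfl
  | succ k ih =>
    rw [Function.iterate_succ_apply, Function.iterate_succ_apply', derivative_antideriv, ih]

/-- Integration by parts against a primitive of an integrable function. -/
lemma IsTest.integral_deriv_mul_prim {φ w : ℝ → ℝ} (h : IsTest φ) (hw : IntegrableOn w Ω) :
    ∫ t in Ω, deriv φ t * prim w t = -∫ t in Ω, φ t * w t := by
  have hwi := intervalIntegrable_iff_integrableOn_Ω.2 hw
  have h1 : AbsolutelyContinuousOnInterval φ (-1) 1 :=
    (h.contDiff.of_le (by exact_mod_cast le_top)).contDiffOn.absolutelyContinuousOnInterval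
  have h2 : AbsolutelyContinuousOnInterval (prim w) (-1) 1 :=
    hwi.absolutelyContinuousOnInterval_intervalIntegral (by simp)
  have h3 := h1.integral_mul_deriv_eq_deriv_mul h2
  rw [h.eq_zero_left, h.eq_zero_right, zero_mul, zero_mul, sub_zero, zero_sub] at h3
  rw [setIntegral_Ω, setIntegral_Ω, ← neg_eq_iff_eq_neg, ← h3]
  refine intervalIntegral.integral_congr_ae ?_
  filter_upwards [hwi.ae_hasDerivAt_integral] with t ht ht'
  have := (ht (Set.uIoc_subset_uIcc ht') (-1) (by simp)).deriv
  rw [← this]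
  rfl

lemma IsTest.integral_iteratedDeriv_mul_prim {φ w : ℝ → ℝ} (h : IsTest φ)
    (hw : IntegrableOn w Ω) (k : ℕ) :
    ∫ t in Ω, iteratedDeriv k φ t * prim^[k] w t = (-1) ^ k * ∫ t in Ω, φ t * w t := by
  induction k with
  | zero => simp
  | succ k ih =>
    rw [iteratedDeriv_succ, Function.iterate_succ_apply',
      (h.isTest_iteratedDeriv k).integral_deriv_mul_prim (integrableOn_prim_iterate hw k), ih,
      pow_succ]
    ring

/-- A test function with vanishing integral is the derivative of a test function. -/
lemma IsTest.exists_deriv_eq {φ : ℝ → ℝ} (h : IsTest φ) (h0 : ∫ t in Ω, φ t = 0) :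
    ∃ χ, IsTest χ ∧ deriv χ = φ := by
  have hd : ∀ t, HasDerivAt (prim φ) (φ t) t := fun t =>
    intervalIntegral.integral_hasDerivAt_right (h.continuous.intervalIntegrable _ _)
      (h.continuous.stronglyMeasurableAtFilter _ _) h.continuous.continuousAt
  have hderiv : deriv (prim φ) = φ := funext fun t => (hd t).deriv
  obtain ⟨a, b, ha, hb, hab⟩ : ∃ a b : ℝ, -1 < a ∧ b < 1 ∧ tsupport φ ⊆ Set.Icc a b := by
    rcases (tsupport φ).eq_empty_or_nonempty with he | hne
    · exact ⟨0, 0, by norm_num, by norm_num, by simp [he]⟩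
    · have hc : IsCompact (tsupport φ) := h.hasCompactSupport
      obtain ⟨a, haK, ha⟩ := hc.exists_isLeast hne
      obtain ⟨b, hbK, hb⟩ := hc.exists_isGreatest hne
      exact ⟨a, b, (h.tsupport_subset haK).1, (h.tsupport_subset hbK).2,
        fun t ht => ⟨ha ht, hb ht⟩⟩
  have hz : ∀ t, t ∉ Set.Icc a b → φ t = 0 := fun t ht =>
    image_eq_zero_of_notMem_tsupport fun h' => ht (hab h')
  have hsupp : tsupport (prim φ) ⊆ Set.Icc a b := by
    refine closure_minimal (fun t ht => ?_) isClosed_Icc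
    by_contra hcon
    refine ht ?_
    rcases lt_or_ge t a with hta | hta
    · refine intervalIntegral.integral_zero_ae (Eventually.of_forall fun s hs => hz s fun hs' => ?_)
      rcases Set.mem_uIoc.1 hs with hs | hs
      · linarith [hs'.1, hs.2]
      · linarith [hs'.1, hs.2]
    · have htb : b < t := by
        by_contra hcon'
        exact hcon ⟨hta, not_lt.1 hcon'⟩
      rw [setIntegral_Ω] at h0
      change ∫ s in (-1 : ℝ)..t, φ s = 0
      rw [← intervalIntegral.integral_add_adjacent_intervals (b := 1)
        (h.continuous.intervalIntegrable _ _) (h.continuous.intervalIntegrable _ _), h0, zero_add]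
      refine intervalIntegral.integral_zero_ae (Eventually.of_forall fun s hs => hz s fun hs' => ?_)
      rcases Set.mem_uIoc.1 hs with hs | hs
      · linarith [hs'.2, hs.1]
      · linarith [hs'.2, hs.1]
  refine ⟨prim φ, ⟨?_, ?_, ?_⟩, hderiv⟩
  · rw [contDiff_infty_iff_deriv, hderiv]
    exact ⟨fun t => (hd t).differentiableAt, h.contDiff⟩
  · exact isCompact_Icc.of_isClosed_subset (isClosed_tsupport _) hsupp
  · exact hsupp.trans fun t ht => ⟨ha.trans_le ht.1, ht.2.trans_lt hb⟩

lemma exists_isTest_integral_eq_one : ∃ φ, IsTest φ ∧ ∫ t in Ω, φ t = 1 := by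
  obtain ⟨f, hf1, hf2, hf3, hf4, hf5⟩ := exists_contDiff_tsupport_subset (n := ⊤)
    (Ioo_mem_nhds (by norm_num : (-1 : ℝ) < 0) (by norm_num : (0 : ℝ) < 1))
  have hf : IsTest f := ⟨hf3, hf2, hf1⟩
  have hpos : 0 < ∫ t in (-1 : ℝ)..1, f t :=
    intervalIntegral.integral_pos (by norm_num) hf.continuous.continuousOn
      (fun t _ => (hf4 ⟨t, rfl⟩).1) ⟨0, by norm_num, by rw [hf5]; exact one_pos⟩
  refine ⟨fun t => (∫ t in (-1 : ℝ)..1, f t)⁻¹ * f t,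
    ⟨contDiff_const.mul hf3, hf2.mul_left, ?_⟩, ?_⟩
  · exact (tsupport_mul_subset_right).trans hf1
  · rw [setIntegral_Ω, intervalIntegral.integral_const_mul, inv_mul_cancel₀ hpos.ne']

lemma IsTest.sub_const_mul {φ ψ : ℝ → ℝ} (hφ : IsTest φ) (hψ : IsTest ψ) (c : ℝ) :
    IsTest (φ - fun t => c * ψ t) where
  contDiff := hφ.contDiff.sub (contDiff_const.mul hψ.contDiff)
  hasCompactSupport := hφ.hasCompactSupport.sub hψ.hasCompactSupport.mul_left
  tsupport_subset := (tsupport_sub _ _).trans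
    (Set.union_subset hφ.tsupport_subset ((tsupport_mul_subset_right).trans hψ.tsupport_subset))

/-- The lemma of du Bois-Reymond of order `k`: a function whose weak derivative of order `k`
vanishes agrees almost everywhere with a polynomial of degree less than `k`. -/
lemma exists_polynomial_ae_eq (k : ℕ) : ∀ {w : ℝ → ℝ}, IntegrableOn w Ω →
    (∀ φ, IsTest φ → ∫ t in Ω, iteratedDeriv k φ t * w t = 0) →
    ∃ q : ℝ[X], derivative^[k] q = 0 ∧ w =ᵐ[volume.restrict Ω] q.eval := by
  induction k with
  | zero =>
    intro w hw h
    refine ⟨0, rfl, ?_⟩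
    have h1 : ∀ᵐ t ∂(volume : Measure ℝ), t ∈ Set.Ioo (-1 : ℝ) 1 → w t = 0 := by
      refine isOpen_Ioo.ae_eq_zero_of_integral_contDiff_smul_eq_zero
        (hw.mono_set Set.Ioo_subset_Icc_self).locallyIntegrableOn fun φ h1 h2 h3 => ?_
      have hφ : IsTest φ := ⟨h1, h2, h3⟩
      rw [← h φ hφ, iteratedDeriv_zero]
      symm
      refine setIntegral_eq_integral_of_forall_compl_eq_zero fun t ht => ?_
      rw [hφ.eq_zero fun h' => ht ⟨h'.1.le, h'.2.le⟩, zero_mul]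
    have h2 : (Set.Ioo (-1 : ℝ) 1 : Set ℝ) =ᵐ[volume] Set.Icc (-1 : ℝ) 1 := Ioo_ae_eq_Icc
    rw [Ω, ← Measure.restrict_congr_set h2]
    refine (ae_restrict_iff' measurableSet_Ioo).2 ?_
    filter_upwards [h1] with t ht ht'
    rw [ht ht', eval_zero]
  | succ k ih =>
    intro w hw h
    obtain ⟨φ₀, hφ₀, hint⟩ := exists_isTest_integral_eq_one
    set κ := ∫ t in Ω, iteratedDeriv k φ₀ t * w t with hκ
    set r : ℝ[X] := C ((-1) ^ k * κ) * antideriv^[k] 1 with hr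
    have hrd : derivative^[k + 1] r = 0 := by
      rw [hr, iterate_derivative_C_mul, Function.iterate_succ_apply',
        derivative_iterate_antideriv_iterate, derivative_one, mul_zero]
    have hri : IntegrableOn r.eval Ω := integrableOn_of_continuousOn r.continuous.continuousOn
    obtain ⟨q, hq, hqw⟩ := ih (hw.sub hri) (by
      intro φ hφ
      have h1 : IsTest (φ - fun t => (∫ t in Ω, φ t) * φ₀ t) := hφ.sub_const_mul hφ₀ _
      have h2 : ∫ t in Ω, (φ - fun t => (∫ t in Ω, φ t) * φ₀ t) t = 0 := by
        simp only [Pi.sub_apply]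
        rw [integral_sub (integrableOn_of_continuousOn hφ.continuous.continuousOn)
          ((integrableOn_of_continuousOn hφ₀.continuous.continuousOn).const_mul _),
          integral_const_mul, hint, mul_one, sub_self]
      obtain ⟨χ, hχ, hχd⟩ := h1.exists_deriv_eq h2
      have h3 := h χ hχ
      rw [iteratedDeriv_succ', hχd] at h3
      have h4 : ∀ t, iteratedDeriv k (φ - fun t => (∫ t in Ω, φ t) * φ₀ t) t =
          iteratedDeriv k φ t - (∫ t in Ω, φ t) * iteratedDeriv k φ₀ t := by
        intro t
        rw [iteratedDeriv_sub (hφ.contDiff.contDiffAt.of_le (by exact_mod_cast le_top))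
          ((contDiff_const.mul hφ₀.contDiff).contDiffAt.of_le (by exact_mod_cast le_top)),
          iteratedDeriv_const_mul_field]
      simp only [h4, sub_mul, mul_assoc] at h3
      rw [integral_sub ((hφ.isTest_iteratedDeriv k).integrableOn_mul hw)
        (((hφ₀.isTest_iteratedDeriv k).integrableOn_mul hw).const_mul _), integral_const_mul,
        ← hκ] at h3
      have h5 := hφ.integral_iteratedDeriv_mul_prim (w := (1 : ℝ[X]).eval)
        (integrableOn_of_continuousOn (1 : ℝ[X]).continuous.continuousOn) k
      rw [prim_iterate_eval] at h5
      simp only [eval_one, mul_one] at h5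
      have h6 : ∀ t, iteratedDeriv k φ t * (w - r.eval) t = iteratedDeriv k φ t * w t -
          ((-1) ^ k * κ) * (iteratedDeriv k φ t * (antideriv^[k] (1 : ℝ[X])).eval t) := by
        intro t
        simp only [Pi.sub_apply, hr, eval_mul, eval_C]
        ring
      simp only [h6]
      rw [integral_sub ((hφ.isTest_iteratedDeriv k).integrableOn_mul hw)
        (((hφ.isTest_iteratedDeriv k).integrableOn_mul (integrableOn_of_continuousOn
          (antideriv^[k] (1 : ℝ[X])).continuous.continuousOn)).const_mul _), integral_const_mul, h5]
      have h7 : ((-1 : ℝ) ^ k) * (-1) ^ k = 1 := by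
        rw [← mul_pow]; norm_num
      linear_combination h3 - κ * (∫ t in Ω, φ t) * h7)
    refine ⟨q + r, ?_, ?_⟩
    · rw [iterate_map_add, hrd, Function.iterate_succ_apply', hq, derivative_zero,
        add_zero]
    · filter_upwards [hqw] with t ht
      rw [eval_add, ← ht, Pi.sub_apply, sub_add_cancel]

/-! ### Approximation by polynomials -/

/-- Polynomials are dense in `L²(-1, 1)`, with quantitative control of the `L¹` distance and of the
`L²` norm. -/
lemma exists_polynomial_near {h : ℝ → ℝ} (hh : MemLp h 2 (volume.restrict Ω)) {ε : ℝ}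
    (hε : 0 < ε) : ∃ H : ℝ[X], ∫ t in Ω, |H.eval t - h t| ≤ 4 * ε ∧
      polyInt (H * H) ≤ (1 + ε) * (∫ t in Ω, h t ^ 2) + (1 + ε) * (6 * ε) := by
  have : IsFiniteMeasure (volume.restrict Ω) := ⟨by simp [Ω]⟩
  obtain ⟨g, hg, hgm⟩ := MemLp.exists_boundedContinuous_integral_rpow_sub_le
    (μ := volume.restrict Ω) (p := 2) (by norm_num) (f := h) (by simpa using hh)
    (ε := ε ^ 2) (by positivity)
  obtain ⟨H, hH⟩ := exists_polynomial_near_of_continuousOn (-1) 1 g g.continuous.continuousOn ε hε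
  have hh2 : Integrable (fun t => h t ^ 2) (volume.restrict Ω) := hh.integrable_sq
  have hgL : MemLp g 2 (volume.restrict Ω) := by simpa using hgm
  have hHL : MemLp H.eval 2 (volume.restrict Ω) :=
    MemLp.of_bound H.continuous.aestronglyMeasurable (sSup ((fun t => |H.eval t|) '' Ω)) (by
      refine (ae_restrict_iff' measurableSet_Icc).2 (Eventually.of_forall fun t ht => ?_)
      exact le_csSup (isCompact_Icc.image (H.continuous.abs)).bddAbove ⟨t, ht, rfl⟩)
  have hgh2 : Integrable (fun t => (h t - g t) ^ 2) (volume.restrict Ω) :=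
    (hh.sub hgL).integrable_sq
  have hHh2 : Integrable (fun t => (H.eval t - h t) ^ 2) (volume.restrict Ω) :=
    (hHL.sub hh).integrable_sq
  have hHh : Integrable (fun t => |H.eval t - h t|) (volume.restrict Ω) :=
    ((hHL.sub hh).integrable (by norm_num)).abs
  have hH2 : Integrable (fun t => H.eval t ^ 2) (volume.restrict Ω) := hHL.integrable_sq
  have hc : ∀ c : ℝ, Integrable (fun _ : ℝ => c) (volume.restrict Ω) := fun c =>
    integrable_const c
  have hci : ∀ c : ℝ, ∫ _ in Ω, c = 2 * c := fun c => by
    rw [setIntegral_Ω, intervalIntegral.integral_const]; norm_num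
  have hg' : ∫ t in Ω, (h t - g t) ^ 2 ≤ ε ^ 2 := by
    refine le_trans (le_of_eq ?_) hg
    refine integral_congr_ae (Eventually.of_forall fun t => ?_)
    simp
  have hae : ∀ {P : ℝ → Prop}, (∀ t ∈ Ω, P t) → ∀ᵐ t ∂(volume.restrict Ω), P t := fun hP =>
    (ae_restrict_iff' measurableSet_Icc).2 (Eventually.of_forall hP)
  have hD : ∫ t in Ω, (H.eval t - h t) ^ 2 ≤ 6 * ε ^ 2 := by
    calc ∫ t in Ω, (H.eval t - h t) ^ 2 ≤ ∫ t in Ω, (2 * (h t - g t) ^ 2 + 2 * ε ^ 2) := by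
          refine integral_mono_ae hHh2 ((hgh2.const_mul 2).add (hc _)) (hae fun t ht => ?_)
          have := abs_lt.1 (hH t ht)
          have h1 : (H.eval t - g t) ^ 2 ≤ ε ^ 2 := by nlinarith
          nlinarith [sq_nonneg (H.eval t - g t + (h t - g t))]
      _ ≤ 6 * ε ^ 2 := by
          rw [integral_add (hgh2.const_mul 2) (hc _), integral_const_mul, hci]
          linarith
  refine ⟨H, ?_, ?_⟩
  · calc ∫ t in Ω, |H.eval t - h t| ≤ ∫ t in Ω, ((2 * ε)⁻¹ * (H.eval t - h t) ^ 2 + ε / 2) := by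
          refine integral_mono_ae hHh ((hHh2.const_mul _).add (hc _)) (hae fun t ht => ?_)
          have h1 : 0 ≤ (2 * ε)⁻¹ * (|H.eval t - h t| - ε) ^ 2 := by positivity
          have h2 : (2 * ε)⁻¹ * (|H.eval t - h t| - ε) ^ 2 =
              (2 * ε)⁻¹ * (H.eval t - h t) ^ 2 + ε / 2 - |H.eval t - h t| := by
            rw [← sq_abs (H.eval t - h t)]
            field_simp
            ring
          linarith
      _ ≤ 4 * ε := by
          rw [integral_add (hHh2.const_mul _) (hc _), integral_const_mul, hci]
          have : (2 * ε)⁻¹ * ∫ t in Ω, (H.eval t - h t) ^ 2 ≤ (2 * ε)⁻¹ * (6 * ε ^ 2) :=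
            mul_le_mul_of_nonneg_left hD (by positivity)
          have h3 : (2 * ε)⁻¹ * (6 * ε ^ 2) = 3 * ε := by field_simp; norm_num
          linarith
  · have hpi : polyInt (H * H) = ∫ t in Ω, H.eval t ^ 2 := by
      rw [setIntegral_Ω, polyInt_apply]
      simp [sq]
    rw [hpi]
    calc ∫ t in Ω, H.eval t ^ 2
        ≤ ∫ t in Ω, ((1 + ε) * h t ^ 2 + (1 + ε⁻¹) * (H.eval t - h t) ^ 2) := by
          refine integral_mono_ae hH2 ((hh2.const_mul _).add (hHh2.const_mul _))
            (hae fun t ht => ?_)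
          have h1 : 0 ≤ ε⁻¹ * (ε * h t - (H.eval t - h t)) ^ 2 := by positivity
          have h2 : ε⁻¹ * (ε * h t - (H.eval t - h t)) ^ 2 =
              (1 + ε) * h t ^ 2 + (1 + ε⁻¹) * (H.eval t - h t) ^ 2 - H.eval t ^ 2 := by
            field_simp
            ring
          linarith
      _ ≤ _ := by
          rw [integral_add (hh2.const_mul _) (hHh2.const_mul _), integral_const_mul,
            integral_const_mul]
          have : (1 + ε⁻¹) * ∫ t in Ω, (H.eval t - h t) ^ 2 ≤ (1 + ε⁻¹) * (6 * ε ^ 2) :=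
            mul_le_mul_of_nonneg_left hD (by positivity)
          have h3 : (1 + ε⁻¹) * (6 * ε ^ 2) = (1 + ε) * (6 * ε) := by field_simp; ring
          linarith

lemma abs_prim_iterate_sub_le {f g : ℝ → ℝ} (hf : IntegrableOn f Ω) (hg : IntegrableOn g Ω)
    (k : ℕ) :
    ∀ t ∈ Ω, |prim^[k + 1] f t - prim^[k + 1] g t| ≤ 2 ^ k * ∫ t in Ω, |f t - g t| := by
  have hsub : ∀ {F : ℝ → ℝ}, IntegrableOn F Ω → ∀ t ∈ Ω, IntervalIntegrable F volume (-1) t := by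
    intro F hF t ht
    rw [intervalIntegrable_iff_integrableOn_Icc_of_le ht.1]
    exact hF.mono_set (Set.Icc_subset_Icc_right ht.2)
  induction k with
  | zero =>
    intro t ht
    simp only [zero_add, Function.iterate_one, pow_zero, one_mul, prim]
    rw [← intervalIntegral.integral_sub (hsub hf t ht) (hsub hg t ht)]
    refine (intervalIntegral.abs_integral_le_integral_abs ht.1).trans ?_
    rw [setIntegral_Ω]
    refine intervalIntegral.integral_mono_interval le_rfl ht.1 ht.2
      (Eventually.of_forall fun s => abs_nonneg _) ?_
    exact intervalIntegrable_iff_integrableOn_Ω.2 (hf.sub hg).abs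
  | succ k ih =>
    intro t ht
    rw [Function.iterate_succ_apply', Function.iterate_succ_apply' _ _ g]
    change |(∫ s in (-1 : ℝ)..t, _) - ∫ s in (-1 : ℝ)..t, _| ≤ _
    rw [← intervalIntegral.integral_sub (hsub (integrableOn_prim_iterate hf _) t ht)
      (hsub (integrableOn_prim_iterate hg _) t ht)]
    have hle : ∀ s ∈ Set.uIoc (-1) t, ‖prim^[k + 1] f s - prim^[k + 1] g s‖ ≤
        2 ^ k * ∫ t in Ω, |f t - g t| := by
      intro s hs
      rw [Set.uIoc_of_le ht.1] at hs
      exact ih s ⟨hs.1.le, hs.2.trans ht.2⟩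
    refine (intervalIntegral.norm_integral_le_of_norm_le_const hle).trans ?_
    · have h0 : 0 ≤ 2 ^ k * ∫ t in Ω, |f t - g t| := by positivity
      rw [abs_of_nonneg (by linarith [ht.1]), pow_succ]
      nlinarith [ht.2]

/-- A function with a weak derivative `h` of order `k + 1 ≥ 2` in `L²` is, together with its first
derivative, a pointwise limit of polynomials whose derivatives of order `k + 1` are asymptotically
no larger than `h` in `L²`. -/
lemma exists_polynomial_approx {k : ℕ} (hk : 1 ≤ k) {x x' h : ℝ → ℝ}
    (hx : ∀ t ∈ Ω, HasDerivWithinAt x (x' t) Ω t) (hh : MemLp h 2 (volume.restrict Ω))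
    (hw : ∀ φ, IsTest φ →
      ∫ t in Ω, iteratedDeriv (k + 1) φ t * x t = (-1) ^ (k + 1) * ∫ t in Ω, φ t * h t) :
    ∃ X : ℕ → ℝ[X], (∀ t ∈ Ω, Tendsto (fun n => (X n).eval t) atTop (𝓝 (x t))) ∧
      (∀ t ∈ Ω, Tendsto (fun n => (derivative (X n)).eval t) atTop (𝓝 (x' t))) ∧
      ∃ b : ℕ → ℝ, Tendsto b atTop (𝓝 (∫ t in Ω, h t ^ 2)) ∧
        ∀ n, polyInt (derivative^[k + 1] (X n) * derivative^[k + 1] (X n)) ≤ b n := by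
  have : IsFiniteMeasure (volume.restrict Ω) := ⟨by simp [Ω]⟩
  obtain ⟨j, rfl⟩ : ∃ j, k = j + 1 := ⟨k - 1, by omega⟩
  have hxc : ContinuousOn x Ω := fun t ht => (hx t ht).continuousWithinAt
  have hhi : IntegrableOn h Ω := hh.integrable (by norm_num)
  have hpc := continuousOn_prim_iterate hhi (j + 1)
  obtain ⟨q, hq, hqx⟩ := exists_polynomial_ae_eq (j + 1 + 1) (w := x - prim^[j + 1 + 1] h)
    (integrableOn_of_continuousOn (hxc.sub hpc)) (by
      intro φ hφ
      simp only [Pi.sub_apply, mul_sub]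
      rw [integral_sub ((hφ.isTest_iteratedDeriv _).integrableOn_mul
        (integrableOn_of_continuousOn hxc))
        ((hφ.isTest_iteratedDeriv _).integrableOn_mul (integrableOn_of_continuousOn hpc)), hw φ hφ,
        hφ.integral_iteratedDeriv_mul_prim hhi, sub_self])
  have hxq : ∀ t ∈ Ω, x t = q.eval t + prim^[j + 1 + 1] h t := by
    have := Measure.eqOn_Icc_of_ae_eq (μ := volume) (by norm_num : (-1 : ℝ) ≠ 1) hqx (hxc.sub hpc)
      q.continuous.continuousOn
    intro t ht
    have := this ht
    simp only [Pi.sub_apply] at this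
    linarith
  have hxq' : ∀ t ∈ Ω, x' t = (derivative q).eval t + prim^[j + 1] h t := by
    intro t ht
    have h1 : HasDerivWithinAt (fun t => q.eval t + prim^[j + 1 + 1] h t)
        ((derivative q).eval t + prim^[j + 1] h t) Ω t := by
      refine (q.hasDerivAt t).hasDerivWithinAt.add ?_
      rw [Function.iterate_succ_apply']
      exact hasDerivWithinAt_prim (continuousOn_prim_iterate hhi j) ht
    have h2 : HasDerivWithinAt x ((derivative q).eval t + prim^[j + 1] h t) Ω t :=
      h1.congr hxq (hxq t ht)
    exact ((uniqueDiffOn_Icc (by norm_num : (-1 : ℝ) < 1)) t ht).eq_deriv _ (hx t ht) h2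
  have hε : ∀ n : ℕ, (0 : ℝ) < 1 / ((n : ℝ) + 1) := fun n => by positivity
  have hlim : Tendsto (fun n : ℕ => 1 / ((n : ℝ) + 1)) atTop (𝓝 0) :=
    tendsto_one_div_add_atTop_nhds_zero_nat
  choose H hH1 hH2 using fun n : ℕ => exists_polynomial_near hh (hε n)
  have hiter : ∀ (i : ℕ) (t : ℝ), t ∈ Ω →
      Tendsto (fun n => (antideriv^[i + 1] (H n)).eval t) atTop (𝓝 (prim^[i + 1] h t)) := by
    intro i t ht
    rw [tendsto_iff_norm_sub_tendsto_zero]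
    refine squeeze_zero (g := fun n : ℕ => 2 ^ i * (4 * (1 / ((n : ℝ) + 1))))
      (fun n => norm_nonneg _) (fun n => ?_) ?_
    · have := abs_prim_iterate_sub_le
        (integrableOn_of_continuousOn (H n).continuous.continuousOn) hhi i t ht
      rw [prim_iterate_eval] at this
      exact this.trans (mul_le_mul_of_nonneg_left (hH1 n) (by positivity))
    · simpa using (hlim.const_mul 4).const_mul (2 ^ i)
  refine ⟨fun n => q + antideriv^[j + 1 + 1] (H n), fun t ht => ?_, fun t ht => ?_,
    fun n => (1 + 1 / ((n : ℝ) + 1)) * (∫ t in Ω, h t ^ 2) +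
      (1 + 1 / ((n : ℝ) + 1)) * (6 * (1 / ((n : ℝ) + 1))), ?_, fun n => ?_⟩
  · simp only [eval_add, hxq t ht]
    exact (hiter (j + 1) t ht).const_add _
  · simp only [derivative_add, eval_add, hxq' t ht, Function.iterate_succ_apply' antideriv (j + 1),
      derivative_antideriv]
    exact (hiter j t ht).const_add _
  rotate_left
  · rw [iterate_map_add, hq, zero_add, derivative_iterate_antideriv_iterate]
    exact hH2 n
  · have h1 : Tendsto (fun n : ℕ => 1 + 1 / ((n : ℝ) + 1)) atTop (𝓝 (1 + 0)) := hlim.const_add 1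
    have h2 := (h1.mul_const (∫ t in Ω, h t ^ 2)).add (h1.mul (hlim.const_mul 6))
    simpa using h2

/-- The three collocation defects of a function with a square integrable weak derivative of order
`k + 1`, where `1 ≤ k ≤ N`. -/
theorem defects_le {N k : ℕ} (hN : 1 ≤ N) (hk : 1 ≤ k) (hkN : k ≤ N) {x x' h : ℝ → ℝ}
    (hx : ∀ t ∈ Ω, HasDerivWithinAt x (x' t) Ω t) (hh : MemLp h 2 (volume.restrict Ω))
    (hw : ∀ φ, IsTest φ →
      ∫ t in Ω, iteratedDeriv (k + 1) φ t * x t = (-1) ^ (k + 1) * ∫ t in Ω, φ t * h t) :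
    weightedSq (stateDefect N x x') ≤
        540 * N * ((Real.exp 1 / N) ^ k) ^ 2 * ∫ t in Ω, h t ^ 2 ∧
      weightedSq (costateDefect N x x') ≤
        540 * N * ((Real.exp 1 / N) ^ k) ^ 2 * ∫ t in Ω, h t ^ 2 ∧
      quadDefect N x x' ^ 2 ≤ 540 * N * ((Real.exp 1 / N) ^ k) ^ 2 * ∫ t in Ω, h t ^ 2 := by
  obtain ⟨X, hX, hX', b, hb, hXb⟩ := exists_polynomial_approx hk hx hh hw
  have hbound : ∀ n, 540 * (N : ℝ) *
      ((Real.exp 1 / N) ^ k * polyNorm (derivative^[k + 1] (X n))) ^ 2 ≤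
      540 * N * ((Real.exp 1 / N) ^ k) ^ 2 * b n := by
    intro n
    rw [mul_pow, polyNorm_sq, ← mul_assoc]
    exact mul_le_mul_of_nonneg_left (hXb n) (by positivity)
  have hb' := hb.const_mul (540 * N * ((Real.exp 1 / N) ^ k) ^ 2)
  have hnode : ∀ j, node N j ∈ Ω := by
    intro j
    refine Fin.cases ?_ (fun j => Fin.lastCases ?_ (fun j => ?_) j) j
    · rw [node_zero]; simp [Ω]
    · rw [Fin.succ_last, node_last]; simp [Ω]
    · rw [Fin.succ_castSucc, ← Fin.succ_castSucc, node_castSucc_succ]; exact gaussPoint_mem_Icc N j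
  have hτ : ∀ i, gaussPoint N i ∈ Ω := fun i => gaussPoint_mem_Icc N i
  refine ⟨?_, ?_, ?_⟩
  · refine le_of_tendsto_of_tendsto' (f := fun n => weightedSq (stateDefect N (X n).eval
      (derivative (X n)).eval)) ?_ hb' fun n =>
      ((defects_polynomial_le hN hk hkN (X n) rfl).1).trans (hbound n)
    refine tendsto_finsetSum _ fun i _ => Tendsto.const_mul _ (Tendsto.pow ?_ 2)
    exact (tendsto_finsetSum _ fun j _ => (hX _ (hnode _)).const_mul _).sub (hX' _ (hτ i))
  · refine le_of_tendsto_of_tendsto' (f := fun n => weightedSq (costateDefect N (X n).eval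
      (derivative (X n)).eval)) ?_ hb' fun n =>
      ((defects_polynomial_le hN hk hkN (X n) rfl).2.1).trans (hbound n)
    refine tendsto_finsetSum _ fun i _ => Tendsto.const_mul _ (Tendsto.pow ?_ 2)
    exact (tendsto_finsetSum _ fun j _ => (hX _ (hnode _)).const_mul _).sub (hX' _ (hτ i))
  · refine le_of_tendsto_of_tendsto' (f := fun n => quadDefect N (X n).eval
      (derivative (X n)).eval ^ 2) ?_ hb' fun n =>
      ((defects_polynomial_le hN hk hkN (X n) rfl).2.2).trans (hbound n)
    refine Tendsto.pow ?_ 2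
    exact ((hX _ (by simp [Ω])).sub (hX _ (by simp [Ω]))).sub
      (tendsto_finsetSum _ fun j _ => (hX' _ (hτ j)).const_mul _)

end GaussCollocation

namespace GaussCollocation

/-! ### Vector-valued functions -/

/-- The defining property of the chosen weak derivative. -/
lemma MemSobolev.weakDeriv_spec {n p k : ℕ} {g : ℝ → Vec n} (hg : MemSobolev p g) (hk : k ≤ p) :
    MemLp (weakDeriv k g) 2 (volume.restrict Ω) ∧ HasWeakDeriv k g (weakDeriv k g) := by
  have h := hg.2 k hk
  rw [weakDeriv, dif_pos h]
  exact h.choose_spec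

lemma integral_sq_weakDeriv_le {n : ℕ} (p : ℕ) (g : ℝ → Vec n) :
    ∫ t in Ω, ‖weakDeriv p g t‖ ^ 2 ≤ sobolevNorm p g ^ 2 := by
  rw [sobolevNorm, Real.sq_sqrt (Finset.sum_nonneg fun k _ => by positivity)]
  exact Finset.single_le_sum (f := fun k => ∫ t in Ω, ‖weakDeriv k g t‖ ^ 2)
    (fun k _ => by positivity) (Finset.mem_range.2 (Nat.lt_succ_self p))

lemma sobolevNorm_nonneg {n : ℕ} (p : ℕ) (g : ℝ → Vec n) : 0 ≤ sobolevNorm p g :=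
  Real.sqrt_nonneg _

lemma integral_apply {n : ℕ} {F : ℝ → Vec n} (hF : IntegrableOn F Ω) (i : Fin n) :
    (∫ t in Ω, F t) i = ∫ t in Ω, F t i :=
  ((EuclideanSpace.proj (𝕜 := ℝ) i).integral_comp_comm hF).symm

lemma component_weakDeriv {n p : ℕ} {g h : ℝ → Vec n} (hg : IntegrableOn g Ω)
    (hh : IntegrableOn h Ω) (hw : HasWeakDeriv p g h) (i : Fin n) (φ : ℝ → ℝ) (hφ : IsTest φ) :
    ∫ t in Ω, iteratedDeriv p φ t * g t i = (-1) ^ p * ∫ t in Ω, φ t * h t i := by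
  have h1 := congrArg (fun v : Vec n => v i)
    (hw φ hφ.contDiff hφ.hasCompactSupport hφ.tsupport_subset)
  simp only [PiLp.smul_apply, smul_eq_mul] at h1
  rw [integral_apply (hg.continuousOn_smul (hφ.isTest_iteratedDeriv p).continuous.continuousOn
    isCompact_Icc), integral_apply (hh.continuousOn_smul hφ.continuous.continuousOn
    isCompact_Icc)] at h1
  simpa only [PiLp.smul_apply, smul_eq_mul] using h1

/-- The rate of the collocation defects, for a vector-valued function of class `H^{k+1}`. -/
lemma vector_defects_le {n N k η : ℕ} (hN : 1 ≤ N) (hk : 1 ≤ k) (hkN : k ≤ N) (hkη : k + 1 ≤ η)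
    {g g' : ℝ → Vec n} (hg : ∀ t ∈ Ω, HasDerivWithinAt g (g' t) Ω t) (hs : MemSobolev η g) :
    omegaNorm (fun i => (∑ j : Fin (N + 1), diffMatrix N i j • g (node N j.castSucc)) -
        g' (gaussPoint N i)) ≤
      24 * (Real.sqrt N * (Real.exp 1 / N) ^ k) * sobolevNorm (k + 1) g ∧
    omegaNorm (fun i => (∑ j : Fin (N + 1), adjMatrix N i j • g (node N j.succ)) -
        g' (gaussPoint N i)) ≤
      24 * (Real.sqrt N * (Real.exp 1 / N) ^ k) * sobolevNorm (k + 1) g ∧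
    ‖g 1 - g (-1) - ∑ i, gaussWeight N i • g' (gaussPoint N i)‖ ≤
      24 * (Real.sqrt N * (Real.exp 1 / N) ^ k) * sobolevNorm (k + 1) g := by
  have : IsFiniteMeasure (volume.restrict Ω) := ⟨by simp [Ω]⟩
  obtain ⟨hL, hw⟩ := hs.weakDeriv_spec hkη
  set h := weakDeriv (k + 1) g with hh
  have hgc : ContinuousOn g Ω := fun t ht => (hg t ht).continuousWithinAt
  have hgi : IntegrableOn g Ω := hgc.integrableOn_Icc
  have hhi : IntegrableOn h Ω := hL.integrable (by norm_num)
  have hLi : ∀ i, MemLp (fun t => h t i) 2 (volume.restrict Ω) := fun i =>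
    (EuclideanSpace.proj (𝕜 := ℝ) i).comp_memLp' hL
  set A : ℝ := 540 * N * ((Real.exp 1 / N) ^ k) ^ 2 with hA
  have hA0 : 0 ≤ A := by positivity
  have key := fun i : Fin n => defects_le hN hk hkN
    (x := fun t => g t i) (x' := fun t => g' t i) (h := fun t => h t i)
    (fun t ht => (EuclideanSpace.proj (𝕜 := ℝ) i).hasFDerivAt.comp_hasDerivWithinAt t (hg t ht))
    (hLi i) (component_weakDeriv hgi hhi hw i)
  have hsum : ∑ i, ∫ t in Ω, h t i ^ 2 = ∫ t in Ω, ‖h t‖ ^ 2 := by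
    rw [← integral_finsetSum _ fun i _ => (hLi i).integrable_sq]
    simp only [EuclideanSpace.real_norm_sq_eq]
  have htot : A * ∑ i, ∫ t in Ω, h t i ^ 2 ≤
      (24 * (Real.sqrt N * (Real.exp 1 / N) ^ k) * sobolevNorm (k + 1) g) ^ 2 := by
    rw [hsum, mul_pow, mul_pow, mul_pow, Real.sq_sqrt (Nat.cast_nonneg N)]
    refine (mul_le_mul_of_nonneg_left (integral_sq_weakDeriv_le (k + 1) g) hA0).trans ?_
    refine mul_le_mul_of_nonneg_right ?_ (sq_nonneg _)
    rw [hA, mul_assoc]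
    exact mul_le_mul_of_nonneg_right (by norm_num) (by positivity)
  have hR : 0 ≤ 24 * (Real.sqrt N * (Real.exp 1 / N) ^ k) * sobolevNorm (k + 1) g :=
    mul_nonneg (by positivity) (sobolevNorm_nonneg _ _)
  have homega : ∀ z : Fin N → Vec n, ∑ i, gaussWeight N i * ‖z i‖ ^ 2 =
      ∑ l, weightedSq (fun i => z i l) := by
    intro z
    simp only [weightedSq, EuclideanSpace.real_norm_sq_eq, Finset.mul_sum]
    exact Finset.sum_comm
  rw [Finset.mul_sum] at htot
  refine ⟨?_, ?_, ?_⟩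
  · refine Real.sqrt_le_iff.2 ⟨hR, ?_⟩
    rw [homega]
    refine (Finset.sum_le_sum fun l _ => ?_).trans htot
    refine le_trans (le_of_eq (congrArg weightedSq (funext fun i => ?_))) (key l).1
    simp [stateDefect]
  · refine Real.sqrt_le_iff.2 ⟨hR, ?_⟩
    rw [homega]
    refine (Finset.sum_le_sum fun l _ => ?_).trans htot
    refine le_trans (le_of_eq (congrArg weightedSq (funext fun i => ?_))) (key l).2.1
    simp [costateDefect]
  · refine abs_le_of_sq_le_sq' ?_ hR |>.2
    rw [EuclideanSpace.real_norm_sq_eq]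
    refine (Finset.sum_le_sum fun l _ => ?_).trans htot
    refine le_trans (le_of_eq ?_) (key l).2.2
    simp [quadDefect]

/-- Absorbing the constants into the base of the power. -/
lemma rate_le {N k : ℕ} (hN : 1 ≤ N) (hk : 1 ≤ k) :
    48 * (Real.sqrt N * (Real.exp 1 / N) ^ k) ≤
      (9216 * Real.exp 1 / (N : ℝ)) ^ (((k + 1 : ℕ) : ℝ) - 3 / 2) := by
  have hN0 : (0 : ℝ) < N := by exact_mod_cast hN
  have hk1 : (1 : ℝ) ≤ k := by exact_mod_cast hk
  have hb : 0 < Real.exp 1 / (N : ℝ) := div_pos (Real.exp_pos 1) hN0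
  have hs : (((k + 1 : ℕ) : ℝ) - 3 / 2) = (k : ℝ) - 1 / 2 := by push_cast; ring
  have h1 : (Real.exp 1 / (N : ℝ)) ^ k =
      (Real.exp 1 / (N : ℝ)) ^ ((k : ℝ) - 1 / 2) * Real.sqrt (Real.exp 1 / N) := by
    rw [Real.sqrt_eq_rpow, ← Real.rpow_add hb, sub_add_cancel, Real.rpow_natCast]
  have h2 : Real.sqrt N * Real.sqrt (Real.exp 1 / N) ≤ 2 := by
    rw [← Real.sqrt_mul hN0.le, mul_div_cancel₀ _ hN0.ne']
    refine Real.sqrt_le_iff.2 ⟨by norm_num, ?_⟩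
    linarith [Real.exp_one_lt_d9]
  have h3 : (96 : ℝ) ≤ 9216 ^ ((k : ℝ) - 1 / 2) := by
    calc (96 : ℝ) = 9216 ^ (1 / 2 : ℝ) := by
          rw [← Real.sqrt_eq_rpow, show (9216 : ℝ) = 96 ^ 2 by norm_num,
            Real.sqrt_sq (by norm_num)]
      _ ≤ _ := Real.rpow_le_rpow_of_exponent_le (by norm_num) (by linarith)
  rw [hs, mul_div_assoc, Real.mul_rpow (by norm_num) hb.le, h1]
  have hpos : 0 ≤ (Real.exp 1 / (N : ℝ)) ^ ((k : ℝ) - 1 / 2) := Real.rpow_nonneg hb.le _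
  calc 48 * (Real.sqrt N * ((Real.exp 1 / (N : ℝ)) ^ ((k : ℝ) - 1 / 2) *
        Real.sqrt (Real.exp 1 / N)))
      = 48 * (Real.sqrt N * Real.sqrt (Real.exp 1 / N)) *
        (Real.exp 1 / (N : ℝ)) ^ ((k : ℝ) - 1 / 2) := by ring
    _ ≤ 96 * (Real.exp 1 / (N : ℝ)) ^ ((k : ℝ) - 1 / 2) :=
        mul_le_mul_of_nonneg_right (by linarith) hpos
    _ ≤ _ := mul_le_mul_of_nonneg_right h3 hpos

end GaussCollocation

namespace GaussCollocation
open Filter Topology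

/-! ### Perturbation of a trajectory -/

lemma HasDerivWithinAt.Ici_of_Ω {E : Type*} [NormedAddCommGroup E] [NormedSpace ℝ E]
    {g : ℝ → E} {g' : E} {t : ℝ} (ht : t ∈ Set.Ico (-1 : ℝ) 1) (h : HasDerivWithinAt g g' Ω t) :
    HasDerivWithinAt g g' (Set.Ici t) t :=
  h.mono_of_mem_nhdsWithin <| mem_of_superset (Icc_mem_nhdsGE ht.2)
    (Set.Icc_subset_Icc_left ht.1)

/-- A bounded, globally Lipschitz field has a solution on `Ω` that vanishes at `-1`. -/
lemma exists_solution {E : Type*} [NormedAddCommGroup E] [NormedSpace ℝ E] [CompleteSpace E]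
    {G : ℝ → E → E} {K L : NNReal} (hlip : ∀ t ∈ Ω, LipschitzWith K (G t))
    (hc : ∀ y, ContinuousOn (fun t => G t y) Ω) (hL : ∀ t ∈ Ω, ∀ y, ‖G t y‖ ≤ L) :
    ∃ δ : ℝ → E, δ (-1) = 0 ∧ ∀ t ∈ Ω, HasDerivWithinAt δ (G t (δ t)) Ω t := by
  have hp : IsPicardLindelof G (tmin := -1) (tmax := 1) ⟨-1, by norm_num⟩ 0 (2 * L) 0 L K :=
    { lipschitzOnWith := fun t ht => (hlip t ht).lipschitzOnWith
      continuousOn := fun y _ => hc y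
      norm_le := fun t ht y _ => hL t ht y
      mul_max_le := by
        rw [max_eq_left (by norm_num)]
        push_cast
        linarith }
  exact hp.exists_eq_forall_mem_Icc_hasDerivWithinAt₀

/-- If a field is Lipschitz on a ball about the origin and small at the origin, then the solution
that vanishes at `-1` exists on all of `Ω` and stays small.  The field is first cut off outside the
ball, and Gronwall's inequality shows that the cutoff is never felt. -/
lemma exists_small_solution {E : Type*} [NormedAddCommGroup E] [InnerProductSpace ℝ E]
    [FiniteDimensional ℝ E] {g : ℝ → E → E} {r M β : ℝ} (hr : 0 < r) (hM : 1 ≤ M)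
    (hlip : ∀ t ∈ Ω, ∀ y y', ‖y‖ ≤ r → ‖y'‖ ≤ r → ‖g t y - g t y'‖ ≤ M * ‖y - y'‖)
    (hc : ∀ y, ContinuousOn (fun t => g t y) Ω) (h0 : ∀ t ∈ Ω, ‖g t 0‖ ≤ β)
    (hβ : β * Real.exp (2 * M) ≤ r / 2) :
    ∃ δ : ℝ → E, δ (-1) = 0 ∧ ∀ t ∈ Ω, HasDerivWithinAt δ (g t (δ t)) Ω t ∧
      ‖δ t‖ ≤ β * Real.exp (2 * M) := by
  have hβ0 : 0 ≤ β := (norm_nonneg _).trans (h0 (-1) (by simp [Ω]))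
  let χ : ContDiffBump (0 : E) := ⟨r / 2, r, by positivity, by linarith⟩
  set θ : E → E := fun y => χ y • y with hθ
  have hθ_le : ∀ y, ‖θ y‖ ≤ ‖y‖ := fun y => by
    rw [hθ, norm_smul, Real.norm_of_nonneg χ.nonneg]
    exact mul_le_of_le_one_left (norm_nonneg _) χ.le_one
  have hθ_r : ∀ y, ‖θ y‖ ≤ r := fun y => by
    by_cases hy : ‖y‖ ≤ r
    · exact (hθ_le y).trans hy
    · have : χ y = 0 := χ.zero_of_le_dist (by rw [dist_zero_right]; exact (not_le.1 hy).le)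
      simp only [hθ, this, zero_smul, norm_zero]
      exact hr.le
  have hθ_eq : ∀ y, ‖y‖ ≤ r / 2 → θ y = y := fun y hy => by
    have : χ y = 1 := χ.one_of_mem_closedBall (by simpa using hy)
    simp only [hθ, this, one_smul]
  obtain ⟨Kθ, hKθ⟩ := ContDiff.lipschitzWith_of_hasCompactSupport (𝕂 := ℝ) (n := 1) (f := θ)
    (χ.hasCompactSupport.smul_right) (χ.contDiff.smul contDiff_id) one_ne_zero
  have hgθ : ∀ t ∈ Ω, ∀ y, ‖g t (θ y)‖ ≤ M * ‖θ y‖ + β := fun t ht y => by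
    have h1 := hlip t ht (θ y) 0 (hθ_r y) (by simpa using hr.le)
    rw [sub_zero] at h1
    calc ‖g t (θ y)‖ = ‖(g t (θ y) - g t 0) + g t 0‖ := by rw [sub_add_cancel]
      _ ≤ _ := (norm_add_le _ _).trans (add_le_add h1 (h0 t ht))
  obtain ⟨δ, hδ0, hδ⟩ := exists_solution (G := fun t y => g t (θ y))
    (K := M.toNNReal * Kθ) (L := (M * r + β).toNNReal)
    (fun t ht => LipschitzWith.of_dist_le_mul fun y y' => by
      rw [dist_eq_norm, NNReal.coe_mul, Real.coe_toNNReal _ (by linarith), mul_assoc]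
      refine (hlip t ht _ _ (hθ_r y) (hθ_r y')).trans
        (mul_le_mul_of_nonneg_left ?_ (by linarith))
      rw [← dist_eq_norm]
      exact hKθ.dist_le_mul y y')
    (fun y => hc (θ y))
    (fun t ht y => by
      rw [Real.coe_toNNReal _ (by positivity)]
      exact (hgθ t ht y).trans (by gcongr; exact hθ_r y))
  have hbound : ∀ t ∈ Ω, ‖δ t‖ ≤ β * Real.exp (2 * M) := by
    intro t ht
    have h1 := norm_le_gronwallBound_of_norm_deriv_right_le (f := δ) (δ := 0) (K := M) (ε := β)
      (a := -1) (b := 1) (fun t ht => (hδ t ht).continuousWithinAt)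
      (fun t ht => HasDerivWithinAt.Ici_of_Ω ht (hδ t ⟨ht.1, ht.2.le⟩)) (by rw [hδ0, norm_zero])
      (fun t ht => (hgθ t ⟨ht.1, ht.2.le⟩ _).trans (by gcongr; exact hθ_le _)) t ht
    rw [gronwallBound_of_K_ne_0 (by linarith)] at h1
    simp only [zero_mul, zero_add] at h1
    refine h1.trans ?_
    have h2 : β / M ≤ β := div_le_self hβ0 hM
    have h3 : Real.exp (M * (t - -1)) ≤ Real.exp (2 * M) :=
      Real.exp_le_exp.2 (by nlinarith [ht.2])
    have h4 : 1 ≤ Real.exp (M * (t - -1)) := Real.one_le_exp (by nlinarith [ht.1])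
    calc β / M * (Real.exp (M * (t - -1)) - 1) ≤ β * (Real.exp (M * (t - -1)) - 1) :=
          mul_le_mul_of_nonneg_right h2 (by linarith)
      _ ≤ β * Real.exp (2 * M) := mul_le_mul_of_nonneg_left (by linarith) hβ0
  refine ⟨δ, hδ0, fun t ht => ⟨?_, hbound t ht⟩⟩
  have := hδ t ht
  rwa [hθ_eq _ ((hbound t ht).trans hβ)] at this

section Bounds

variable {n m : ℕ} {f : Vec n × Vec m → Vec n} {C : Vec n → ℝ} {x : ℝ → Vec n} {u : ℝ → Vec m}

/-- Uniform first and second order estimates for `f` near the trajectory. -/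
lemma SmoothNear.exists_bounds (h : SmoothNear f C x u) (hx : ContinuousOn x Ω)
    (hu : ContinuousOn u Ω) :
    (∀ t ∈ Ω, DifferentiableAt ℝ f (x t, u t)) ∧
    ContinuousOn (fun t => fderiv ℝ f (x t, u t)) Ω ∧
    ∃ r > 0, ∃ M ≥ 1, ∃ K ≥ 0, ∀ t ∈ Ω,
      (∀ z ∈ Metric.closedBall (x t, u t) r, ∀ z' ∈ Metric.closedBall (x t, u t) r,
        ‖f z - f z'‖ ≤ M * ‖z - z'‖) ∧
      ∀ z ∈ Metric.closedBall (x t, u t) r,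
        ‖f z - f (x t, u t) - fderiv ℝ f (x t, u t) (z - (x t, u t))‖ ≤
          K * ‖z - (x t, u t)‖ ^ 2 := by
  obtain ⟨O, r, hO, hr, hball, ⟨hf, K, hK, -⟩, -⟩ := h
  have hmem : ∀ t ∈ Ω, (x t, u t) ∈ O := fun t ht =>
    hball t ht (Metric.mem_closedBall_self hr.le)
  have hdiff : ∀ z ∈ O, DifferentiableAt ℝ f z := fun z hz =>
    (hf.differentiableOn two_ne_zero).differentiableAt (hO.mem_nhds hz)
  have hcont : ContinuousOn (fun t => fderiv ℝ f (x t, u t)) Ω :=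
    (hf.continuousOn_fderiv_of_isOpen hO (by norm_num)).comp (hx.prodMk hu) hmem
  obtain ⟨M₀, hM₀⟩ := isCompact_Icc.exists_bound_of_continuousOn hcont
  refine ⟨fun t ht => hdiff _ (hmem t ht), hcont, r, hr, max 1 (M₀ + K * r), le_max_left _ _, K,
    K.2, fun t ht => ⟨fun z hz z' hz' => ?_, fun z hz => ?_⟩⟩
  · refine (convex_closedBall (x t, u t) r).norm_image_sub_le_of_norm_fderiv_le (𝕜 := ℝ)
      (fun y hy => hdiff y (hball t ht hy)) (fun y hy => ?_) hz' hz
    refine le_trans ?_ (le_max_right _ _)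
    have h1 := hK.dist_le_mul y (hball t ht hy) _ (hmem t ht)
    rw [dist_eq_norm] at h1
    have h2 : (K : ℝ) * dist y (x t, u t) ≤ K * r := mul_le_mul_of_nonneg_left hy K.2
    calc ‖fderiv ℝ f y‖ = ‖fderiv ℝ f (x t, u t) + (fderiv ℝ f y - fderiv ℝ f (x t, u t))‖ := by
          rw [add_sub_cancel]
      _ ≤ _ := (norm_add_le _ _).trans (add_le_add (hM₀ t ht) (h1.trans h2))
  · have hsub : Metric.closedBall (x t, u t) ‖z - (x t, u t)‖ ⊆ O :=
      (Metric.closedBall_subset_closedBall (by simpa [dist_eq_norm] using hz)).trans (hball t ht)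
    refine ((convex_closedBall (x t, u t) ‖z - (x t, u t)‖).norm_image_sub_le_of_norm_fderiv_le'
      (𝕜 := ℝ) (C := K * ‖z - (x t, u t)‖) (fun y hy => hdiff y (hsub hy)) (fun y hy => ?_)
      (Metric.mem_closedBall_self (norm_nonneg _))
      (by rw [Metric.mem_closedBall, dist_eq_norm])).trans_eq (by ring)
    have h1 := hK.dist_le_mul y (hsub hy) _ (hmem t ht)
    rw [dist_eq_norm] at h1
    exact h1.trans (mul_le_mul_of_nonneg_left hy K.2)

lemma inner_gradX {a : Vec n} {b : Vec m} (l : Vec n) (hf : DifferentiableAt ℝ f (a, b))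
    (d : Vec n) : inner ℝ (gradX f a b l) d = inner ℝ l (fderiv ℝ f (a, b) (d, 0)) := by
  have h1 : HasFDerivAt (fun y => f (y, b))
      ((fderiv ℝ f (a, b)).comp (ContinuousLinearMap.inl ℝ (Vec n) (Vec m))) a :=
    hf.hasFDerivAt.comp a (hasFDerivAt_prodMk_left a b)
  have h2 : HasFDerivAt (fun y => hamiltonian f y b l) ((innerSL ℝ l).comp
      ((fderiv ℝ f (a, b)).comp (ContinuousLinearMap.inl ℝ (Vec n) (Vec m)))) a :=
    (innerSL ℝ l).hasFDerivAt.comp a h1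
  rw [gradX, gradient, h2.fderiv, InnerProductSpace.toDual_symm_apply]
  simp

lemma inner_gradU {a : Vec n} {b : Vec m} (l : Vec n) (hf : DifferentiableAt ℝ f (a, b))
    (d : Vec m) : inner ℝ (gradU f a b l) d = inner ℝ l (fderiv ℝ f (a, b) (0, d)) := by
  have h1 : HasFDerivAt (fun y => f (a, y))
      ((fderiv ℝ f (a, b)).comp (ContinuousLinearMap.inr ℝ (Vec n) (Vec m))) b :=
    hf.hasFDerivAt.comp b (hasFDerivAt_prodMk_right a b)
  have h2 : HasFDerivAt (fun y => hamiltonian f a y l) ((innerSL ℝ l).comp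
      ((fderiv ℝ f (a, b)).comp (ContinuousLinearMap.inr ℝ (Vec n) (Vec m)))) b :=
    (innerSL ℝ l).hasFDerivAt.comp b h1
  rw [gradU, gradient, h2.fderiv, InnerProductSpace.toDual_symm_apply]
  simp

end Bounds

end GaussCollocation

namespace GaussCollocation
open Filter Topology

/-! ### The minimum principle -/

section MinimumPrinciple

variable {n m : ℕ} {f : Vec n × Vec m → Vec n} {C : Vec n → ℝ} {U : Set (Vec m)} {x₀ : Vec n}
  {x : ℝ → Vec n} {u : ℝ → Vec m} {l : ℝ → Vec n}

lemma IsFeasible.hasDerivWithinAt (h : IsFeasible f U x₀ x u) {t : ℝ} (ht : t ∈ Ω) :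
    HasDerivWithinAt x (f (x t, u t)) Ω t := by
  rw [← h.dynamics t ht]
  exact ((h.contDiffOn_state.differentiableOn one_ne_zero) t ht).hasDerivWithinAt

lemma uniqueDiffOn_Ω : UniqueDiffOn ℝ Ω := uniqueDiffOn_Icc (by norm_num)

lemma IsFeasible.of_hasDerivWithinAt {y : ℝ → Vec n} {v : ℝ → Vec m} (hf : Continuous f)
    (hy : ∀ t ∈ Ω, HasDerivWithinAt y (f (y t, v t)) Ω t) (hv : ContinuousOn v Ω)
    (hU : ∀ t ∈ Ω, v t ∈ U) (h0 : y (-1) = x₀) : IsFeasible f U x₀ y v where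
  contDiffOn_state := by
    rw [contDiffOn_one_iff_derivWithin uniqueDiffOn_Ω]
    refine ⟨fun t ht => (hy t ht).differentiableWithinAt, ?_⟩
    have hyc : ContinuousOn y Ω := fun t ht => (hy t ht).continuousWithinAt
    exact (hf.comp_continuousOn (hyc.prodMk hv)).congr fun t ht =>
      (hy t ht).derivWithin (uniqueDiffOn_Ω t ht)
  continuousOn_control := hv
  initial := h0
  control_mem := hU
  dynamics t ht := (hy t ht).derivWithin (uniqueDiffOn_Ω t ht)

lemma SmoothNear.differentiableAt_cost (h : SmoothNear f C x u) : DifferentiableAt ℝ C (x 1) := by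
  obtain ⟨O, r, -, hr, -, -, hC, -⟩ := h
  exact (hC.differentiableOn two_ne_zero).differentiableAt (Metric.ball_mem_nhds _ hr)

lemma SmoothNear.continuousOn_inner_gradU (h : SmoothNear f C x u) (hx : ContinuousOn x Ω)
    (hu : ContinuousOn u Ω) (hl : ContinuousOn l Ω) {v : ℝ → Vec m} (hv : ContinuousOn v Ω) :
    ContinuousOn (fun t => (inner ℝ (gradU f (x t) (u t) (l t)) (v t) : ℝ)) Ω := by
  obtain ⟨hd, hc, -⟩ := h.exists_bounds hx hu
  have h1 : ContinuousOn (fun t => (inner ℝ (l t) (fderiv ℝ f (x t, u t) (0, v t)) : ℝ)) Ω :=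
    hl.inner (hc.clm_apply (continuousOn_const.prodMk hv))
  exact h1.congr fun t ht => inner_gradU _ (hd t ht) _

/-- First order optimality: the first variation of the cost in an admissible direction is
nonnegative. -/
lemma integral_inner_gradU_nonneg (hf : Continuous f) (hmin : IsLocalMinimizer f C U x₀ x u)
    (hs : SmoothNear f C x u) (hl : IsCostate f C x u l) {v : ℝ → Vec m} (hv : ContinuousOn v Ω)
    {ε₀ : ℝ} (hε₀ : 0 < ε₀) (hadm : ∀ ε, 0 < ε → ε ≤ ε₀ → ∀ t ∈ Ω, u t + ε • v t ∈ U) :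
    0 ≤ ∫ t in Ω, (inner ℝ (gradU f (x t) (u t) (l t)) (v t) : ℝ) := by
  obtain ⟨hfeas, e, he, hopt⟩ := hmin
  have hu := hfeas.continuousOn_control
  have hx : ContinuousOn x Ω := hfeas.contDiffOn_state.continuousOn
  have hlc : ContinuousOn l Ω := fun t ht => (hl.1 t ht).continuousWithinAt
  have hbc := hs.continuousOn_inner_gradU hx hu hlc hv
  set b : ℝ → ℝ := fun t => inner ℝ (gradU f (x t) (u t) (l t)) (v t) with hb
  obtain ⟨hdiff, -, r, hr, M, hM, K, hK, hest⟩ := hs.exists_bounds hx hu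
  obtain ⟨V₀, hV₀⟩ := isCompact_Icc.exists_bound_of_continuousOn hv
  obtain ⟨L₀, hL₀⟩ := isCompact_Icc.exists_bound_of_continuousOn hlc
  by_contra hneg
  set I := ∫ t in Ω, b t with hI
  have hI0 : I < 0 := not_le.1 hneg
  set V := max 1 V₀ with hVdef
  have hV1 : 1 ≤ V := le_max_left _ _
  have hV : ∀ t ∈ Ω, ‖v t‖ ≤ V := fun t ht => (hV₀ t ht).trans (le_max_right _ _)
  set L := max 0 L₀ with hLdef
  have hL0 : 0 ≤ L := le_max_left _ _
  have hL : ∀ t ∈ Ω, ‖l t‖ ≤ L := fun t ht => (hL₀ t ht).trans (le_max_right _ _)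
  set D := M * V * Real.exp (2 * M) with hD
  have hD0 : 0 < D := by positivity
  set Q := L * (K * (D + V) ^ 2) with hQ
  have hQ0 : 0 ≤ Q := by positivity
  set κ := -I / (4 * D) with hκ
  have hκ0 : 0 < κ := div_pos (by linarith) (by positivity)
  obtain ⟨rC, hrC, hC⟩ := Metric.eventually_nhds_iff.1
    ((hasFDerivAt_iff_isLittleO_nhds_zero.1 hs.differentiableAt_cost.hasFDerivAt).def hκ0)
  have small : ∀ c d : ℝ, 0 < d → ∀ᶠ ε in 𝓝[>] (0 : ℝ), c * ε < d := fun c d hd => by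
    have : Tendsto (fun ε : ℝ => c * ε) (𝓝[>] 0) (𝓝 (c * 0)) :=
      (tendsto_id.mono_left nhdsWithin_le_nhds).const_mul c
    rw [mul_zero] at this
    exact this.eventually (gt_mem_nhds hd)
  have hpos : ∀ᶠ ε in 𝓝[>] (0 : ℝ), 0 < ε := self_mem_nhdsWithin
  obtain ⟨ε, hε, h1, h2, h3, h4, h5, h6, h7, h8⟩ := (hpos.and <| (small 1 ε₀ hε₀).and <|
    (small D (r / 2) (by positivity)).and <| (small V r hr).and <| (small D e he).and <|
    (small (M * (D + V)) e he).and <| (small V e he).and <| (small D rC hrC).and <|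
    small (2 * Q) (-I / 4) (by linarith)).exists
  rw [one_mul] at h1
  have hεv : ∀ t ∈ Ω, ‖ε • v t‖ ≤ V * ε := fun t ht => by
    rw [norm_smul, Real.norm_of_nonneg hε.le, mul_comm]
    exact mul_le_mul_of_nonneg_right (hV t ht) hε.le
  have hVε : 0 ≤ V * ε := by positivity
  have hmem : ∀ t ∈ Ω, ∀ y : Vec n, ‖y‖ ≤ r →
      (x t + y, u t + ε • v t) ∈ Metric.closedBall (x t, u t) r := fun t ht y hy => by
    rw [Metric.mem_closedBall, dist_eq_norm, Prod.mk_sub_mk, add_sub_cancel_left,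
      add_sub_cancel_left]
    exact max_le hy ((hεv t ht).trans h3.le)
  have hself : ∀ t, (x t, u t) ∈ Metric.closedBall (x t, u t) r := fun t =>
    Metric.mem_closedBall_self hr.le
  -- The state perturbation caused by the control perturbation `ε v`.
  obtain ⟨δ, hδ0, hδ⟩ := exists_small_solution
    (g := fun t y => f (x t + y, u t + ε • v t) - f (x t, u t)) (β := M * V * ε) hr hM
    (fun t ht y y' hy hy' => by
      rw [sub_sub_sub_cancel_right]
      refine ((hest t ht).1 _ (hmem t ht y hy) _ (hmem t ht y' hy')).trans (le_of_eq ?_)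
      rw [Prod.mk_sub_mk, sub_self, add_sub_add_left_eq_sub, Prod.norm_mk, norm_zero,
        max_eq_left (norm_nonneg _)])
    (fun y => (hf.comp_continuousOn ((hx.add continuousOn_const).prodMk
      (hu.add (hv.const_smul ε)))).sub (hf.comp_continuousOn (hx.prodMk hu)))
    (fun t ht => by
      refine ((hest t ht).1 _ (hmem t ht 0 (by simpa using hr.le)) _ (hself t)).trans ?_
      rw [Prod.mk_sub_mk, add_sub_cancel_left, add_sub_cancel_left, Prod.norm_mk, norm_zero,
        max_eq_right (norm_nonneg _), mul_assoc]
      exact mul_le_mul_of_nonneg_left (hεv t ht) (by linarith))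
    (by rw [mul_right_comm]; exact h2.le)
  have hδn : ∀ t ∈ Ω, ‖δ t‖ ≤ D * ε := fun t ht => by
    have := (hδ t ht).2
    rwa [mul_right_comm] at this
  have hδr : ∀ t ∈ Ω, ‖δ t‖ ≤ r := fun t ht => (hδn t ht).trans (by linarith)
  have hpair : ∀ t ∈ Ω, ‖((x t + δ t, u t + ε • v t) : Vec n × Vec m) - (x t, u t)‖ ≤
      (D + V) * ε := fun t ht => by
    rw [Prod.mk_sub_mk, add_sub_cancel_left, add_sub_cancel_left]
    refine max_le ((hδn t ht).trans ?_) ((hεv t ht).trans ?_)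
    · nlinarith
    · nlinarith [mul_pos hD0 hε]
  have hfd : ∀ t ∈ Ω, ‖f (x t + δ t, u t + ε • v t) - f (x t, u t)‖ ≤ M * (D + V) * ε :=
    fun t ht => by
      rw [mul_assoc]
      exact ((hest t ht).1 _ (hmem t ht _ (hδr t ht)) _ (hself t)).trans
        (mul_le_mul_of_nonneg_left (hpair t ht) (by linarith))
  have hyd : ∀ t ∈ Ω, HasDerivWithinAt (fun t => x t + δ t)
      (f (x t + δ t, u t + ε • v t)) Ω t := fun t ht => by
    have := (hfeas.hasDerivWithinAt ht).add (hδ t ht).1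
    rwa [add_sub_cancel] at this
  have hyf : IsFeasible f U x₀ (fun t => x t + δ t) (fun t => u t + ε • v t) :=
    IsFeasible.of_hasDerivWithinAt hf hyd (hu.add (hv.const_smul ε)) (hadm ε hε h1.le)
      (by rw [hδ0, add_zero, hfeas.initial])
  have hcost := hopt _ _ hyf fun t ht => by
    refine ⟨?_, ?_, ?_⟩
    · rw [add_sub_cancel_left]
      exact (hδn t ht).trans_lt h4
    · rw [hyf.dynamics t ht, hfeas.dynamics t ht]
      exact (hfd t ht).trans_lt h5
    · rw [add_sub_cancel_left]
      exact (hεv t ht).trans_lt h6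
  have h1Ω : (1 : ℝ) ∈ Ω := by simp [Ω]
  have hC1 := hC (y := δ 1) (by rw [dist_zero_right]; exact (hδn 1 h1Ω).trans_lt h7)
  have hgrad : fderiv ℝ C (x 1) (δ 1) = inner ℝ (l 1) (δ 1) := by
    rw [hl.2, gradient, InnerProductSpace.toDual_symm_apply]
  rw [hgrad] at hC1
  -- The pairing of the costate with the perturbation grows at the rate `ε b + O(ε²)`.
  have hbi : IntegrableOn b Ω := integrableOn_of_continuousOn hbc
  have hpd : ∀ t ∈ Ω, HasDerivWithinAt (fun t => (inner ℝ (l t) (δ t) : ℝ))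
      (inner ℝ (l t) (f (x t + δ t, u t + ε • v t) - f (x t, u t)) +
        inner ℝ (-gradX f (x t) (u t) (l t)) (δ t)) Ω t := fun t ht =>
    (hl.1 t ht).inner ℝ (hδ t ht).1
  have hBd : ∀ t ∈ Ω, HasDerivWithinAt (fun t => ε * prim b t + Q * ε ^ 2 * (t + 1))
      (ε * b t + Q * ε ^ 2 * 1) Ω t := fun t ht =>
    ((hasDerivWithinAt_prim hbc ht).const_mul ε).add
      (((hasDerivAt_id t).add_const 1).const_mul (Q * ε ^ 2)).hasDerivWithinAt
  have hle := image_le_of_deriv_right_le_deriv_boundary (a := (-1 : ℝ)) (b := 1)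
    (fun t ht => (hpd t ht).continuousWithinAt)
    (fun t ht => HasDerivWithinAt.Ici_of_Ω ht (hpd t ⟨ht.1, ht.2.le⟩))
    (B := fun t => ε * prim b t + Q * ε ^ 2 * (t + 1))
    (by simp [hδ0, prim])
    (fun t ht => (hBd t ht).continuousWithinAt)
    (fun t ht => HasDerivWithinAt.Ici_of_Ω ht (hBd t ⟨ht.1, ht.2.le⟩))
    (fun t ht => by
      have ht' : t ∈ Ω := ⟨ht.1, ht.2.le⟩
      set R := f (x t + δ t, u t + ε • v t) - f (x t, u t) -
        fderiv ℝ f (x t, u t) ((x t + δ t, u t + ε • v t) - (x t, u t)) with hR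
      have hRn : ‖R‖ ≤ K * ((D + V) * ε) ^ 2 :=
        ((hest t ht').2 _ (hmem t ht' _ (hδr t ht'))).trans
          (mul_le_mul_of_nonneg_left (pow_le_pow_left₀ (norm_nonneg _) (hpair t ht') 2) hK)
      have hsplit : ((x t + δ t, u t + ε • v t) : Vec n × Vec m) - (x t, u t) =
          (δ t, 0) + ε • ((0 : Vec n), v t) := by
        ext1 <;> simp
      have hfR : f (x t + δ t, u t + ε • v t) - f (x t, u t) =
          R + (fderiv ℝ f (x t, u t) (δ t, 0) + ε • fderiv ℝ f (x t, u t) (0, v t)) := by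
        rw [← map_smul, ← map_add, ← hsplit, hR, sub_add_cancel]
      rw [hfR, inner_neg_left, inner_gradX _ (hdiff t ht'), inner_add_right, inner_add_right,
        real_inner_smul_right, ← inner_gradU _ (hdiff t ht')]
      change _ + (_ + ε * b t) + _ ≤ _
      have h9 : inner ℝ (l t) R ≤ Q * ε ^ 2 :=
        calc inner ℝ (l t) R ≤ ‖l t‖ * ‖R‖ := real_inner_le_norm _ _
          _ ≤ L * (K * ((D + V) * ε) ^ 2) :=
            mul_le_mul (hL t ht') hRn (norm_nonneg _) hL0
          _ = Q * ε ^ 2 := by rw [hQ]; ring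
      linarith) (show (1 : ℝ) ∈ Set.Icc (-1) 1 from h1Ω)
  have hpI : prim b 1 = I := by rw [hI, setIntegral_Ω]; rfl
  simp only [hpI] at hle
  have h10 := (abs_le.1 hC1).2
  have h11 : κ * ‖δ 1‖ ≤ -I / 4 * ε := by
    calc κ * ‖δ 1‖ ≤ κ * (D * ε) := mul_le_mul_of_nonneg_left (hδn 1 h1Ω) hκ0.le
      _ = -I / 4 * ε := by rw [hκ]; field_simp
  have h12 : 2 * Q * ε * ε < -I / 4 * ε := mul_lt_mul_of_pos_right h8 hε
  have h13 : 0 < -I * ε := mul_pos (by linarith) hε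
  nlinarith

/-- The pointwise minimum principle, in the form of the variational inequality satisfied by the
optimal control. -/
theorem neg_gradU_mem_normalCone (hf : Continuous f) (hU : Convex ℝ U)
    (hmin : IsLocalMinimizer f C U x₀ x u) (hs : SmoothNear f C x u) (hl : IsCostate f C x u l)
    {t : ℝ} (ht : t ∈ Ω) : -gradU f (x t) (u t) (l t) ∈ normalCone U (u t) := by
  refine ⟨hmin.1.control_mem t ht, fun w hw => ?_⟩
  rw [inner_neg_left, neg_nonpos]
  by_contra hneg
  have hu := hmin.1.continuousOn_control
  have hx : ContinuousOn x Ω := hmin.1.contDiffOn_state.continuousOn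
  have hlc : ContinuousOn l Ω := fun t ht => (hl.1 t ht).continuousWithinAt
  have hwc : ContinuousOn (fun t => w - u t) Ω := continuousOn_const.sub hu
  have hac := hs.continuousOn_inner_gradU hx hu hlc hwc
  set a : ℝ → ℝ := fun t => inner ℝ (gradU f (x t) (u t) (l t)) (w - u t) with ha
  -- Move the control towards `w` exactly where this decreases the Hamiltonian.
  set ρ : ℝ → ℝ := fun t => max 0 (-a t) with hρ
  have hρc : ContinuousOn ρ Ω := continuousOn_const.sup hac.neg
  have hρ0 : ∀ t, 0 ≤ ρ t := fun t => le_max_left _ _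
  obtain ⟨R, hR⟩ := isCompact_Icc.exists_bound_of_continuousOn hρc
  have hR1 : 0 < max 1 R := lt_max_of_lt_left one_pos
  have h1 := integral_inner_gradU_nonneg hf hmin hs hl (v := fun t => ρ t • (w - u t))
    (hρc.smul hwc) (ε₀ := (max 1 R)⁻¹) (inv_pos.2 hR1) (fun ε hε hε' s hs' => by
      have h2 : ε * ρ s ≤ 1 := by
        have h3 : ρ s ≤ max 1 R := ((le_abs_self _).trans (hR s hs')).trans (le_max_right _ _)
        calc ε * ρ s ≤ (max 1 R)⁻¹ * max 1 R :=
              mul_le_mul hε' h3 (hρ0 s) (inv_nonneg.2 hR1.le)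
          _ = 1 := inv_mul_cancel₀ hR1.ne'
      rw [smul_smul]
      exact hU.add_smul_sub_mem (hmin.1.control_mem s hs') hw
        ⟨mul_nonneg hε.le (hρ0 s), h2⟩)
  have h4 : ∀ s, (inner ℝ (gradU f (x s) (u s) (l s)) (ρ s • (w - u s)) : ℝ) = -(ρ s ^ 2) := by
    intro s
    rw [real_inner_smul_right]
    change ρ s * a s = _
    rcases le_total (-a s) 0 with h | h
    · simp [hρ, max_eq_left h]
    · simp only [hρ, max_eq_right h]; ring
  simp only [h4] at h1
  rw [setIntegral_Ω, intervalIntegral.integral_neg] at h1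
  have h5 : 0 < ∫ s in (-1 : ℝ)..1, ρ s ^ 2 :=
    intervalIntegral.integral_pos (by norm_num) (hρc.pow 2) (fun s _ => sq_nonneg _)
      ⟨t, ht, pow_pos (lt_max_of_lt_right (by linarith [not_le.1 hneg])) 2⟩
  linarith

end MinimumPrinciple

end GaussCollocation

namespace GaussCollocation

/-! ### The residual of the optimality system -/

lemma omegaNorm_congr {n N : ℕ} {z z' : Fin N → Vec n} (h : ∀ i, z i = z' i) :
    omegaNorm z = omegaNorm z' := by rw [funext h]

lemma supNorm_zero (m N : ℕ) : supNorm (0 : Fin N → Vec m) = 0 := by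
  have : (fun i k => (0 : Fin N → Vec m) i k : Fin N → Fin m → ℝ) = 0 := rfl
  rw [supNorm, this, norm_zero]

end GaussCollocation

theorem lemma4p1 :
    ∃ c : ℝ, 0 < c ∧
      ∀ (n m : ℕ) (f : Vec n × Vec m → Vec n) (C : Vec n → ℝ) (U : Set (Vec m)) (x₀ : Vec n)
        (xs : ℝ → Vec n) (us : ℝ → Vec m) (ls : ℝ → Vec n),
        Continuous f → Continuous C →
        IsClosed U → Convex ℝ U → (interior U).Nonempty →
        IsLocalMinimizer f C U x₀ xs us →
        SmoothNear f C xs us →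
        IsCostate f C xs us ls →
        ∀ η : ℕ, 2 ≤ η → MemSobolev η xs → MemSobolev η ls →
        ∀ N : ℕ, 1 ≤ N →
          yDist
              (residualMap f C x₀ (sampleNodes N xs) (sampleGauss N us) (sampleNodes N ls))
              (inclusionSet U (sampleGauss N us)) ≤
            ENNReal.ofReal
              ((c / (N : ℝ)) ^ (((min η (N + 1) : ℕ) : ℝ) - 3 / 2) *
                (sobolevNorm (min η (N + 1)) xs + sobolevNorm (min η (N + 1)) ls)) := by
  refine ⟨9216 * Real.exp 1, by positivity, ?_⟩
  intro n m f C U x₀ xs us ls hf _ _ hU _ hmin hs hl η hη hxs hls N hN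
  obtain ⟨k, hk⟩ : ∃ k, min η (N + 1) = k + 1 := ⟨min η (N + 1) - 1, by omega⟩
  have hk1 : 1 ≤ k := by omega
  have hkN : k ≤ N := by omega
  have hkη : k + 1 ≤ η := by omega
  rw [hk]
  obtain ⟨hx1, -, hx3⟩ := vector_defects_le hN hk1 hkN hkη
    (fun t ht => hmin.1.hasDerivWithinAt ht) hxs
  obtain ⟨-, hl2, hl3⟩ := vector_defects_le hN hk1 hkN hkη hl.1 hls
  set T := residualMap f C x₀ (sampleNodes N xs) (sampleGauss N us) (sampleNodes N ls) with hT
  -- The stationarity residual lies in the normal cone, so it does not contribute.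
  have hz : (⟨0, 0, 0, 0, 0, 0, T.y6⟩ : YSpace n m N) ∈ inclusionSet U (sampleGauss N us) := by
    refine ⟨rfl, rfl, rfl, rfl, rfl, rfl, fun i => ?_⟩
    have := neg_gradU_mem_normalCone hf hU hmin hs hl (gaussPoint_mem_Icc N i)
    simp only [hT, residualMap, sampleNodes, sampleGauss, node_castSucc_succ]
    exact this
  refine (iInf₂_le _ hz).trans (ENNReal.ofReal_le_ofReal ?_)
  have h0 : T.y0 = 0 := by
    change xs (node N 0) - x₀ = 0
    rw [node_zero, hmin.1.initial, sub_self]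
  have h5 : T.y5 = 0 := by
    change ls (node N (Fin.last (N + 1))) - gradient C (xs (node N (Fin.last (N + 1)))) = 0
    rw [node_last, hl.2, sub_self]
  have h1 : omegaNorm T.y1 ≤ _ := le_trans (le_of_eq (omegaNorm_congr fun i => by
    simp only [hT, residualMap, sampleNodes, sampleGauss, node_castSucc_succ])) hx1
  have h2 : ‖T.y2‖ ≤ _ := le_trans (le_of_eq (by
    simp only [hT, residualMap, sampleNodes, sampleGauss, node_castSucc_succ, node_last,
      node_zero])) hx3
  have h3 : ‖T.y3‖ ≤ _ := le_trans (le_of_eq (by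
    simp only [hT, residualMap, sampleNodes, sampleGauss, node_castSucc_succ, node_last,
      node_zero, smul_neg, Finset.sum_neg_distrib, sub_neg_eq_add])) hl3
  have h4 : omegaNorm T.y4 ≤ _ := le_trans (le_of_eq (omegaNorm_congr fun i => by
    simp only [hT, residualMap, sampleNodes, sampleGauss, node_castSucc_succ,
      sub_neg_eq_add])) hl2
  have hnorm : yNorm (T - ⟨0, 0, 0, 0, 0, 0, T.y6⟩) =
      ‖T.y2‖ + ‖T.y3‖ + omegaNorm T.y1 + omegaNorm T.y4 := by
    change ‖T.y0 - 0‖ + ‖T.y2 - 0‖ + ‖T.y3 - 0‖ + ‖T.y5 - 0‖ + supNorm (T.y6 - T.y6) +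
      omegaNorm (T.y1 - 0) + omegaNorm (T.y4 - 0) = _
    rw [h0, h5, sub_self T.y6, supNorm_zero]
    simp only [sub_zero, norm_zero, zero_add, add_zero]
  rw [hnorm]
  have hrate := mul_le_mul_of_nonneg_right (rate_le hN hk1)
    (add_nonneg (sobolevNorm_nonneg (k + 1) xs) (sobolevNorm_nonneg (k + 1) ls))
  linarith
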